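/- Let $(\Omega,\mathcal F,\mathbb P)$ be a probability space, $X:\Omega\to\mathbb R^d$ and $Y:\Omega\to\mathbb R^p$ random variables, $f:\mathbb R^p\to\mathbb R$ measurable with $\mathbb E[f(Y)^2]<\infty$, and let $\varphi:\mathbb R^q\times\mathbb R^d\to\mathbb R$ be such that, for each $\theta$, $\varphi(\theta,\cdot)$ is measurable and $\mathbb E[\varphi(\theta,X)^2]<\infty$. Let $(X_i)_{i\ge1}$ be iid with the law of $X$; for each $i$, given $X_i=x$, let $(Y_i^{(k)})_{k\ge1}$ be iid with the conditional law $\mathcal L(Y\mid X=x)$, the blocks $(X_i,(Y_i^{(k)})_{k\ge 1})$, $i\ge1$, being independent. For $K,N\ge1$ put $$v_N^K(\theta)=\frac1N\sum_{i=1}^N\Big(\varphi(\theta,X_i)-\frac1K\sum_{k=1}^Kf(Y_i^{(k)})\Big)^2,\qquad v^\infty(\theta)=\mathbb E\big[(\varphi(\theta,X)-\mathbb E[f(Y)\mid X])^2\big].$$ Let $C\subset\mathbb R^q$ be compact and assume ($\nabla,\nabla^2$ are taken in $\theta$): * $\mathbb E[\sup_{\theta\in C}|\varphi(\theta,X)|^2]<\infty$,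 and $\theta\mapsto\varphi(\theta,X)$ is a.s. continuous on $C$; * $v^\infty$ has a unique minimizer $\theta^\star$ on $C$, and $\theta^\star\in\mathring C$; * $\theta\mapsto\varphi(\theta,X)$ is a.s. twice continuously differentiable on $\mathring C$, with $\mathbb E[\sup_{\theta\in\mathring C}|\nabla\varphi(\theta,X)|^2]<\infty$ and $\mathbb E[\sup_{\theta\in\mathring C}|\nabla^2\varphi(\theta,X)|^2]<\infty$; * $H:=\nabla^2v^\infty(\theta^\star)$ is positive definite. ("A.s." in these hypotheses means: for almost every value of $X$ under its law.) For all $K,N\ge1$ let $\theta_N^K$ be a random variable that is a.s. a minimizer of $v_N^K$ on $C$. Set $$A=\mathbb E\big[(\varphi(\theta^\star,X)-\mathbb E[f(Y)|X])^2\,\nabla\varphi(\theta^\star,X)\nabla\varphi(\theta^\star,X)^T\big],\quad B=\mathbb E\big[(f(Y)-\mathbb E[f(Y)|X])^2\,\nabla\varphi(\theta^\star,X)\nabla\varphi(\theta^\star,X)^T\big],\quad \Gamma^K=A+\frac BK .$$ For $K\ge1$ consider the condition $(\mathcal U_K)$: $\ \mathbb E\big[\big(\varphi(\theta^\star,X_1)-\frac1K\sum_{k=1}^Kf(Y_1^{(k)})\big)^2|\nabla\varphi(\theta^\star,X_1)|^2\big]<\infty$,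 and the sequence $\big(N(v^\infty(\theta_N^K)-v^\infty(\theta^\star))\big)_{N\ge1}$ is uniformly integrable. 1. For every $K\ge1$ satisfying $(\mathcal U_K)$, as $N\to\infty$, $$\mathbb E[v^\infty(\theta_N^K)]=v^\infty(\theta^\star)+\frac{2\,\mathrm{tr}(\Gamma^KH^{-1})}{N}+o(1/N).$$ 2. For $x\ge0$ let $\nu(x)$ be the least integer $n\ge1$ with $x\le n(n+1)$; for $x>0$ it is the unique integer $n\ge1$ with $(n-1)n<x\le n(n+1)$. Let $A\ne0$ and $C_{Y|X}>0$, so that computing $v_N^K$ costs $N+NK\,C_{Y|X}$, and put $$K^\star=\nu\Big(\frac{\mathrm{tr}(BH^{-1})}{C_{Y|X}\,\mathrm{tr}(AH^{-1})}\Big),\qquad N^\star=N^\star(c)=\Big\lfloor\frac{c}{1+K^\star C_{Y|X}}\Big\rfloor .$$ If $(\mathcal U_{K})$ holds for $K=K^\star$, then $(N^\star,K^\star)$ is an asymptotically optimal allocation for the budget $c\to\infty$: for all large $c$ one has $N^\star\ge1$ and $N^\star+N^\star K^\star C_{Y|X}\le c$, and, as $c\to\infty$, $$\mathbb E[v^\infty(\theta_{N^\star}^{K^\star})]-v^\infty(\theta^\star)\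 \sim\ \inf_{\substack{N,K\ge1\\ N+NK\,C_{Y|X}\le c}}\Big(\mathbb E[v^\infty(\theta_N^K)]-v^\infty(\theta^\star)\Big).$$ -/

import Mathlib

open MeasureTheory ProbabilityTheory Filter Topology Asymptotics

noncomputable section

/-- The Hessian matrix `∇²g(θ)` of a function `g : ℝ^q → ℝ`. -/
def hessianMatrix {q : ℕ} (g : EuclideanSpace ℝ (Fin q) → ℝ) (θ : EuclideanSpace ℝ (Fin q)) :
    Matrix (Fin q) (Fin q) ℝ :=
  Matrix.of fun i j =>
    fderiv ℝ (fderiv ℝ g) θ (EuclideanSpace.single i 1) (EuclideanSpace.single j 1)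

section Model

variable {Ω : Type*} [MeasurableSpace Ω] {d p q : ℕ}

/-- The conditional expectation `E[f(Y) | X]`, a random variable on `Ω`. -/
def condMean (P : Measure Ω) (X : Ω → EuclideanSpace ℝ (Fin d)) (Y : Ω → EuclideanSpace ℝ (Fin p))
    (f : EuclideanSpace ℝ (Fin p) → ℝ) : Ω → ℝ :=
  P[fun ω => f (Y ω) | MeasurableSpace.comap X inferInstance]

/-- `v^∞(θ) = E[(φ(θ, X) - E[f(Y) | X])²]`. -/
def vInf (P : Measure Ω) (X : Ω → EuclideanSpace ℝ (Fin d)) (Y : Ω → EuclideanSpace ℝ (Fin p))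
    (f : EuclideanSpace ℝ (Fin p) → ℝ)
    (φ : EuclideanSpace ℝ (Fin q) → EuclideanSpace ℝ (Fin d) → ℝ)
    (θ : EuclideanSpace ℝ (Fin q)) : ℝ :=
  ∫ ω, (φ θ (X ω) - condMean P X Y f ω) ^ 2 ∂P

/-- `A = E[(φ(θ, X) - E[f(Y) | X])² ∇φ(θ, X) ∇φ(θ, X)ᵀ]`, to be taken at `θ = θ⋆`. -/
def matA (P : Measure Ω) (X : Ω → EuclideanSpace ℝ (Fin d)) (Y : Ω → EuclideanSpace ℝ (Fin p))
    (f : EuclideanSpace ℝ (Fin p) → ℝ)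
    (φ : EuclideanSpace ℝ (Fin q) → EuclideanSpace ℝ (Fin d) → ℝ)
    (θ : EuclideanSpace ℝ (Fin q)) : Matrix (Fin q) (Fin q) ℝ :=
  Matrix.of fun i j =>
    ∫ ω, (φ θ (X ω) - condMean P X Y f ω) ^ 2 *
      (gradient (fun t => φ t (X ω)) θ i * gradient (fun t => φ t (X ω)) θ j) ∂P

/-- `B = E[(f(Y) - E[f(Y) | X])² ∇φ(θ, X) ∇φ(θ, X)ᵀ]`, to be taken at `θ = θ⋆`. -/
def matB (P : Measure Ω) (X : Ω → EuclideanSpace ℝ (Fin d)) (Y : Ω → EuclideanSpace ℝ (Fin p))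
    (f : EuclideanSpace ℝ (Fin p) → ℝ)
    (φ : EuclideanSpace ℝ (Fin q) → EuclideanSpace ℝ (Fin d) → ℝ)
    (θ : EuclideanSpace ℝ (Fin q)) : Matrix (Fin q) (Fin q) ℝ :=
  Matrix.of fun i j =>
    ∫ ω, (f (Y ω) - condMean P X Y f ω) ^ 2 *
      (gradient (fun t => φ t (X ω)) θ i * gradient (fun t => φ t (X ω)) θ j) ∂P

/-- `Γ^K = A + B / K`, to be taken at `θ = θ⋆`. -/
def matGamma (P : Measure Ω) (X : Ω → EuclideanSpace ℝ (Fin d))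
    (Y : Ω → EuclideanSpace ℝ (Fin p)) (f : EuclideanSpace ℝ (Fin p) → ℝ)
    (φ : EuclideanSpace ℝ (Fin q) → EuclideanSpace ℝ (Fin d) → ℝ)
    (θ : EuclideanSpace ℝ (Fin q)) (K : ℕ) : Matrix (Fin q) (Fin q) ℝ :=
  matA P X Y f φ θ + (1 / (K : ℝ)) • matB P X Y f φ θ

/-- The nested simulation scheme: `Xs 0, Xs 1, …` are iid with the law of `X`; for each `i`,
conditionally on `Xs i = x`, the variables `Ys i 0, Ys i 1, …` are iid with the conditional law
`𝓛(Y | X = x)`; and the blocks `(Xs i, (Ys i k)_k)`, `i = 0, 1, …`, are independent.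
(For `K = 0` the last field says that `Xs i` has the law of `X`.) -/
structure IsNestedSample (P : Measure Ω) [IsFiniteMeasure P]
    (X : Ω → EuclideanSpace ℝ (Fin d)) (Y : Ω → EuclideanSpace ℝ (Fin p))
    (Xs : ℕ → Ω → EuclideanSpace ℝ (Fin d)) (Ys : ℕ → ℕ → Ω → EuclideanSpace ℝ (Fin p)) :
    Prop where
  measurable_fst : ∀ i, Measurable (Xs i)
  measurable_snd : ∀ i k, Measurable (Ys i k)
  indep : iIndepFun (fun (i : ℕ) (ω : Ω) => (Xs i ω, fun k => Ys i k ω)) P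
  law : ∀ (i K : ℕ) (S : Set (EuclideanSpace ℝ (Fin d)))
    (T : ℕ → Set (EuclideanSpace ℝ (Fin p))), MeasurableSet S → (∀ k, MeasurableSet (T k)) →
    P {ω | Xs i ω ∈ S ∧ ∀ k < K, Ys i k ω ∈ T k} =
      ∫⁻ x in S, ∏ k ∈ Finset.range K, condDistrib Y X P x (T k) ∂(P.map X)

/-- The empirical mean `(1/K) ∑_{k=1}^K f(Y_i^{(k)})`. -/
def innerMean (f : EuclideanSpace ℝ (Fin p) → ℝ) (Ys : ℕ → ℕ → Ω → EuclideanSpace ℝ (Fin p))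
    (K i : ℕ) (ω : Ω) : ℝ :=
  (1 / (K : ℝ)) * ∑ k ∈ Finset.range K, f (Ys i k ω)

/-- `v_N^K(θ) = (1/N) ∑_{i=1}^N (φ(θ, X_i) - (1/K) ∑_{k=1}^K f(Y_i^{(k)}))²`, at the outcome
`ω`. -/
def vEmp (f : EuclideanSpace ℝ (Fin p) → ℝ)
    (φ : EuclideanSpace ℝ (Fin q) → EuclideanSpace ℝ (Fin d) → ℝ)
    (Xs : ℕ → Ω → EuclideanSpace ℝ (Fin d)) (Ys : ℕ → ℕ → Ω → EuclideanSpace ℝ (Fin p))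
    (K N : ℕ) (ω : Ω) (θ : EuclideanSpace ℝ (Fin q)) : ℝ :=
  (1 / (N : ℝ)) * ∑ i ∈ Finset.range N, (φ θ (Xs i ω) - innerMean f Ys K i ω) ^ 2

end Model

/-- `ν(x)` is the least `n ≥ 1` with `x ≤ n (n + 1)`. For `x > 0` this is the unique `n ≥ 1` with
`(n - 1) n < x ≤ n (n + 1)`, see `nu_eq_iff`; moreover `ν(0) = 1`. -/
def nu (x : ℝ) : ℕ := sInf {n : ℕ | 1 ≤ n ∧ x ≤ (n : ℝ) * ((n : ℝ) + 1)}

theorem nu_mem (x : ℝ) : 1 ≤ nu x ∧ x ≤ (nu x : ℝ) * ((nu x : ℝ) + 1) := by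
  have h : {n : ℕ | 1 ≤ n ∧ x ≤ (n : ℝ) * ((n : ℝ) + 1)}.Nonempty := by
    obtain ⟨n, hn⟩ := exists_nat_ge (max x 1)
    have h1 : (1 : ℝ) ≤ n := (le_max_right _ _).trans hn
    have h2 : x ≤ n := (le_max_left _ _).trans hn
    exact ⟨n, by exact_mod_cast h1, by nlinarith⟩
  exact Nat.sInf_mem h

theorem nu_eq_iff {x : ℝ} (hx : 0 < x) (n : ℕ) :
    nu x = n ↔ 1 ≤ n ∧ ((n : ℝ) - 1) * n < x ∧ x ≤ (n : ℝ) * ((n : ℝ) + 1) := by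
  obtain ⟨h1, h2⟩ := nu_mem x
  have h3 : ((nu x : ℝ) - 1) * nu x < x := by
    by_contra! h
    obtain ⟨m, hm⟩ := Nat.exists_eq_add_of_le h1
    rw [hm] at h
    push_cast at h
    have hm0 : 1 ≤ m := by
      rcases Nat.eq_zero_or_pos m with h0 | h0
      · subst h0
        norm_num at h
        linarith
      · exact h0
    have : nu x ≤ m := Nat.sInf_le ⟨hm0, by nlinarith⟩
    omega
  constructor
  · rintro rfl
    exact ⟨h1, h3, h2⟩
  · rintro ⟨g1, g2, g3⟩
    apply le_antisymm
    · exact Nat.sInf_le ⟨g1, g3⟩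
    · by_contra! hlt
      have : (nu x : ℝ) + 1 ≤ n := by exact_mod_cast hlt
      have h0 : (0 : ℝ) ≤ nu x := Nat.cast_nonneg _
      nlinarith

/-- The infimum of `R N K` over the allocations `N, K ≥ 1` whose cost `N + N K C_{Y|X}` is within
the budget `c`. -/
def budgetInf (R : ℕ → ℕ → ℝ) (CYX c : ℝ) : ℝ :=
  sInf {r : ℝ | ∃ N K : ℕ, 1 ≤ N ∧ 1 ≤ K ∧ (N : ℝ) + (N : ℝ) * (K : ℝ) * CYX ≤ c ∧ r = R N K}

end

/-! For fixed `K` the pairs ζ_i = (X_i, inner mean of block i) are iid, and v_N^K is the empirical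
mean of the loss (φ(θ, x) - y)² along them. Given X, the innovations f(Y^(k)) - E[f(Y)|X] are
centred and uncorrelated. Hence the mean loss is v^∞(θ) plus a constant free of θ
(`integral_sqLoss`), and θ_N^K is an M-estimator of θ⋆ for every `K`, with Hessian H and score
covariance 4 Γ^K at θ⋆ (`integral_score_mul_score`).

Let g_N be the empirical mean of -H⁻¹ times the score. Uniform strong laws, for the loss on C and
for its second order Taylor quotients near θ⋆, reduce the problem to a perturbed quadratic
minimisation (`perturbed_quadratic_argmin`): almost surely the excess risk is ½ H(g_N, g_N) +
o(‖g_N‖²) (`ae_excess_risk_expansion`). No central limit theorem is needed: g_N is an average of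
centred iid vectors, so N/2 · H(g_N, g_N) has mean exactly 2 tr(Γ^K H⁻¹) for every N ≥ 1, and
N‖g_N‖² is uniformly integrable (`unifIntegrable_normSum_sq`). Off events of vanishing probability
the mean of N times the excess risk is therefore close to this number (`exists_exceptional_sets`).
Since the excess risk is nonnegative, the lower limit follows without uniform integrability of the
risks; with it, the limit follows (`excess_risk_limit`).

For the allocation, cost times excess risk tends to (1 + K C)(α + β/K), with α = 2 tr(A H⁻¹) and β =
2 tr(B H⁻¹), and ν minimises this over K (`one_add_nu_mul_le`). The infimum runs over N and K
jointly, so limits at fixed K do not suffice: a bound excess ≥ δ/N, uniform in K and N, is also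
required (`exists_le_excess_risk`). It rests on A ≠ 0. The part of the score that depends on X alone
is then nonzero and does not shrink with K; its correlation with a bounded function of X keeps the
normalised score away from 0 with fixed probability, a large score pushes the minimiser at distance
of order 1/√N from θ⋆, and the risk grows quadratically. Large K is then too costly, small N is too
risky for a large budget, and finitely many K remain (`allocation_asymptotics`).

The moment condition at one K suffices for all: orthogonality splits the squared weighted residual
into its A and B parts (`memLp_of_memLp_mul_sub_innerMean`). The almost sure regularity hypotheses
become sure ones after φ is modified on a null set of the law of X (`exists_isSmoothModel`). -/

noncomputable section

set_option maxSynthPendingDepth 5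

/-! ### Iid sequences: uniform strong law, covariances and fourth moments. -/

/-- A sequence of independent, identically distributed random variables. -/
structure IsIIDSeq {Ω Z : Type*} [MeasurableSpace Ω] [MeasurableSpace Z] (ζ : ℕ → Ω → Z)
    (P : Measure Ω) : Prop where
  measurable : ∀ i, Measurable (ζ i)
  indep : iIndepFun ζ P
  ident : ∀ i, IdentDistrib (ζ i) (ζ 0) P P

theorem IsIIDSeq.comp {Ω Z W : Type*} [MeasurableSpace Ω] [MeasurableSpace Z] [MeasurableSpace W]
    {ζ : ℕ → Ω → Z} {P : Measure Ω} (h : IsIIDSeq ζ P) {g : Z → W} (hg : Measurable g) :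
    IsIIDSeq (fun i ω => g (ζ i ω)) P :=
  ⟨fun i => hg.comp (h.measurable i), h.indep.comp (fun _ => g) (fun _ => hg),
    fun i => (h.ident i).comp hg⟩

theorem IsIIDSeq.strong_law {Ω Z E : Type*} [MeasurableSpace Ω] [MeasurableSpace Z]
    [NormedAddCommGroup E] [NormedSpace ℝ E] [CompleteSpace E] [MeasurableSpace E] [BorelSpace E]
    {ζ : ℕ → Ω → Z} {P : Measure Ω} (h : IsIIDSeq ζ P) {g : Z → E} (hg : Measurable g)
    (hint : Integrable (fun ω => g (ζ 0 ω)) P) :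
    ∀ᵐ ω ∂P, Tendsto (fun n : ℕ => (n : ℝ)⁻¹ • ∑ i ∈ Finset.range n, g (ζ i ω)) atTop
      (𝓝 (∫ ω, g (ζ 0 ω) ∂P)) :=
  strong_law_ae (fun i ω => g (ζ i ω)) hint
    (fun _ _ hij => (h.comp hg).indep.indepFun hij) (h.comp hg).ident

/-- A map into `C(T, ℝ)` is Borel measurable as soon as its evaluations are measurable. -/
theorem measurable_continuousMap_of_eval {Z T : Type*} [MeasurableSpace Z] [MetricSpace T]
    [CompactSpace T] {Φ : Z → C(T, ℝ)} (h : ∀ t, Measurable fun z => Φ z t) :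
    @Measurable _ _ _ (borel C(T, ℝ)) Φ := by
  let _ : MeasurableSpace C(T, ℝ) := borel _
  have _ : BorelSpace C(T, ℝ) := ⟨rfl⟩
  -- By continuity the sup distance to `g` can be tested on a countable dense subset of `T`, so
  -- closed balls, and then open ones, have measurable preimages.
  have hdist : ∀ g : C(T, ℝ), Measurable fun z => dist (Φ z) g := by
    intro g
    refine measurable_of_Iic fun r => ?_
    rcases lt_or_ge r 0 with hr | hr
    · have : (fun z => dist (Φ z) g) ⁻¹' Set.Iic r = ∅ := by
        ext z
        simpa using hr.trans_le dist_nonneg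
      rw [this]
      exact MeasurableSet.empty
    · obtain ⟨D, hDc, hDd⟩ := TopologicalSpace.exists_countable_dense T
      have : (fun z => dist (Φ z) g) ⁻¹' Set.Iic r = ⋂ t ∈ D, {z | dist (Φ z t) (g t) ≤ r} := by
        ext z
        simp only [Set.mem_preimage, Set.mem_Iic, Set.mem_iInter, Set.mem_ofPred_eq]
        rw [ContinuousMap.dist_le hr]
        refine ⟨fun H t _ => H t, fun H t => ?_⟩
        have hcl : IsClosed {t | dist (Φ z t) (g t) ≤ r} :=
          isClosed_le ((Φ z).continuous.dist g.continuous) continuous_const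
        have : closure D ⊆ {t | dist (Φ z t) (g t) ≤ r} :=
          closure_minimal (fun t ht => H t ht) hcl
        exact this (hDd.closure_eq ▸ Set.mem_univ t)
      rw [this]
      refine MeasurableSet.biInter hDc fun t _ => ?_
      exact measurableSet_le ((h t).dist measurable_const) measurable_const
  refine measurable_of_isOpen fun U hU => ?_
  have hex : ∀ g : U, ∃ ε > 0, Metric.ball (g : C(T, ℝ)) ε ⊆ U := fun g =>
    Metric.isOpen_iff.1 hU g g.2
  choose ε hε hεU using hex
  -- `C(T, ℝ)` is second countable, so countably many of the balls filling `U` already cover it.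
  obtain ⟨S, hSc, hS⟩ := TopologicalSpace.isOpen_iUnion_countable
    (fun g : U => Metric.ball (g : C(T, ℝ)) (ε g)) (fun _ => Metric.isOpen_ball)
  have hU' : U = ⋃ g ∈ S, Metric.ball (g : C(T, ℝ)) (ε g) := by
    rw [hS]
    apply Set.Subset.antisymm
    · intro g hg
      exact Set.mem_iUnion.2 ⟨⟨g, hg⟩, Metric.mem_ball_self (hε _)⟩
    · exact Set.iUnion_subset hεU
  rw [hU', Set.preimage_iUnion₂]
  refine MeasurableSet.biUnion hSc fun g _ => ?_
  exact measurableSet_lt (hdist g) measurable_const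

/-- The uniform strong law of large numbers over a compact parameter set. -/
theorem IsIIDSeq.uniform_strong_law {Ω Z T : Type*} [MeasurableSpace Ω] [MeasurableSpace Z]
    [MetricSpace T] [CompactSpace T] {ζ : ℕ → Ω → Z} {P : Measure Ω} (h : IsIIDSeq ζ P)
    {g : T → Z → ℝ} (hmeas : ∀ t, Measurable (g t)) (hcont : ∀ z, Continuous fun t => g t z)
    {D : Z → ℝ} (hD : ∀ t z, |g t z| ≤ D z) (hDint : Integrable (fun ω => D (ζ 0 ω)) P) :
    (Continuous fun t => ∫ ω, g t (ζ 0 ω) ∂P) ∧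
    ∀ᵐ ω ∂P, ∀ ε > 0, ∀ᶠ N : ℕ in atTop, ∀ t,
      |(N : ℝ)⁻¹ * ∑ i ∈ Finset.range N, g t (ζ i ω) - ∫ ω, g t (ζ 0 ω) ∂P| ≤ ε := by
  rcases isEmpty_or_nonempty T with hT | hT
  · exact ⟨continuous_of_discreteTopology, ae_of_all _ fun ω ε _ => Eventually.of_forall fun N t =>
      (hT.false t).elim⟩
  let _ : MeasurableSpace C(T, ℝ) := borel _
  have _ : BorelSpace C(T, ℝ) := ⟨rfl⟩
  -- Uniformity in `t` is obtained from the strong law for random elements of the Banach space `C(T,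
  -- ℝ)`, whose norm is the sup norm; no covering argument is needed.
  set Φ : Z → C(T, ℝ) := fun z => ⟨fun t => g t z, hcont z⟩ with hΦ
  have hΦm : Measurable Φ := measurable_continuousMap_of_eval hmeas
  have hint : Integrable (fun ω => Φ (ζ 0 ω)) P := by
    refine hDint.mono' (hΦm.comp (h.measurable 0)).aestronglyMeasurable (ae_of_all _ fun ω => ?_)
    rw [ContinuousMap.norm_le_of_nonempty]
    exact fun t => hD t _
  have heval : ∀ t, (∫ ω, Φ (ζ 0 ω) ∂P) t = ∫ ω, g t (ζ 0 ω) ∂P := fun t =>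
    ContinuousMap.integral_apply hint t
  constructor
  · simp_rw [← heval]
    exact (∫ ω, Φ (ζ 0 ω) ∂P).continuous
  · filter_upwards [h.strong_law hΦm hint] with ω hω ε hε
    filter_upwards [(Metric.tendsto_nhds.1 hω) ε hε] with N hN t
    have := (ContinuousMap.dist_lt_iff hε).1 hN t
    rw [heval, Real.dist_eq] at this
    simpa [ContinuousMap.sum_apply, hΦ] using this.le

theorem IsIIDSeq.memLp {Ω Z : Type*} [MeasurableSpace Ω] [MeasurableSpace Z] {ζ : ℕ → Ω → Z}
    {P : Measure Ω} (h : IsIIDSeq ζ P) {α : Z → ℝ} (hα : Measurable α) {p : ENNReal}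
    (hint : MemLp (fun ω => α (ζ 0 ω)) p P) (i : ℕ) : MemLp (fun ω => α (ζ i ω)) p P :=
  ((h.comp hα).ident i).symm.memLp_iff.1 hint

theorem IsIIDSeq.integral_eq {Ω Z : Type*} [MeasurableSpace Ω] [MeasurableSpace Z]
    {ζ : ℕ → Ω → Z} {P : Measure Ω} (h : IsIIDSeq ζ P) {α : Z → ℝ} (hα : Measurable α) (i : ℕ) :
    ∫ ω, α (ζ i ω) ∂P = ∫ ω, α (ζ 0 ω) ∂P :=
  ((h.comp hα).ident i).integral_eq

theorem IsIIDSeq.memLp_sum {Ω Z : Type*} [MeasurableSpace Ω] [MeasurableSpace Z] {ζ : ℕ → Ω → Z}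
    {P : Measure Ω} (h : IsIIDSeq ζ P) {α : Z → ℝ} (hα : Measurable α) {p : ENNReal}
    (hint : MemLp (fun ω => α (ζ 0 ω)) p P) (N : ℕ) :
    MemLp (fun ω => ∑ i ∈ Finset.range N, α (ζ i ω)) p P :=
  memLp_finsetSum _ fun i _ => h.memLp hα hint i

/-- Covariance of two centred sums over the same iid sequence. -/
theorem IsIIDSeq.integral_sum_mul_sum {Ω Z : Type*} [MeasurableSpace Ω] [MeasurableSpace Z]
    {ζ : ℕ → Ω → Z} {P : Measure Ω} [IsProbabilityMeasure P] (h : IsIIDSeq ζ P) {α β : Z → ℝ}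
    (hα : Measurable α) (hβ : Measurable β) (hα2 : MemLp (fun ω => α (ζ 0 ω)) 2 P)
    (hβ2 : MemLp (fun ω => β (ζ 0 ω)) 2 P) (hα0 : ∫ ω, α (ζ 0 ω) ∂P = 0) (N : ℕ) :
    ∫ ω, (∑ i ∈ Finset.range N, α (ζ i ω)) * (∑ i ∈ Finset.range N, β (ζ i ω)) ∂P =
      N * ∫ ω, α (ζ 0 ω) * β (ζ 0 ω) ∂P := by
  have hij : ∀ i j, Integrable (fun ω => α (ζ i ω) * β (ζ j ω)) P := fun i j =>
    (h.memLp hα hα2 i).integrable_mul (h.memLp hβ hβ2 j)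
  simp_rw [Finset.sum_mul_sum]
  rw [integral_finsetSum _ fun i _ => integrable_finsetSum _ fun j _ => hij i j]
  have hrow : ∀ i ∈ Finset.range N, ∫ ω, ∑ j ∈ Finset.range N, α (ζ i ω) * β (ζ j ω) ∂P =
      ∫ ω, α (ζ 0 ω) * β (ζ 0 ω) ∂P := by
    intro i hi
    rw [integral_finsetSum _ fun j _ => hij i j, Finset.sum_eq_single_of_mem i hi]
    · exact h.integral_eq (hα.mul hβ) i
    -- An off-diagonal term factors by independence, so it is enough that `α` alone is centred.
    · intro j _ hji
      have := ((h.indep.indepFun hji.symm).comp hα hβ).integral_fun_mul_eq_mul_integral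
        (hα.comp (h.measurable i)).aestronglyMeasurable
        (hβ.comp (h.measurable j)).aestronglyMeasurable
      simp only [Function.comp_apply] at this
      rw [this, h.integral_eq hα i, hα0, zero_mul]
  rw [Finset.sum_congr rfl hrow]
  simp

/-- A fourth moment bound for centred sums of bounded iid variables. -/
theorem IsIIDSeq.integral_sum_pow_four_le {Ω Z : Type*} [MeasurableSpace Ω] [MeasurableSpace Z]
    {ζ : ℕ → Ω → Z} {P : Measure Ω} [IsProbabilityMeasure P] (h : IsIIDSeq ζ P) {α : Z → ℝ}
    (hα : Measurable α) {M : ℝ} (hM : ∀ z, |α z| ≤ M) (hα0 : ∫ ω, α (ζ 0 ω) ∂P = 0) (N : ℕ) :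
    ∫ ω, (∑ i ∈ Finset.range N, α (ζ i ω)) ^ 4 ∂P ≤ 3 * (N : ℝ) ^ 2 * M ^ 4 := by
  have hm : ∀ i, Measurable fun ω => α (ζ i ω) := fun i => hα.comp (h.measurable i)
  have hSm : ∀ n, Measurable fun ω => ∑ i ∈ Finset.range n, α (ζ i ω) := fun n =>
    Finset.measurable_sum _ fun i _ => hm i
  have hSb : ∀ n ω, |∑ i ∈ Finset.range n, α (ζ i ω)| ≤ n * M := by
    intro n ω
    calc |∑ i ∈ Finset.range n, α (ζ i ω)| ≤ ∑ i ∈ Finset.range n, |α (ζ i ω)| :=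
          Finset.abs_sum_le_sum_abs _ _
      _ ≤ ∑ i ∈ Finset.range n, M := Finset.sum_le_sum fun i _ => hM _
      _ = n * M := by simp
  have hint : ∀ n k l : ℕ, Integrable
      (fun ω => (∑ i ∈ Finset.range n, α (ζ i ω)) ^ k * (α (ζ n ω)) ^ l) P := by
    intro n k l
    refine Integrable.of_bound (((hSm n).pow_const k).mul ((hm n).pow_const l)).aestronglyMeasurable
      ((n * M) ^ k * M ^ l) (ae_of_all _ fun ω => ?_)
    rw [Real.norm_eq_abs, abs_mul, abs_pow, abs_pow]
    have := hSb n ω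
    have := hM (ζ n ω)
    gcongr
    exact pow_nonneg ((abs_nonneg _).trans (hSb n ω)) _
  have hprod : ∀ n k l : ℕ, ∫ ω, (∑ i ∈ Finset.range n, α (ζ i ω)) ^ k * (α (ζ n ω)) ^ l ∂P =
      (∫ ω, (∑ i ∈ Finset.range n, α (ζ i ω)) ^ k ∂P) * ∫ ω, (α (ζ 0 ω)) ^ l ∂P := by
    intro n k l
    have hind := (h.comp hα).indep.indepFun_finsetSum_of_notMem (fun i => hm i)
      (Finset.notMem_range_self (n := n))
    have := (hind.comp (φ := fun x : ℝ => x ^ k) (ψ := fun x : ℝ => x ^ l) (by fun_prop)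
      (by fun_prop)).integral_fun_mul_eq_mul_integral
      (by
        have := (hSm n).pow_const k
        refine Measurable.aestronglyMeasurable ?_
        convert this using 2
        simp)
      ((hm n).pow_const l).aestronglyMeasurable
    simp only [Function.comp_apply, Finset.sum_apply] at this
    rw [this, h.integral_eq (hα.pow_const l) n]
  have hM2 : MemLp (fun ω => α (ζ 0 ω)) 2 P :=
    MemLp.of_bound (hm 0).aestronglyMeasurable M (ae_of_all _ fun ω => hM _)
  have hpow : ∀ l : ℕ, ∫ ω, (α (ζ 0 ω)) ^ l ∂P ≤ M ^ l := by
    intro l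
    have : ∫ ω, (α (ζ 0 ω)) ^ l ∂P ≤ ∫ _, M ^ l ∂P := by
      refine integral_mono (by simpa using hint 0 0 l) (integrable_const _) fun ω => ?_
      exact (le_abs_self _).trans (by rw [abs_pow]; exact pow_le_pow_left₀ (abs_nonneg _) (hM _) _)
    simpa using this
  induction N with
  | zero => simp
  | succ n ih =>
    have hS2 : ∫ ω, (∑ i ∈ Finset.range n, α (ζ i ω)) ^ 2 ∂P ≤ n * M ^ 2 := by
      have := h.integral_sum_mul_sum hα hα hM2 hM2 hα0 n
      simp_rw [← sq] at this
      rw [this]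
      exact mul_le_mul_of_nonneg_left (hpow 2) (Nat.cast_nonneg n)
    -- Zeroth and first powers are kept so that every term has the shape of `hprod`. The terms with
    -- a single factor of the new variable or of the old sum vanish, and the increment 6n + 1 fits
    -- into 3(n+1)² - 3n² = 6n + 3.
    have hexp : ∀ ω, (∑ i ∈ Finset.range (n + 1), α (ζ i ω)) ^ 4 =
        (∑ i ∈ Finset.range n, α (ζ i ω)) ^ 4 * (α (ζ n ω)) ^ 0 +
        4 * ((∑ i ∈ Finset.range n, α (ζ i ω)) ^ 3 * (α (ζ n ω)) ^ 1) +
        6 * ((∑ i ∈ Finset.range n, α (ζ i ω)) ^ 2 * (α (ζ n ω)) ^ 2) +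
        4 * ((∑ i ∈ Finset.range n, α (ζ i ω)) ^ 1 * (α (ζ n ω)) ^ 3) +
        (∑ i ∈ Finset.range n, α (ζ i ω)) ^ 0 * (α (ζ n ω)) ^ 4 := by
      intro ω
      rw [Finset.sum_range_succ]
      ring
    simp_rw [hexp]
    have hS1 : ∫ ω, (∑ i ∈ Finset.range n, α (ζ i ω)) ^ 1 ∂P = 0 := by
      simp_rw [pow_one]
      rw [integral_finsetSum _ fun i _ => (h.memLp hα hM2 i).integrable (by norm_num)]
      exact Finset.sum_eq_zero fun i _ => by rw [h.integral_eq hα i, hα0]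
    rw [integral_add (by fun_prop) (by fun_prop), integral_add (by fun_prop) (by fun_prop),
      integral_add (by fun_prop) (by fun_prop), integral_add (by fun_prop) (by fun_prop),
      integral_const_mul, integral_const_mul, integral_const_mul, hprod, hprod, hprod, hprod,
      hprod, hS1]
    simp only [pow_one, hα0, pow_zero, integral_const, probReal_univ, smul_eq_mul]
    have h1 := hpow 2
    have h2 := hpow 4
    have h3 : 0 ≤ ∫ ω, (α (ζ 0 ω)) ^ 2 ∂P := integral_nonneg fun ω => sq_nonneg _
    have h4 := mul_le_mul hS2 h1 h3 (by positivity)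
    push_cast
    nlinarith [sq_nonneg (M ^ 2)]

/-! ### Normalised sums, truncation and uniform integrability. -/

/-- The normalised sum `N^{-1/2} ∑_{i < N} α(ζ_i)`. -/
def normSum {Ω Z : Type*} (ζ : ℕ → Ω → Z) (α : Z → ℝ) (N : ℕ) (ω : Ω) : ℝ :=
  (√(N : ℝ))⁻¹ * ∑ i ∈ Finset.range N, α (ζ i ω)

theorem IsIIDSeq.memLp_normSum {Ω Z : Type*} [MeasurableSpace Ω] [MeasurableSpace Z]
    {ζ : ℕ → Ω → Z} {P : Measure Ω} (h : IsIIDSeq ζ P) {α : Z → ℝ} (hα : Measurable α)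
    {p : ENNReal} (hint : MemLp (fun ω => α (ζ 0 ω)) p P) (N : ℕ) :
    MemLp (normSum ζ α N) p P :=
  (h.memLp_sum hα hint N).const_mul _

/-- The right side does not involve `N`. This exact identity, used in place of a central limit
theorem, fixes the mean of the leading term for every sample size. -/
theorem IsIIDSeq.integral_normSum_mul {Ω Z : Type*} [MeasurableSpace Ω] [MeasurableSpace Z]
    {ζ : ℕ → Ω → Z} {P : Measure Ω} [IsProbabilityMeasure P] (h : IsIIDSeq ζ P) {α β : Z → ℝ}
    (hα : Measurable α) (hβ : Measurable β) (hα2 : MemLp (fun ω => α (ζ 0 ω)) 2 P)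
    (hβ2 : MemLp (fun ω => β (ζ 0 ω)) 2 P) (hα0 : ∫ ω, α (ζ 0 ω) ∂P = 0) {N : ℕ} (hN : 1 ≤ N) :
    ∫ ω, normSum ζ α N ω * normSum ζ β N ω ∂P = ∫ ω, α (ζ 0 ω) * β (ζ 0 ω) ∂P := by
  have hN' : (0 : ℝ) < N := by exact_mod_cast hN
  have hs : (√(N : ℝ))⁻¹ * (√(N : ℝ))⁻¹ = (N : ℝ)⁻¹ := by
    rw [← mul_inv, Real.mul_self_sqrt hN'.le]
  have : ∀ ω, normSum ζ α N ω * normSum ζ β N ω = (N : ℝ)⁻¹ *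
      ((∑ i ∈ Finset.range N, α (ζ i ω)) * (∑ i ∈ Finset.range N, β (ζ i ω))) := by
    intro ω
    rw [← hs, normSum, normSum]
    ring
  simp_rw [this]
  rw [integral_const_mul, h.integral_sum_mul_sum hα hβ hα2 hβ2 hα0, inv_mul_cancel_left₀ hN'.ne']

theorem IsIIDSeq.integral_normSum_pow_four_le {Ω Z : Type*} [MeasurableSpace Ω]
    [MeasurableSpace Z] {ζ : ℕ → Ω → Z} {P : Measure Ω} [IsProbabilityMeasure P]
    (h : IsIIDSeq ζ P) {α : Z → ℝ} (hα : Measurable α) {M : ℝ} (hM : ∀ z, |α z| ≤ M)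
    (hα0 : ∫ ω, α (ζ 0 ω) ∂P = 0) (N : ℕ) :
    ∫ ω, normSum ζ α N ω ^ 4 ∂P ≤ 3 * M ^ 4 := by
  rcases Nat.eq_zero_or_pos N with rfl | hN
  · simp only [normSum, Finset.range_zero, Finset.sum_empty, mul_zero]
    simp
    positivity
  have hN' : (0 : ℝ) < N := by exact_mod_cast hN
  have hs : ((√(N : ℝ))⁻¹) ^ 4 = ((N : ℝ) ^ 2)⁻¹ := by
    rw [inv_pow, show (√(N : ℝ)) ^ 4 = ((√(N : ℝ)) ^ 2) ^ 2 by ring, Real.sq_sqrt hN'.le]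
  simp_rw [normSum, mul_pow, hs]
  rw [integral_const_mul, inv_mul_le_iff₀ (by positivity)]
  calc _ ≤ _ := h.integral_sum_pow_four_le hα hM hα0 N
    _ = _ := by ring

theorem IsIIDSeq.integrable_normSum_pow_four {Ω Z : Type*} [MeasurableSpace Ω]
    [MeasurableSpace Z] {ζ : ℕ → Ω → Z} {P : Measure Ω} [IsProbabilityMeasure P]
    (h : IsIIDSeq ζ P) {α : Z → ℝ} (hα : Measurable α) {M : ℝ} (hM : ∀ z, |α z| ≤ M) (N : ℕ) :
    Integrable (fun ω => normSum ζ α N ω ^ 4) P := by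
  have := h.memLp_normSum hα (p := 4)
    (MemLp.of_bound (hα.comp (h.measurable 0)).aestronglyMeasurable M
      (ae_of_all _ fun ω => hM _)) N
  have h4 := this.integrable_norm_pow (p := 4) (by norm_num)
  refine h4.congr (ae_of_all _ fun ω => ?_)
  simp only [Real.norm_eq_abs]
  exact Even.pow_abs (by decide) _

/-- The truncation of `α` at level `M`. -/
def truncAt {Z : Type*} (α : Z → ℝ) (M : ℝ) (z : Z) : ℝ := {z | |α z| ≤ M}.indicator α z

theorem measurable_truncAt {Z : Type*} [MeasurableSpace Z] {α : Z → ℝ} (hα : Measurable α)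
    (M : ℝ) : Measurable (truncAt α M) :=
  hα.indicator (measurableSet_le hα.abs measurable_const)

theorem abs_truncAt_le {Z : Type*} (α : Z → ℝ) {M : ℝ} (hM : 0 ≤ M) (z : Z) :
    |truncAt α M z| ≤ M := by
  unfold truncAt
  by_cases hz : |α z| ≤ M
  · rw [Set.indicator_of_mem (by exact hz)]
    exact hz
  · rw [Set.indicator_of_notMem (by exact hz)]
    simpa using hM

theorem abs_sub_truncAt_le {Z : Type*} (α : Z → ℝ) (M : ℝ) (z : Z) :
    |α z - truncAt α M z| ≤ |α z| := by
  unfold truncAt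
  by_cases hz : |α z| ≤ M
  · rw [Set.indicator_of_mem (by exact hz)]
    simp
  · rw [Set.indicator_of_notMem (by exact hz)]
    simp

/-- The truncation is either `α` or `0`. In this form the correlation of `α` with its truncation is
the second moment minus that of the tail. -/
theorem mul_truncAt {Z : Type*} (α : Z → ℝ) (M : ℝ) (z : Z) :
    α z * truncAt α M z = α z ^ 2 - (α z - truncAt α M z) ^ 2 := by
  unfold truncAt
  by_cases hz : |α z| ≤ M
  · rw [Set.indicator_of_mem (by exact hz)]
    ring
  · rw [Set.indicator_of_notMem (by exact hz)]
    ring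

theorem tendsto_integral_sub_truncAt_sq {Ω Z : Type*} [MeasurableSpace Ω] [MeasurableSpace Z]
    {P : Measure Ω} {ζ : Ω → Z} (hζ : Measurable ζ) {α : Z → ℝ} (hα : Measurable α)
    (hα2 : MemLp (fun ω => α (ζ ω)) 2 P) :
    Tendsto (fun n : ℕ => ∫ ω, (α (ζ ω) - truncAt α n (ζ ω)) ^ 2 ∂P) atTop (𝓝 0) := by
  have : Tendsto (fun n : ℕ => ∫ ω, (α (ζ ω) - truncAt α n (ζ ω)) ^ 2 ∂P) atTop
      (𝓝 (∫ _, (0 : ℝ) ∂P)) := by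
    refine tendsto_integral_of_dominated_convergence (fun ω => α (ζ ω) ^ 2) (fun n => ?_)
      hα2.integrable_sq (fun n => ae_of_all _ fun ω => ?_) (ae_of_all _ fun ω => ?_)
    · exact (((hα.sub (measurable_truncAt hα _)).comp hζ).pow_const 2).aestronglyMeasurable
    · rw [Real.norm_eq_abs, abs_pow, ← sq_abs (α (ζ ω))]
      exact pow_le_pow_left₀ (abs_nonneg _) (abs_sub_truncAt_le _ _ _) 2
    · obtain ⟨n₀, hn₀⟩ := exists_nat_ge |α (ζ ω)|
      refine tendsto_const_nhds.congr' ?_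
      filter_upwards [eventually_ge_atTop n₀] with n hn
      have hle : |α (ζ ω)| ≤ n := hn₀.trans (by exact_mod_cast hn)
      unfold truncAt
      rw [Set.indicator_of_mem (by exact hle)]
      simp
  simpa using this

/-- The squares of the normalised centred sums of an iid sequence are uniformly integrable. -/
theorem IsIIDSeq.unifIntegrable_normSum_sq {Ω Z : Type*} [MeasurableSpace Ω] [MeasurableSpace Z]
    {ζ : ℕ → Ω → Z} {P : Measure Ω} [IsProbabilityMeasure P] (h : IsIIDSeq ζ P) {α : Z → ℝ}
    (hα : Measurable α) (hα2 : MemLp (fun ω => α (ζ 0 ω)) 2 P) (hα0 : ∫ ω, α (ζ 0 ω) ∂P = 0)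
    {ε : ℝ} (hε : 0 < ε) :
    ∃ δ > 0, ∀ N : ℕ, 1 ≤ N → ∀ S : Set Ω, P.real S ≤ δ →
      ∫ ω in S, normSum ζ α N ω ^ 2 ∂P ≤ ε := by
  -- The truncation level is fixed by the L² tail of `α`, before `N` enters.
  obtain ⟨M, hM⟩ := ((tendsto_integral_sub_truncAt_sq (h.measurable 0) hα hα2).eventually
    (gt_mem_nhds (show (0 : ℝ) < ε / 8 by positivity))).exists
  have hM0 : (0 : ℝ) ≤ M := Nat.cast_nonneg M
  set c := ∫ ω, truncAt α M (ζ 0 ω) ∂P with hc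
  have htm := measurable_truncAt hα (M : ℝ)
  have ht2 : MemLp (fun ω => truncAt α M (ζ 0 ω)) 2 P :=
    MemLp.of_bound (htm.comp (h.measurable 0)).aestronglyMeasurable M
      (ae_of_all _ fun ω => abs_truncAt_le α hM0 _)
  have hti := ht2.integrable (by norm_num)
  have hαi := hα2.integrable (by norm_num)
  have hcM : |c| ≤ M := by
    have := norm_integral_le_of_norm_le_const (μ := P)
      (f := fun ω => truncAt α M (ζ 0 ω)) (ae_of_all P fun ω => abs_truncAt_le α hM0 (ζ 0 ω))
    simpa using this
  -- `α = β + γ` with both parts centred: `β` is bounded, so its normalised sums have fourth moments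
  -- bounded in `N`, and `γ` is small in L², so its normalised sums are too.
  set β : Z → ℝ := fun z => truncAt α M z - c with hβ
  set γ : Z → ℝ := fun z => α z - truncAt α M z + c with hγ
  have hβm : Measurable β := htm.sub_const c
  have hγm : Measurable γ := (hα.sub htm).add_const c
  have hβb : ∀ z, |β z| ≤ 2 * M := fun z =>
    (abs_sub _ _).trans (by linarith [abs_truncAt_le α hM0 z])
  have hβ0 : ∫ ω, β (ζ 0 ω) ∂P = 0 := by
    simp only [hβ]
    rw [integral_sub hti (integrable_const _)]
    simp [hc]
  have hκ2 : MemLp (fun ω => α (ζ 0 ω) - truncAt α M (ζ 0 ω)) 2 P := hα2.sub ht2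
  have hκ0 : ∫ ω, α (ζ 0 ω) - truncAt α M (ζ 0 ω) ∂P = -c := by
    rw [integral_sub hαi hti, hα0]
    simp [hc]
  have hγ2 : MemLp (fun ω => γ (ζ 0 ω)) 2 P := hκ2.add (memLp_const c)
  have hγ0 : ∫ ω, γ (ζ 0 ω) ∂P = 0 := by
    simp only [hγ]
    rw [integral_add (hκ2.integrable (by norm_num)) (integrable_const _), hκ0]
    simp
  -- Centring only lowers the second moment: the cross term is `-2c²`, against the `+c²` from the
  -- constant.
  have hγsq : ∫ ω, γ (ζ 0 ω) * γ (ζ 0 ω) ∂P ≤ ε / 8 := by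
    have : ∀ ω, γ (ζ 0 ω) * γ (ζ 0 ω) = (α (ζ 0 ω) - truncAt α M (ζ 0 ω)) ^ 2 +
        ((2 * c) * (α (ζ 0 ω) - truncAt α M (ζ 0 ω)) + c ^ 2) := by
      intro ω
      simp only [hγ]
      ring
    simp_rw [this]
    have hκ1 := (hκ2.integrable (by norm_num)).const_mul (2 * c)
    have hκc : Integrable (fun ω => 2 * c * (α (ζ 0 ω) - truncAt α M (ζ 0 ω)) + c ^ 2) P :=
      hκ1.add (integrable_const _)
    rw [integral_add hκ2.integrable_sq hκc, integral_add hκ1 (integrable_const _),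
      integral_const_mul, hκ0]
    simp
    nlinarith [sq_nonneg c]
  set B := 3 * (2 * (M : ℝ)) ^ 4 with hB
  have hB0 : 0 ≤ B := by positivity
  -- `t` balances the inequality Z² ≤ t + Z⁴/t: the fourth moment costs at most `B / t ≤ ε / 8`, and
  -- then `δ = ε / (8 t)` makes the contribution of `t` on `S` at most `ε / 8`.
  set t := 8 * (B + 1) / ε with ht
  have ht0 : 0 < t := by positivity
  refine ⟨ε / (8 * t), by positivity, fun N hN S hS => ?_⟩
  have hβ2 : MemLp (fun ω => β (ζ 0 ω)) 2 P := ht2.sub (memLp_const c)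
  have hZβ := h.memLp_normSum hβm hβ2 N
  have hZγ := h.memLp_normSum hγm hγ2 N
  have hZγ2 : ∫ ω, normSum ζ γ N ω ^ 2 ∂P ≤ ε / 8 := by
    simp_rw [sq]
    rw [h.integral_normSum_mul hγm hγm hγ2 hγ2 hγ0 hN]
    exact hγsq
  have hZβ4 := h.integral_normSum_pow_four_le hβm hβb hβ0 N
  have hZβ4i := h.integrable_normSum_pow_four hβm hβb N
  have hdec : ∀ ω, normSum ζ α N ω = normSum ζ β N ω + normSum ζ γ N ω := by
    intro ω
    simp only [normSum, ← mul_add, ← Finset.sum_add_distrib, hβ, hγ]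
    congr 1
    exact Finset.sum_congr rfl fun i _ => by ring
  have hpt : ∀ ω, normSum ζ α N ω ^ 2 ≤
      2 * (t + normSum ζ β N ω ^ 4 / t) + 2 * normSum ζ γ N ω ^ 2 := by
    intro ω
    rw [hdec]
    have h1 : normSum ζ β N ω ^ 2 ≤ t + normSum ζ β N ω ^ 4 / t := by
      rw [← sub_nonneg]
      have : t + normSum ζ β N ω ^ 4 / t - normSum ζ β N ω ^ 2 =
          ((t - normSum ζ β N ω ^ 2 / 2) ^ 2 + 3 / 4 * normSum ζ β N ω ^ 4) / t := by
        field_simp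
        ring
      rw [this]
      positivity
    nlinarith [sq_nonneg (normSum ζ β N ω - normSum ζ γ N ω)]
  have hi1 : Integrable (fun ω => normSum ζ β N ω ^ 4 / t) P := hZβ4i.div_const t
  have hi2 := hZγ.integrable_sq
  have hi3 : Integrable (fun ω => 2 * (t + normSum ζ β N ω ^ 4 / t)) P :=
    ((integrable_const t).add hi1).const_mul 2
  calc ∫ ω in S, normSum ζ α N ω ^ 2 ∂P
      ≤ ∫ ω in S, (2 * (t + normSum ζ β N ω ^ 4 / t) + 2 * normSum ζ γ N ω ^ 2) ∂P := by
        refine integral_mono (h.memLp_normSum hα hα2 N).integrable_sq.integrableOn ?_ hpt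
        exact (hi3.add (hi2.const_mul 2)).integrableOn
    _ = 2 * (P.real S * t + (∫ ω in S, normSum ζ β N ω ^ 4 ∂P) / t) +
        2 * ∫ ω in S, normSum ζ γ N ω ^ 2 ∂P := by
        rw [integral_add hi3.integrableOn (hi2.const_mul 2).integrableOn, integral_const_mul, integral_const_mul,
          integral_add (integrable_const t) hi1.integrableOn, setIntegral_const, integral_div,
          smul_eq_mul]
    _ ≤ 2 * (ε / (8 * t) * t + B / t) + 2 * (ε / 8) := by
        gcongr
        · exact (setIntegral_le_integral hZβ4i (ae_of_all _ fun ω => by positivity)).trans hZβ4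
        · exact (setIntegral_le_integral hi2 (ae_of_all _ fun ω => by positivity)).trans hZγ2
    _ ≤ ε := by
        have h1 : ε / (8 * t) * t = ε / 8 := by field_simp
        have h2 : B / t ≤ ε / 8 := by
          rw [ht, div_div_eq_mul_div, div_le_div_iff₀ (by positivity) (by norm_num)]
          nlinarith
        rw [h1]
        linarith

/-! ### Anti-concentration from correlation. -/

/-- Anti-concentration: a random variable of bounded second moment, which is correlated with a
random variable of bounded fourth moment, is bounded away from zero with positive probability. -/
theorem exists_le_measureReal_lt_abs {a b m : ℝ} (ha : 0 < a) (hb : 0 ≤ b) (hm : 0 ≤ m) :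
    ∃ s > 0, ∃ p > 0, ∀ {Ω : Type*} [MeasurableSpace Ω] (P : Measure Ω) [IsProbabilityMeasure P]
      (U V : Ω → ℝ), MemLp U 2 P → MemLp V 2 P → Integrable (fun ω => V ω ^ 4) P →
      a ≤ ∫ ω, U ω * V ω ∂P → ∫ ω, U ω ^ 2 ∂P ≤ b → ∫ ω, V ω ^ 4 ∂P ≤ m →
      p ≤ P.real {ω | s < |U ω|} := by
  -- The constants split the correlation `a`: where |U| ≤ s it is at most a/4, the term τU²/2 costs
  -- at most a/4, the fourth moment of V at most a/8. The probability of |U| > s has to supply the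
  -- rest.
  set s := a / (4 * (2 + m)) with hs
  set τ := a / (2 * (b + 1)) with hτ
  have hs0 : 0 < s := by positivity
  have hτ0 : 0 < τ := by positivity
  set t := 4 * (m + 1) / (a * τ) with ht
  have ht0 : 0 < t := by positivity
  refine ⟨s, hs0, a * τ / (4 * t), by positivity, fun P _ U V hU hV hV4 hUV hU2 hV4m => ?_⟩
  rename_i Ω _ _
  set S := {ω | s < |U ω|} with hS
  have hSn : NullMeasurableSet S P :=
    nullMeasurableSet_lt aemeasurable_const hU.aestronglyMeasurable.norm.aemeasurable
  -- Off `S` one uses |V| ≤ 2 + V⁴. On `S` Young's inequality is used twice, first between `U` and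
  -- `V`, then between V² and the constant `t`, so that only fourth moments of `V` occur.
  have hpt : ∀ ω, U ω * V ω ≤ s * (2 + V ω ^ 4) + (τ / 2 * U ω ^ 2 +
      (V ω ^ 4 / t / (2 * τ)  + S.indicator (fun _ => t / (2 * τ)) ω)) := by
    intro ω
    have hV1 : |V ω| ≤ 2 + V ω ^ 4 := by
      have : V ω ^ 4 = |V ω| ^ 4 := (Even.pow_abs (by decide) _).symm
      rw [this]
      nlinarith [sq_nonneg (|V ω| - 1), sq_nonneg (|V ω| ^ 2 - 1), abs_nonneg (V ω)]
    have habs : U ω * V ω ≤ |U ω| * |V ω| := (le_abs_self _).trans (abs_mul _ _).le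
    by_cases hω : ω ∈ S
    · rw [Set.indicator_of_mem hω]
      have h1 : |U ω| * |V ω| ≤ τ / 2 * U ω ^ 2 + V ω ^ 2 / (2 * τ) := by
        rw [← sub_nonneg]
        have : τ / 2 * U ω ^ 2 + V ω ^ 2 / (2 * τ) - |U ω| * |V ω| =
            (τ * |U ω| - |V ω|) ^ 2 / (2 * τ) := by
          rw [← sq_abs (U ω), ← sq_abs (V ω)]
          field_simp
          ring
        rw [this]
        positivity
      have h2 : V ω ^ 2 ≤ V ω ^ 4 / t + t := by
        rw [← sub_nonneg]
        have : V ω ^ 4 / t + t - V ω ^ 2 = ((t - V ω ^ 2 / 2) ^ 2 + 3 / 4 * V ω ^ 4) / t := by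
          field_simp
          ring
        rw [this]
        positivity
      have h3 : V ω ^ 2 / (2 * τ) ≤ V ω ^ 4 / t / (2 * τ) + t / (2 * τ) := by
        rw [← add_div]
        gcongr
      have : 0 ≤ s * (2 + V ω ^ 4) := by positivity
      linarith
    · rw [Set.indicator_of_notMem hω]
      have h1 : |U ω| ≤ s := not_lt.1 hω
      have h2 : |U ω| * |V ω| ≤ s * (2 + V ω ^ 4) :=
        mul_le_mul h1 hV1 (abs_nonneg _) hs0.le
      have : 0 ≤ τ / 2 * U ω ^ 2 + (V ω ^ 4 / t / (2 * τ) + 0) := by positivity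
      linarith
  have hi1 : Integrable (fun ω => s * (2 + V ω ^ 4)) P := ((integrable_const 2).add hV4).const_mul s
  have hi2 : Integrable (fun ω => τ / 2 * U ω ^ 2) P := hU.integrable_sq.const_mul _
  have hi3 : Integrable (fun ω => V ω ^ 4 / t / (2 * τ)) P := (hV4.div_const t).div_const _
  have hi4 : Integrable (S.indicator fun _ => t / (2 * τ)) P :=
    (integrable_const _).indicator₀ hSn
  have hi34 : Integrable (fun ω => V ω ^ 4 / t / (2 * τ) +
      S.indicator (fun _ => t / (2 * τ)) ω) P := hi3.add hi4
  have hi234 : Integrable (fun ω => τ / 2 * U ω ^ 2 + (V ω ^ 4 / t / (2 * τ) +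
      S.indicator (fun _ => t / (2 * τ)) ω)) P := hi2.add hi34
  have hle := integral_mono (hU.integrable_mul hV) (hi1.add hi234) hpt
  simp only [Pi.add_apply, Pi.mul_apply] at hle
  rw [integral_add hi1 hi234, integral_add hi2 hi34, integral_add hi3 hi4, integral_const_mul, integral_const_mul,
    integral_add (integrable_const _) hV4, integral_div, integral_div,
    integral_indicator₀ hSn, setIntegral_const] at hle
  simp only [integral_const, probReal_univ, smul_eq_mul, one_mul] at hle
  have h1 : s * (2 + ∫ ω, V ω ^ 4 ∂P) ≤ a / 4 := by
    calc s * (2 + ∫ ω, V ω ^ 4 ∂P) ≤ s * (2 + m) := by gcongr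
      _ = a / 4 := by rw [hs]; field_simp
  have h2 : τ / 2 * ∫ ω, U ω ^ 2 ∂P ≤ a / 4 := by
    calc τ / 2 * ∫ ω, U ω ^ 2 ∂P ≤ τ / 2 * (b + 1) := by gcongr; linarith
      _ = a / 4 := by rw [hτ]; field_simp; norm_num
  have h3 : (∫ ω, V ω ^ 4 ∂P) / t / (2 * τ) ≤ a / 8 := by
    calc (∫ ω, V ω ^ 4 ∂P) / t / (2 * τ) ≤ (m + 1) / t / (2 * τ) := by gcongr; linarith
      _ = a / 8 := by rw [ht]; field_simp; norm_num
  have h4 : a / 8 ≤ P.real S * (t / (2 * τ)) := by linarith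
  rw [div_le_iff₀ (by positivity)]
  have : P.real S * (t / (2 * τ)) * (2 * τ) = P.real S * t := by field_simp
  nlinarith [mul_le_mul_of_nonneg_right h4 (show (0 : ℝ) ≤ 2 * τ by positivity)]

/-! ### Second order Taylor remainders. -/

section Taylor

variable {E : Type*} [NormedAddCommGroup E] [NormedSpace ℝ E]

/-- The mean value inequality is applied twice, to `fderiv ℝ f` and then to `f`. This loses the
factor ½ of the sharp constant, which plays no role later. -/
theorem abs_sub_fderiv_le_of_norm_fderiv_fderiv_le {f : E → ℝ} {U : Set E} (hU : IsOpen U)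
    (hf : ContDiffOn ℝ 2 f U) {x : E} {r : ℝ} (hr : Metric.closedBall x r ⊆ U) {B : ℝ}
    (hB : ∀ y ∈ U, ‖fderiv ℝ (fderiv ℝ f) y‖ ≤ B) {h : E} (hh : ‖h‖ ≤ r) :
    |f (x + h) - f x - fderiv ℝ f x h| ≤ B * ‖h‖ ^ 2 := by
  have hr0 : 0 ≤ r := (norm_nonneg h).trans hh
  have hsub : Metric.closedBall x ‖h‖ ⊆ U := (Metric.closedBall_subset_closedBall hh).trans hr
  have hx : x ∈ Metric.closedBall x ‖h‖ := Metric.mem_closedBall_self (norm_nonneg h)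
  have hdf : ∀ y ∈ U, DifferentiableAt ℝ f y := fun y hy =>
    (hf.contDiffAt (hU.mem_nhds hy)).differentiableAt (by norm_num)
  have hddf : ∀ y ∈ U, DifferentiableAt ℝ (fderiv ℝ f) y := fun y hy =>
    ((hf.contDiffAt (hU.mem_nhds hy)).fderiv_right (m := 1) (by norm_num)).differentiableAt
      (by norm_num)
  have hB0 : 0 ≤ B := (norm_nonneg (fderiv ℝ (fderiv ℝ f) x)).trans (hB x (hsub hx))
  have h1 : ∀ y ∈ Metric.closedBall x ‖h‖, ‖fderiv ℝ f y - fderiv ℝ f x‖ ≤ B * ‖h‖ := by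
    intro y hy
    refine ((convex_closedBall x ‖h‖).norm_image_sub_le_of_norm_fderiv_le
      (fun z hz => hddf z (hsub hz)) (fun z hz => hB z (hsub hz)) hx hy).trans ?_
    gcongr
    rwa [← dist_eq_norm]
  have := (convex_closedBall x ‖h‖).norm_image_sub_le_of_norm_fderiv_le'
    (fun z hz => hdf z (hsub hz)) h1 hx (y := x + h) (by simp)
  simpa [sq, mul_assoc] using this

/-- The quotient of the second order Taylor remainder of `f` at `x` by `‖h‖²`, extended by `0`. -/
def taylorQuot (f : E → ℝ) (x h : E) : ℝ :=
  (f (x + h) - f x - fderiv ℝ f x h - 1 / 2 * fderiv ℝ (fderiv ℝ f) x h h) / ‖h‖ ^ 2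

theorem taylor_expansion (f : E → ℝ) (x h : E) :
    f (x + h) = f x + fderiv ℝ f x h + 1 / 2 * fderiv ℝ (fderiv ℝ f) x h h +
      taylorQuot f x h * ‖h‖ ^ 2 := by
  rcases eq_or_ne h 0 with rfl | hh
  · simp
  · have : ‖h‖ ≠ 0 := norm_ne_zero_iff.2 hh
    unfold taylorQuot
    field_simp
    ring

theorem taylorQuot_zero (f : E → ℝ) (x : E) : taylorQuot f x 0 = 0 := by simp [taylorQuot]

/-- This provides the integrable envelope for the uniform strong law of the quotients: the first
order remainder and half the Hessian form are each at most `B‖h‖²`. -/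
theorem abs_taylorQuot_le {f : E → ℝ} {U : Set E} (hU : IsOpen U)
    (hf : ContDiffOn ℝ 2 f U) {x : E} {r : ℝ} (hr : Metric.closedBall x r ⊆ U) {B : ℝ}
    (hB : ∀ y ∈ U, ‖fderiv ℝ (fderiv ℝ f) y‖ ≤ B) {h : E} (hh : ‖h‖ ≤ r) :
    |taylorQuot f x h| ≤ 2 * B := by
  have hx : x ∈ U := hr (Metric.mem_closedBall_self ((norm_nonneg h).trans hh))
  have hB0 : 0 ≤ B := (norm_nonneg (fderiv ℝ (fderiv ℝ f) x)).trans (hB x hx)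
  rcases eq_or_ne h 0 with rfl | hne
  · simp [taylorQuot_zero, hB0]
  have hpos : 0 < ‖h‖ := norm_pos_iff.2 hne
  unfold taylorQuot
  rw [abs_div, abs_of_pos (pow_pos hpos 2), div_le_iff₀ (pow_pos hpos 2)]
  have h1 := abs_sub_fderiv_le_of_norm_fderiv_fderiv_le hU hf hr hB hh
  have h2 : |fderiv ℝ (fderiv ℝ f) x h h| ≤ B * ‖h‖ ^ 2 := by
    calc |fderiv ℝ (fderiv ℝ f) x h h| ≤ ‖fderiv ℝ (fderiv ℝ f) x‖ * ‖h‖ * ‖h‖ :=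
          (fderiv ℝ (fderiv ℝ f) x).le_opNorm₂ h h
      _ ≤ B * ‖h‖ * ‖h‖ := by gcongr; exact hB x hx
      _ = B * ‖h‖ ^ 2 := by ring
  rw [abs_le] at *
  constructor <;> linarith [h1.1, h1.2, h2.1, h2.2]

/-- Subtracting half the Hessian form from `f` leaves a function whose derivative near `x` is
`fderiv ℝ f x` up to o(‖h‖); the mean value inequality then bounds the remainder. Symmetry of the
second derivative is what makes the derivative of `Q k k / 2` equal to `Q k`. -/
theorem tendsto_taylorQuot {f : E → ℝ} {x : E} (hf : ContDiffAt ℝ 2 f x) :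
    Tendsto (taylorQuot f x) (𝓝 0) (𝓝 0) := by
  rw [Metric.tendsto_nhds]
  intro ε hε
  set Q := fderiv ℝ (fderiv ℝ f) x with hQ
  have hsymm : ∀ v w, Q v w = Q w v := hf.isSymmSndFDerivAt (by simp)
  have hd2 : HasFDerivAt (fderiv ℝ f) Q x :=
    ((hf.fderiv_right (m := 1) (by norm_num)).differentiableAt (by norm_num)).hasFDerivAt
  have hd1 : ∀ᶠ y in 𝓝 x, DifferentiableAt ℝ f y := by
    filter_upwards [hf.eventually (by simp)] with y hy
    exact hy.differentiableAt (by norm_num)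
  have hlo := (hasFDerivAt_iff_isLittleO_nhds_zero.1 hd2).def (half_pos hε)
  have hd1' : ∀ᶠ h in 𝓝 (0 : E), DifferentiableAt ℝ f (x + h) := by
    have : Tendsto (fun h : E => x + h) (𝓝 0) (𝓝 x) := by
      simpa using (continuous_const.add continuous_id).tendsto (0 : E) (f := fun h : E => x + h)
    exact this.eventually hd1
  obtain ⟨ρ, hρ, hball⟩ := Metric.eventually_nhds_iff_ball.1 (hlo.and hd1')
  refine Metric.eventually_nhds_iff_ball.2 ⟨ρ, hρ, fun h hh => ?_⟩
  rcases eq_or_ne h 0 with rfl | hne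
  · simpa [taylorQuot_zero] using hε
  have hpos : 0 < ‖h‖ := norm_pos_iff.2 hne
  set g : E → ℝ := fun k => f (x + k) - 1 / 2 * Q k k with hg
  have hsub : Metric.closedBall (0 : E) ‖h‖ ⊆ Metric.ball 0 ρ :=
    Metric.closedBall_subset_ball (by simpa using hh)
  have hgd : ∀ k ∈ Metric.closedBall (0 : E) ‖h‖,
      HasFDerivAt g (fderiv ℝ f (x + k) - Q k) k := by
    intro k hk
    have h1 : HasFDerivAt (fun k => f (x + k)) (fderiv ℝ f (x + k)) k := by
      have := (hball k (hsub hk)).2.hasFDerivAt.comp k ((hasFDerivAt_id k).const_add x)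
      rwa [ContinuousLinearMap.comp_id] at this
    have h2 : HasFDerivAt (fun k => 1 / 2 * Q k k) (Q k) k := by
      have := ((Q.hasFDerivAt (x := k)).clm_apply (hasFDerivAt_id k)).const_mul (1 / 2)
      refine this.congr_fderiv ?_
      ext v
      simp [hsymm v k]
      ring
    exact h1.sub h2
  have hbd : ∀ k ∈ Metric.closedBall (0 : E) ‖h‖,
      ‖fderiv ℝ f (x + k) - Q k - fderiv ℝ f x‖ ≤ ε / 2 * ‖h‖ := by
    intro k hk
    have := (hball k (hsub hk)).1
    rw [sub_right_comm]
    refine this.trans ?_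
    gcongr
    simpa using hk
  have := (convex_closedBall (0 : E) ‖h‖).norm_image_sub_le_of_norm_hasFDerivWithin_le'
    (fun k hk => (hgd k hk).hasFDerivWithinAt) hbd (Metric.mem_closedBall_self (norm_nonneg h))
    (y := h) (by simp)
  simp only [hg, add_zero, map_zero, mul_zero, sub_zero, Real.norm_eq_abs] at this
  rw [Real.dist_eq, sub_zero, taylorQuot, abs_div, abs_of_pos (pow_pos hpos 2),
    div_lt_iff₀ (pow_pos hpos 2)]
  calc |f (x + h) - f x - fderiv ℝ f x h - 1 / 2 * Q h h|
      = |f (x + h) - 1 / 2 * Q h h - f x - fderiv ℝ f x h| := by congr 1; ring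
    _ ≤ ε / 2 * ‖h‖ * ‖h‖ := this
    _ < ε * ‖h‖ ^ 2 := by nlinarith [pow_pos hpos 2]

/-- Continuity on a closed ball, including the origin, turns the quotient into an element of a space
`C(T, ℝ)` with `T` compact in finite dimension, as the uniform strong law requires. At the origin it
is the Peano form of the remainder. -/
theorem continuous_taylorQuot {f : E → ℝ} {U : Set E} (hU : IsOpen U)
    (hf : ContDiffOn ℝ 2 f U) {x : E} {r : ℝ} (hr : Metric.closedBall x r ⊆ U) :
    Continuous fun h : Metric.closedBall (0 : E) r => taylorQuot f x h := by
  rw [continuous_iff_continuousAt]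
  rintro ⟨h, hh⟩
  have hh' : ‖h‖ ≤ r := by simpa using hh
  refine ContinuousAt.comp (g := taylorQuot f x) ?_ continuousAt_subtype_val
  rcases eq_or_ne h 0 with rfl | hne
  · have hx : x ∈ U := hr (Metric.mem_closedBall_self ((norm_nonneg _).trans hh'))
    have := tendsto_taylorQuot (hf.contDiffAt (hU.mem_nhds hx))
    rwa [← taylorQuot_zero f x] at this
  · have hxh : x + h ∈ U := hr (by simpa using hh')
    have hc : ContinuousAt (fun k => f (x + k)) h :=
      ContinuousAt.comp (g := f) (hf.continuousOn.continuousAt (hU.mem_nhds hxh))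
        (continuous_const.add continuous_id).continuousAt
    unfold taylorQuot
    refine ContinuousAt.div ?_ (by fun_prop) (by positivity)
    refine ((hc.sub continuousAt_const).sub (by fun_prop)).sub ?_
    fun_prop

end Taylor

/-! ### Measurability of derivatives in a parameter and differentiation under the integral. -/

section Param

variable {E : Type*} [NormedAddCommGroup E] [NormedSpace ℝ E]

/-- In finite dimension a linear map depends continuously on its values on a basis, so only finitely
many evaluations have to be measurable. -/
theorem stronglyMeasurable_clm_of_apply [FiniteDimensional ℝ E] {Z G : Type*} [MeasurableSpace Z]
    [NormedAddCommGroup G] [NormedSpace ℝ G] {T : Z → E →L[ℝ] G}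
    (h : ∀ v, StronglyMeasurable fun z => T z v) : StronglyMeasurable T := by
  set b := Module.finBasis ℝ E
  have hT : T = fun z => ∑ i, ContinuousLinearMap.smulRightL ℝ E G
      (LinearMap.toContinuousLinearMap (b.coord i)) (T z (b i)) := by
    funext z
    ext v
    conv_lhs => rw [← b.sum_repr v]
    simp only [map_sum, map_smul, sum_apply]
    rfl
  rw [hT]
  refine Finset.stronglyMeasurable_fun_sum _ fun i _ => ?_
  exact (ContinuousLinearMap.continuous _).comp_stronglyMeasurable (h (b i))

theorem stronglyMeasurable_fderiv_param [FiniteDimensional ℝ E] {Z G : Type*} [MeasurableSpace Z]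
    [NormedAddCommGroup G] [NormedSpace ℝ G] {F : E → Z → G} {U : Set E} (hU : IsOpen U)
    (hm : ∀ x ∈ U, StronglyMeasurable (F x))
    (hd : ∀ z, ∀ x ∈ U, DifferentiableAt ℝ (fun t => F t z) x) {x : E} (hx : x ∈ U) :
    StronglyMeasurable fun z => fderiv ℝ (fun t => F t z) x := by
  refine stronglyMeasurable_clm_of_apply fun v => ?_
  have hc : Tendsto (fun n : ℕ => ‖(n : ℝ)‖) atTop atTop := by
    simpa using tendsto_natCast_atTop_atTop (R := ℝ)
  have hcont : Tendsto (fun n : ℕ => x + ((n : ℝ))⁻¹ • v) atTop (𝓝 x) := by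
    have : Tendsto (fun n : ℕ => ((n : ℝ))⁻¹) atTop (𝓝 0) := tendsto_inv_atTop_nhds_zero_nat
    simpa using (this.smul_const v).const_add x
  obtain ⟨n₀, hn₀⟩ := eventually_atTop.1 (hcont.eventually (hU.mem_nhds hx))
  -- The derivative is the limit of the difference quotients with step 1/n. The shift by `n₀` keeps
  -- every sampled point in `U`, where `F` is known to be measurable.
  refine stronglyMeasurable_of_tendsto (u := atTop)
    (f := fun (n : ℕ) z => ((n + n₀ : ℕ) : ℝ) • (F (x + (((n + n₀ : ℕ) : ℝ))⁻¹ • v) z - F x z))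
    (fun n => ?_) ?_
  · exact ((hm _ (hn₀ _ (Nat.le_add_left _ _))).sub (hm x hx)).const_smul _
  · rw [tendsto_pi_nhds]
    intro z
    exact ((hd z x hx).hasFDerivAt.lim v hc).comp (tendsto_add_atTop_nat n₀)

theorem hasFDerivAt_integral_param [FiniteDimensional ℝ E] {Ω Z G : Type*} [MeasurableSpace Ω]
    [MeasurableSpace Z] [NormedAddCommGroup G] [NormedSpace ℝ G] {P : Measure Ω} {ζ : Ω → Z}
    (hζ : Measurable ζ) {F : E → Z → G} {U : Set E} (hU : IsOpen U)
    (hm : ∀ x ∈ U, StronglyMeasurable (F x))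
    (hd : ∀ z, ∀ x ∈ U, DifferentiableAt ℝ (fun t => F t z) x) {D : Z → ℝ}
    (hD : ∀ z, ∀ x ∈ U, ‖fderiv ℝ (fun t => F t z) x‖ ≤ D z)
    (hDint : Integrable (fun ω => D (ζ ω)) P)
    (hint : ∀ x ∈ U, Integrable (fun ω => F x (ζ ω)) P) {x : E} (hx : x ∈ U) :
    HasFDerivAt (fun t => ∫ ω, F t (ζ ω) ∂P) (∫ ω, fderiv ℝ (fun t => F t (ζ ω)) x ∂P) x := by
  refine hasFDerivAt_integral_of_dominated_of_fderiv_le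
    (F' := fun t ω => fderiv ℝ (fun t => F t (ζ ω)) t)
    (bound := fun ω => D (ζ ω)) (hU.mem_nhds hx) ?_ (hint x hx) ?_
    (ae_of_all _ fun ω t ht => hD _ t ht) hDint
    (ae_of_all _ fun ω t ht => (hd _ t ht).hasFDerivAt)
  · filter_upwards [hU.mem_nhds hx] with t ht
    exact ((hm t ht).comp_measurable hζ).aestronglyMeasurable
  · exact ((stronglyMeasurable_fderiv_param hU hm hd hx).comp_measurable hζ).aestronglyMeasurable

end Param

/-! ### Smooth losses and their means. -/

/-- A loss `F` whose realisations are continuous on `C` and twice continuously differentiable on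
`interior C`, with the envelopes `D₀`, `D₁`, `D₂`. -/
structure IsSmoothLoss {E Z : Type*} [NormedAddCommGroup E] [NormedSpace ℝ E] [MeasurableSpace Z]
    (F : E → Z → ℝ) (C : Set E) (D₀ D₁ D₂ : Z → ℝ) : Prop where
  measurable : ∀ t, Measurable (F t)
  continuousOn : ∀ z, ContinuousOn (fun t => F t z) C
  contDiffOn : ∀ z, ContDiffOn ℝ 2 (fun t => F t z) (interior C)
  bound₀ : ∀ z, ∀ t ∈ C, |F t z| ≤ D₀ z
  bound₁ : ∀ z, ∀ t ∈ interior C, ‖fderiv ℝ (fun s => F s z) t‖ ≤ D₁ z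
  bound₂ : ∀ z, ∀ t ∈ interior C, ‖fderiv ℝ (fderiv ℝ (fun s => F s z)) t‖ ≤ D₂ z

namespace IsSmoothLoss

variable {E Z Ω : Type*} [NormedAddCommGroup E] [NormedSpace ℝ E] [MeasurableSpace Z]
  [MeasurableSpace Ω] {F : E → Z → ℝ} {C : Set E} {D₀ D₁ D₂ : Z → ℝ} {P : Measure Ω} {ζ : Ω → Z}

theorem differentiableAt (h : IsSmoothLoss F C D₀ D₁ D₂) (z : Z) {t : E} (ht : t ∈ interior C) :
    DifferentiableAt ℝ (fun s => F s z) t :=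
  ((h.contDiffOn z).contDiffAt (isOpen_interior.mem_nhds ht)).differentiableAt (by norm_num)

theorem differentiableAt_fderiv (h : IsSmoothLoss F C D₀ D₁ D₂) (z : Z) {t : E}
    (ht : t ∈ interior C) : DifferentiableAt ℝ (fderiv ℝ (fun s => F s z)) t :=
  (((h.contDiffOn z).contDiffAt (isOpen_interior.mem_nhds ht)).fderiv_right (m := 1)
    (by norm_num)).differentiableAt (by norm_num)

theorem integrable (h : IsSmoothLoss F C D₀ D₁ D₂) (hζ : Measurable ζ)
    (hD : Integrable (fun ω => D₀ (ζ ω)) P) {t : E} (ht : t ∈ C) :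
    Integrable (fun ω => F t (ζ ω)) P :=
  hD.mono' ((h.measurable t).comp hζ).aestronglyMeasurable (ae_of_all _ fun _ => h.bound₀ _ t ht)

variable [FiniteDimensional ℝ E]

theorem stronglyMeasurable_fderiv (h : IsSmoothLoss F C D₀ D₁ D₂) {t : E} (ht : t ∈ interior C) :
    StronglyMeasurable fun z => fderiv ℝ (fun s => F s z) t :=
  stronglyMeasurable_fderiv_param isOpen_interior
    (fun s _ => (h.measurable s).stronglyMeasurable) (fun z _ hs => h.differentiableAt z hs) ht

theorem stronglyMeasurable_fderiv_fderiv (h : IsSmoothLoss F C D₀ D₁ D₂) {t : E}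
    (ht : t ∈ interior C) : StronglyMeasurable fun z => fderiv ℝ (fderiv ℝ (fun s => F s z)) t :=
  stronglyMeasurable_fderiv_param (F := fun s z => fderiv ℝ (fun s => F s z) s) isOpen_interior
    (fun _ hs => h.stronglyMeasurable_fderiv hs) (fun z _ hs => h.differentiableAt_fderiv z hs) ht

theorem integrable_fderiv (h : IsSmoothLoss F C D₀ D₁ D₂) (hζ : Measurable ζ)
    (hD : Integrable (fun ω => D₁ (ζ ω)) P) {t : E} (ht : t ∈ interior C) :
    Integrable (fun ω => fderiv ℝ (fun s => F s (ζ ω)) t) P :=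
  hD.mono' ((h.stronglyMeasurable_fderiv ht).comp_measurable hζ).aestronglyMeasurable
    (ae_of_all _ fun _ => h.bound₁ _ t ht)

theorem integrable_fderiv_fderiv (h : IsSmoothLoss F C D₀ D₁ D₂) (hζ : Measurable ζ)
    (hD : Integrable (fun ω => D₂ (ζ ω)) P) {t : E} (ht : t ∈ interior C) :
    Integrable (fun ω => fderiv ℝ (fderiv ℝ (fun s => F s (ζ ω))) t) P :=
  hD.mono' ((h.stronglyMeasurable_fderiv_fderiv ht).comp_measurable hζ).aestronglyMeasurable
    (ae_of_all _ fun _ => h.bound₂ _ t ht)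

theorem fderiv_integral (h : IsSmoothLoss F C D₀ D₁ D₂) (hζ : Measurable ζ)
    (hD₀ : Integrable (fun ω => D₀ (ζ ω)) P) (hD₁ : Integrable (fun ω => D₁ (ζ ω)) P)
    {t : E} (ht : t ∈ interior C) :
    fderiv ℝ (fun s => ∫ ω, F s (ζ ω) ∂P) t = ∫ ω, fderiv ℝ (fun s => F s (ζ ω)) t ∂P :=
  (hasFDerivAt_integral_param hζ isOpen_interior
    (fun s _ => (h.measurable s).stronglyMeasurable) (fun z _ hs => h.differentiableAt z hs)
    h.bound₁ hD₁ (fun _ hs => h.integrable hζ hD₀ (interior_subset hs)) ht).fderiv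

theorem fderiv_fderiv_integral (h : IsSmoothLoss F C D₀ D₁ D₂) (hζ : Measurable ζ)
    (hD₀ : Integrable (fun ω => D₀ (ζ ω)) P) (hD₁ : Integrable (fun ω => D₁ (ζ ω)) P)
    (hD₂ : Integrable (fun ω => D₂ (ζ ω)) P) {t : E} (ht : t ∈ interior C) :
    fderiv ℝ (fderiv ℝ (fun s => ∫ ω, F s (ζ ω) ∂P)) t =
      ∫ ω, fderiv ℝ (fderiv ℝ (fun s => F s (ζ ω))) t ∂P := by
  have heq : fderiv ℝ (fun s => ∫ ω, F s (ζ ω) ∂P) =ᶠ[𝓝 t]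
      fun s => ∫ ω, fderiv ℝ (fun s => F s (ζ ω)) s ∂P := by
    filter_upwards [isOpen_interior.mem_nhds ht] with s hs
    exact h.fderiv_integral hζ hD₀ hD₁ hs
  rw [heq.fderiv_eq]
  exact (hasFDerivAt_integral_param (F := fun s z => fderiv ℝ (fun s => F s z) s) hζ
    isOpen_interior (fun _ hs => h.stronglyMeasurable_fderiv hs)
    (fun z _ hs => h.differentiableAt_fderiv z hs) h.bound₂ hD₂
    (fun _ hs => h.integrable_fderiv hζ hD₁ hs) ht).fderiv

theorem stronglyMeasurable_taylorQuot (h : IsSmoothLoss F C D₀ D₁ D₂) {t : E}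
    (ht : t ∈ interior C) (v : E) :
    StronglyMeasurable fun z => taylorQuot (fun s => F s z) t v := by
  have h1 : StronglyMeasurable fun z => fderiv ℝ (fun s => F s z) t v :=
    (ContinuousLinearMap.apply ℝ ℝ v).continuous.comp_stronglyMeasurable
      (h.stronglyMeasurable_fderiv ht)
  have h2 : StronglyMeasurable fun z => fderiv ℝ (fderiv ℝ (fun s => F s z)) t v v :=
    ((ContinuousLinearMap.apply ℝ ℝ v).continuous.comp
      (ContinuousLinearMap.apply ℝ (E →L[ℝ] ℝ) v).continuous).comp_stronglyMeasurable
      (h.stronglyMeasurable_fderiv_fderiv ht)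
  exact (((((h.measurable _).stronglyMeasurable.sub (h.measurable t).stronglyMeasurable).sub
    h1).sub (h2.const_mul (1 / 2))).mul (stronglyMeasurable_const (b := (‖v‖ ^ 2)⁻¹)))

/-- Taylor expansion of the mean of a smooth loss: the remainder quotients can be averaged. -/
theorem integral_expansion (h : IsSmoothLoss F C D₀ D₁ D₂) (hζ : Measurable ζ)
    (hD₀ : Integrable (fun ω => D₀ (ζ ω)) P) (hD₁ : Integrable (fun ω => D₁ (ζ ω)) P)
    (hD₂ : Integrable (fun ω => D₂ (ζ ω)) P) {t : E} (ht : t ∈ interior C) {v : E}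
    (hv : t + v ∈ C) :
    ∫ ω, F (t + v) (ζ ω) ∂P = ∫ ω, F t (ζ ω) ∂P + (∫ ω, fderiv ℝ (fun s => F s (ζ ω)) t ∂P) v +
      1 / 2 * (∫ ω, fderiv ℝ (fderiv ℝ (fun s => F s (ζ ω))) t ∂P) v v +
      (∫ ω, taylorQuot (fun s => F s (ζ ω)) t v ∂P) * ‖v‖ ^ 2 := by
  have i0 := h.integrable hζ hD₀ (interior_subset ht)
  have i1 := h.integrable_fderiv hζ hD₁ ht
  have i2 := h.integrable_fderiv_fderiv hζ hD₂ ht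
  have i1v : Integrable (fun ω => fderiv ℝ (fun s => F s (ζ ω)) t v) P :=
    i1.apply_continuousLinearMap v
  have i2v := i2.apply_continuousLinearMap v
  have i2vv : Integrable (fun ω => fderiv ℝ (fderiv ℝ (fun s => F s (ζ ω))) t v v) P :=
    i2v.apply_continuousLinearMap v
  -- After multiplication by `‖v‖ ^ 2` the quotient is a combination of integrable terms, so the
  -- remainder can be averaged without a bound on it.
  have hq : ∀ ω, taylorQuot (fun s => F s (ζ ω)) t v * ‖v‖ ^ 2 = F (t + v) (ζ ω) - F t (ζ ω) -
      fderiv ℝ (fun s => F s (ζ ω)) t v - 1 / 2 *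
        fderiv ℝ (fderiv ℝ (fun s => F s (ζ ω))) t v v := by
    intro ω
    have := taylor_expansion (fun s => F s (ζ ω)) t v
    linarith
  have i3 := h.integrable hζ hD₀ hv
  rw [← integral_mul_const, ContinuousLinearMap.integral_apply i1,
    ContinuousLinearMap.integral_apply i2, ContinuousLinearMap.integral_apply i2v]
  simp_rw [hq]
  have i30 : Integrable (fun ω => F (t + v) (ζ ω) - F t (ζ ω)) P := i3.sub i0
  have i301 : Integrable (fun ω => F (t + v) (ζ ω) - F t (ζ ω) -
      fderiv ℝ (fun s => F s (ζ ω)) t v) P := i30.sub i1v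
  rw [integral_sub i301 (i2vv.const_mul _), integral_sub i30 i1v,
    integral_sub i3 i0, integral_const_mul]
  ring

end IsSmoothLoss

/-! ### Stability of quadratic minimisation. -/

section Argmin

variable {E : Type*} [NormedAddCommGroup E] [NormedSpace ℝ E]

theorem abs_bilin_le {Q : E →L[ℝ] E →L[ℝ] ℝ} {B : ℝ} (hB : ‖Q‖ ≤ B) (v w : E) :
    |Q v w| ≤ B * ‖v‖ * ‖w‖ :=
  (Q.le_opNorm₂ v w).trans (by gcongr)

/-- Stability of the minimum of a perturbed quadratic function: if `h` does at least as well as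
the minimizer `g` of the quadratic function `-Q(g, ·) + Q(·, ·) / 2`, for a perturbation of it
which is small compared to `‖·‖²`, then `Q(h, h)` is close to `Q(g, g)`. -/
theorem perturbed_quadratic_argmin {B c ε τ e : ℝ} (hc : 0 < c) (hτ0 : 0 < τ) (hτ1 : τ ≤ 1)
    (hτε : B * τ ≤ ε / 2) (he0 : 0 < e) (he1 : e ≤ c / 8) (he2 : e ≤ c * τ ^ 2 / 12)
    (he3 : e ≤ ε / 18) {Q : E →L[ℝ] E →L[ℝ] ℝ} (hQB : ‖Q‖ ≤ B) (hQs : ∀ v w, Q v w = Q w v)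
    (hQc : ∀ v, c * ‖v‖ ^ 2 ≤ Q v v) (g h : E) (v₀ vg vh V₀ Vh : ℝ)
    (h1 : |vg - v₀ - (-Q g g + 1 / 2 * Q g g)| ≤ e * ‖g‖ ^ 2)
    (h2 : |vh - v₀ - (-Q g h + 1 / 2 * Q h h)| ≤ e * ‖h‖ ^ 2)
    (h3 : vh ≤ vg) (h4 : |Vh - V₀ - 1 / 2 * Q h h| ≤ e * ‖h‖ ^ 2) :
    |Vh - V₀ - 1 / 2 * Q g g| ≤ ε * ‖g‖ ^ 2 := by
  have hB : 0 ≤ B := (norm_nonneg Q).trans hQB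
  set d := h - g with hd
  have hhd : h = g + d := by rw [hd]; abel
  have hQhh : Q h h = Q g g + 2 * Q g d + Q d d := by
    rw [hhd]
    simp only [map_add, add_apply]
    rw [hQs d g]
    ring
  have hQgh : Q g h = Q g g + Q g d := by
    rw [hhd, map_add]
  have hn : ‖h‖ ^ 2 ≤ 2 * ‖d‖ ^ 2 + 2 * ‖g‖ ^ 2 := by
    have : ‖h‖ ≤ ‖g‖ + ‖d‖ := by
      rw [hhd]
      exact norm_add_le g d
    nlinarith [norm_nonneg h, norm_nonneg g, norm_nonneg d, sq_nonneg (‖g‖ - ‖d‖)]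
  rw [abs_le] at h1 h2 h4
  -- Completing the square, the quadratic function at `h` exceeds its value at `g` by exactly `Q d d
  -- / 2`; since `vh ≤ vg`, only the two perturbation errors can pay for this.
  have hQd : 1 / 2 * Q d d ≤ e * (2 * ‖d‖ ^ 2 + 3 * ‖g‖ ^ 2) := by
    have := mul_le_mul_of_nonneg_left hn he0.le
    linarith [h1.2, h2.1]
  -- Coercivity gives `c / 2 * ‖d‖²` on the left; `e ≤ c / 8` absorbs the `‖d‖²` term on the right,
  -- and `e ≤ c τ² / 12` handles the remaining `3 e ‖g‖²`.
  have hd2 : ‖d‖ ^ 2 ≤ (τ * ‖g‖) ^ 2 := by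
    have k1 := hQc d
    have k2 := mul_le_mul_of_nonneg_right he1 (sq_nonneg ‖d‖)
    have k3 := mul_le_mul_of_nonneg_right he2 (sq_nonneg ‖g‖)
    have : c / 4 * ‖d‖ ^ 2 ≤ c / 4 * (τ * ‖g‖) ^ 2 := by nlinarith
    exact le_of_mul_le_mul_left this (by positivity)
  have hd1 : ‖d‖ ≤ τ * ‖g‖ := le_of_sq_le_sq hd2 (by positivity)
  have hdg : ‖d‖ ^ 2 ≤ ‖g‖ ^ 2 := by
    refine hd2.trans (pow_le_pow_left₀ (by positivity) ?_ 2)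
    nlinarith [norm_nonneg g]
  have hQgd : |Q g d| ≤ ε / 2 * ‖g‖ ^ 2 := by
    calc |Q g d| ≤ B * ‖g‖ * ‖d‖ := abs_bilin_le hQB g d
      _ ≤ B * ‖g‖ * (τ * ‖g‖) := by gcongr
      _ = B * τ * ‖g‖ ^ 2 := by ring
      _ ≤ ε / 2 * ‖g‖ ^ 2 := by gcongr
  have hQd0 : 0 ≤ Q d d := le_trans (by positivity) (hQc d)
  have hQd5 : 1 / 2 * Q d d ≤ e * (5 * ‖g‖ ^ 2) :=
    hQd.trans (mul_le_mul_of_nonneg_left (by linarith) he0.le)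
  have he4 : e * ‖h‖ ^ 2 ≤ e * (4 * ‖g‖ ^ 2) :=
    mul_le_mul_of_nonneg_left (by linarith) he0.le
  have he9 : e * (9 * ‖g‖ ^ 2) ≤ ε / 2 * ‖g‖ ^ 2 := by
    have := mul_le_mul_of_nonneg_right he3 (sq_nonneg ‖g‖)
    linarith
  rw [abs_le] at hQgd ⊢
  constructor <;> linarith [h4.1, h4.2, hQgd.1, hQgd.2]

/-- The tolerance `e` is fixed from `B`, `c` and `ε` alone, hence before the random vectors `g` and
`h` to which it is applied. -/
theorem exists_perturbed_quadratic_argmin {B c ε : ℝ} (hB : 0 ≤ B) (hc : 0 < c) (hε : 0 < ε) :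
    ∃ e > 0, ∀ (Q : E →L[ℝ] E →L[ℝ] ℝ), ‖Q‖ ≤ B → (∀ v w, Q v w = Q w v) →
      (∀ v, c * ‖v‖ ^ 2 ≤ Q v v) → ∀ (g h : E) (v₀ vg vh V₀ Vh : ℝ),
      |vg - v₀ - (-Q g g + 1 / 2 * Q g g)| ≤ e * ‖g‖ ^ 2 →
      |vh - v₀ - (-Q g h + 1 / 2 * Q h h)| ≤ e * ‖h‖ ^ 2 →
      vh ≤ vg → |Vh - V₀ - 1 / 2 * Q h h| ≤ e * ‖h‖ ^ 2 →
      |Vh - V₀ - 1 / 2 * Q g g| ≤ ε * ‖g‖ ^ 2 := by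
  obtain ⟨τ, hτ0, hτ1, hτε⟩ : ∃ τ : ℝ, 0 < τ ∧ τ ≤ 1 ∧ B * τ ≤ ε / 2 := by
    refine ⟨min 1 (ε / (2 * (B + 1))), by positivity, min_le_left _ _, ?_⟩
    calc B * min 1 (ε / (2 * (B + 1))) ≤ (B + 1) * (ε / (2 * (B + 1))) := by
          gcongr
          · linarith
          · exact min_le_right _ _
      _ = ε / 2 := by field_simp
  exact ⟨min (c / 8) (min (c * τ ^ 2 / 12) (ε / 18)), by positivity, fun Q hQB hQs hQc =>
    perturbed_quadratic_argmin hc hτ0 hτ1 hτε (by positivity) (min_le_left _ _)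
      ((min_le_right _ _).trans (min_le_left _ _)) ((min_le_right _ _).trans (min_le_right _ _))
      hQB hQs hQc⟩

end Argmin

/-! ### Empirical minimisers: consistency, quadratic growth and pathwise expansion. -/

/-- The empirical mean of `g` over the first `N` terms of the sequence `ζ`. -/
def empMean {Ω Z G : Type*} [AddCommGroup G] [Module ℝ G] (ζ : ℕ → Ω → Z) (g : Z → G) (N : ℕ)
    (ω : Ω) : G :=
  (N : ℝ)⁻¹ • ∑ i ∈ Finset.range N, g (ζ i ω)

theorem empMean_expansion {E Z Ω : Type*} [NormedAddCommGroup E] [NormedSpace ℝ E]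
    {F : E → Z → ℝ} {ζ : ℕ → Ω → Z} (x v : E) (N : ℕ) (ω : Ω) :
    empMean ζ (F (x + v)) N ω = empMean ζ (F x) N ω +
      empMean ζ (fun z => fderiv ℝ (fun s => F s z) x) N ω v +
      1 / 2 * empMean ζ (fun z => fderiv ℝ (fderiv ℝ (fun s => F s z)) x) N ω v v +
      empMean ζ (fun z => taylorQuot (fun s => F s z) x v) N ω * ‖v‖ ^ 2 := by
  simp only [empMean, smul_apply, sum_apply, smul_eq_mul]
  rw [Finset.sum_congr rfl fun i _ => taylor_expansion (fun s => F s (ζ i ω)) x v]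
  rw [Finset.sum_add_distrib, Finset.sum_add_distrib, Finset.sum_add_distrib, ← Finset.sum_mul,
    ← Finset.mul_sum]
  ring

/-- A unique minimizer on a compact set is well separated. -/
theorem exists_lt_of_unique_min {E : Type*} [MetricSpace E] {C : Set E} (hC : IsCompact C)
    {V : E → ℝ} (hV : ContinuousOn V C) {x : E} (hmin : ∀ y ∈ C, y ≠ x → V x < V y) {ρ : ℝ}
    (hρ : 0 < ρ) : ∃ a > 0, ∀ y ∈ C, V y ≤ V x + a → dist y x < ρ := by
  set S := C \ Metric.ball x ρ with hS
  have hSc : IsCompact S := hC.diff Metric.isOpen_ball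
  rcases S.eq_empty_or_nonempty with hemp | hne
  · refine ⟨1, one_pos, fun y hy _ => ?_⟩
    by_contra hcon
    have : y ∈ S := ⟨hy, hcon⟩
    rw [hemp] at this
    exact this
  · obtain ⟨y₀, hy₀, hy₀min⟩ := hSc.exists_isMinOn hne (hV.mono Set.sdiff_subset)
    have hlt : V x < V y₀ := by
      refine hmin y₀ hy₀.1 fun h => hy₀.2 ?_
      rw [h]
      exact Metric.mem_ball_self hρ
    refine ⟨(V y₀ - V x) / 2, by linarith, fun y hy hle => ?_⟩
    by_contra hcon
    have := hy₀min (show y ∈ S from ⟨hy, hcon⟩)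
    simp only [Set.mem_ofPred_eq] at this
    linarith

namespace IsSmoothLoss

variable {E Z Ω : Type*} [NormedAddCommGroup E] [NormedSpace ℝ E] [MeasurableSpace Z]
  [MeasurableSpace Ω] {F : E → Z → ℝ} {C : Set E} {D₀ D₁ D₂ : Z → ℝ} {P : Measure Ω}
  {ζ : ℕ → Ω → Z}

theorem uniform_strong_law (h : IsSmoothLoss F C D₀ D₁ D₂) (hζ : IsIIDSeq ζ P)
    (hC : IsCompact C) (hD₀ : Integrable (fun ω => D₀ (ζ 0 ω)) P) :
    ContinuousOn (fun t => ∫ ω, F t (ζ 0 ω) ∂P) C ∧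
    ∀ᵐ ω ∂P, ∀ ε > 0, ∀ᶠ N : ℕ in atTop, ∀ t ∈ C,
      |empMean ζ (F t) N ω - ∫ ω, F t (ζ 0 ω) ∂P| ≤ ε := by
  have : CompactSpace C := isCompact_iff_compactSpace.1 hC
  obtain ⟨h1, h2⟩ := hζ.uniform_strong_law (T := C) (g := fun t => F t)
    (fun t => h.measurable t) (fun z => (h.continuousOn z).domRestrict)
    (fun t z => h.bound₀ z t t.2) hD₀
  refine ⟨continuousOn_iff_continuous_domRestrict.2 h1, ?_⟩
  filter_upwards [h2] with ω hω ε hε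
  filter_upwards [hω ε hε] with N hN t ht
  exact hN ⟨t, ht⟩

/-- Strong consistency of minimizers of the empirical mean. -/
theorem ae_tendsto_argmin (h : IsSmoothLoss F C D₀ D₁ D₂) (hζ : IsIIDSeq ζ P)
    (hC : IsCompact C) (hD₀ : Integrable (fun ω => D₀ (ζ 0 ω)) P) {x : E} (hx : x ∈ C)
    (hmin : ∀ y ∈ C, y ≠ x → ∫ ω, F x (ζ 0 ω) ∂P < ∫ ω, F y (ζ 0 ω) ∂P) {est : ℕ → Ω → E}
    (hest : ∀ᵐ ω ∂P, ∀ N, 1 ≤ N → est N ω ∈ C ∧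
      IsMinOn (fun t => empMean ζ (F t) N ω) C (est N ω)) :
    ∀ᵐ ω ∂P, Tendsto (fun N => est N ω) atTop (𝓝 x) := by
  obtain ⟨hV, hU⟩ := h.uniform_strong_law hζ hC hD₀
  filter_upwards [hU, hest] with ω hω hm
  rw [Metric.tendsto_nhds]
  intro ρ hρ
  obtain ⟨a, ha, hsep⟩ := exists_lt_of_unique_min hC hV hmin hρ
  filter_upwards [hω (a / 2) (half_pos ha), eventually_ge_atTop 1] with N hN hN1
  obtain ⟨hmem, hmn⟩ := hm N hN1
  refine hsep _ hmem ?_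
  have h1 := abs_le.1 (hN _ hmem)
  have h2 := abs_le.1 (hN _ hx)
  have h3 := hmn hx
  simp only [Set.mem_ofPred_eq] at h3
  linarith [h1.1, h2.2]

variable [FiniteDimensional ℝ E]

theorem integral_fderiv_eq_zero (h : IsSmoothLoss F C D₀ D₁ D₂) (hζ : IsIIDSeq ζ P)
    (hD₀ : Integrable (fun ω => D₀ (ζ 0 ω)) P) (hD₁ : Integrable (fun ω => D₁ (ζ 0 ω)) P)
    {x : E} (hx : x ∈ interior C)
    (hmin : ∀ y ∈ C, y ≠ x → ∫ ω, F x (ζ 0 ω) ∂P < ∫ ω, F y (ζ 0 ω) ∂P) :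
    ∫ ω, fderiv ℝ (fun s => F s (ζ 0 ω)) x ∂P = 0 := by
  rw [← h.fderiv_integral (hζ.measurable 0) hD₀ hD₁ hx]
  refine IsLocalMin.fderiv_eq_zero ?_
  filter_upwards [mem_interior_iff_mem_nhds.1 hx] with y hy
  rcases eq_or_ne y x with rfl | hne
  · exact le_rfl
  · exact (hmin y hy hne).le

theorem integral_fderiv_fderiv_symm (h : IsSmoothLoss F C D₀ D₁ D₂) (hζ : IsIIDSeq ζ P)
    (hD₂ : Integrable (fun ω => D₂ (ζ 0 ω)) P) {x : E} (hx : x ∈ interior C) (v w : E) :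
    (∫ ω, fderiv ℝ (fderiv ℝ (fun s => F s (ζ 0 ω))) x ∂P) v w =
      (∫ ω, fderiv ℝ (fderiv ℝ (fun s => F s (ζ 0 ω))) x ∂P) w v := by
  have i2 := h.integrable_fderiv_fderiv (hζ.measurable 0) hD₂ hx
  rw [ContinuousLinearMap.integral_apply i2, ContinuousLinearMap.integral_apply i2,
    ContinuousLinearMap.integral_apply (i2.apply_continuousLinearMap v),
    ContinuousLinearMap.integral_apply (i2.apply_continuousLinearMap w)]
  congr 1
  funext ω
  exact ((h.contDiffOn (ζ 0 ω)).contDiffAt (isOpen_interior.mem_nhds hx)).isSymmSndFDerivAt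
    (by simp) v w

/-- The uniform law of large numbers for the second order Taylor quotients. -/
theorem uniform_strong_law_taylorQuot (h : IsSmoothLoss F C D₀ D₁ D₂) (hζ : IsIIDSeq ζ P)
    (hD₂ : Integrable (fun ω => D₂ (ζ 0 ω)) P) {x : E} {r : ℝ} (hr0 : 0 ≤ r)
    (hr : Metric.closedBall x r ⊆ interior C) :
    Tendsto (fun v => ∫ ω, taylorQuot (fun s => F s (ζ 0 ω)) x v ∂P)
      (𝓝[Metric.closedBall 0 r] 0) (𝓝 0) ∧
    ∀ᵐ ω ∂P, ∀ ε > 0, ∀ᶠ N : ℕ in atTop, ∀ v ∈ Metric.closedBall (0 : E) r,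
      |empMean ζ (fun z => taylorQuot (fun s => F s z) x v) N ω -
        ∫ ω, taylorQuot (fun s => F s (ζ 0 ω)) x v ∂P| ≤ ε := by
  have hx : x ∈ interior C := hr (Metric.mem_closedBall_self hr0)
  have : CompactSpace (Metric.closedBall (0 : E) r) :=
    isCompact_iff_compactSpace.1 (isCompact_closedBall 0 r)
  obtain ⟨h1, h2⟩ := hζ.uniform_strong_law (T := Metric.closedBall (0 : E) r)
    (g := fun v z => taylorQuot (fun s => F s z) x v) (D := fun z => 2 * D₂ z)
    (fun v => (h.stronglyMeasurable_taylorQuot hx v).measurable)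
    (fun z => continuous_taylorQuot isOpen_interior (h.contDiffOn z) hr)
    (fun v z => abs_taylorQuot_le isOpen_interior (h.contDiffOn z) hr (h.bound₂ z)
      (mem_closedBall_zero_iff.1 v.2)) (hD₂.const_mul 2)
  refine ⟨?_, ?_⟩
  · have := (continuousOn_iff_continuous_domRestrict
      (f := fun v => ∫ ω, taylorQuot (fun s => F s (ζ 0 ω)) x v ∂P).2 h1) 0 (Metric.mem_closedBall_self hr0)
    simpa only [ContinuousWithinAt, taylorQuot_zero, integral_zero] using this
  · filter_upwards [h2] with ω hω ε hε
    filter_upwards [hω ε hε] with N hN v hv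
    exact hN ⟨v, hv⟩

/-- The mean of a smooth loss with a nondegenerate unique minimizer grows quadratically. -/
theorem exists_quadratic_growth (h : IsSmoothLoss F C D₀ D₁ D₂) (hζ : IsIIDSeq ζ P)
    (hC : IsCompact C) (hD₀ : Integrable (fun ω => D₀ (ζ 0 ω)) P)
    (hD₁ : Integrable (fun ω => D₁ (ζ 0 ω)) P) (hD₂ : Integrable (fun ω => D₂ (ζ 0 ω)) P)
    {x : E} (hx : x ∈ interior C)
    (hmin : ∀ y ∈ C, y ≠ x → ∫ ω, F x (ζ 0 ω) ∂P < ∫ ω, F y (ζ 0 ω) ∂P) {c : ℝ} (hc : 0 < c)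
    (hQ : ∀ v, c * ‖v‖ ^ 2 ≤ (∫ ω, fderiv ℝ (fderiv ℝ (fun s => F s (ζ 0 ω))) x ∂P) v v) :
    ∃ a > 0, ∀ y ∈ C, a * ‖y - x‖ ^ 2 ≤ ∫ ω, F y (ζ 0 ω) ∂P - ∫ ω, F x (ζ 0 ω) ∂P := by
  obtain ⟨r, hr0, hr⟩ := Metric.nhds_basis_closedBall.mem_iff.1 (isOpen_interior.mem_nhds hx)
  obtain ⟨hq, -⟩ := h.uniform_strong_law_taylorQuot hζ hD₂ hr0.le hr
  have hnear := (hq.mono_left (nhdsWithin_mono _ (Set.Subset.refl _))).eventually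
    (Metric.closedBall_mem_nhds (0 : ℝ) (show 0 < c / 4 by positivity))
  rw [nhdsWithin_eq_nhds.2 (Metric.closedBall_mem_nhds _ hr0)] at hnear
  obtain ⟨ρ, hρ, hball⟩ := Metric.eventually_nhds_iff_ball.1 hnear
  have hV := (h.uniform_strong_law hζ hC hD₀).1
  obtain ⟨b, hb, hsep⟩ := exists_lt_of_unique_min hC hV hmin (lt_min hρ hr0)
  obtain ⟨M, hM⟩ := hC.isBounded.exists_norm_le
  set L := (M + ‖x‖) ^ 2 + 1 with hL
  have hL0 : 0 < L := by positivity
  -- Near `x` the Taylor quotient costs `c / 4` out of the `c / 2` given by the Hessian. Elsewhere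
  -- the risk gap is at least `b`, while `‖y - x‖²` is at most `L` on the compact set.
  refine ⟨min (c / 4) (b / L), by positivity, fun y hy => ?_⟩
  by_cases hyx : ∫ ω, F y (ζ 0 ω) ∂P ≤ ∫ ω, F x (ζ 0 ω) ∂P + b
  · have hd := hsep y hy hyx
    rw [dist_eq_norm] at hd
    have hd1 := (lt_min_iff.1 hd).1
    have hexp := h.integral_expansion (hζ.measurable 0) hD₀ hD₁ hD₂ hx (v := y - x)
      (by simpa using hy)
    rw [h.integral_fderiv_eq_zero hζ hD₀ hD₁ hx hmin, add_sub_cancel] at hexp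
    have hk := hball (y - x) (by simpa using hd1)
    rw [dist_zero_right, Real.norm_eq_abs, abs_le] at hk
    have hk1 := mul_le_mul_of_nonneg_right hk.1 (sq_nonneg ‖y - x‖)
    have hk2 := hQ (y - x)
    have hk3 := mul_le_mul_of_nonneg_right (min_le_left (c / 4) (b / L)) (sq_nonneg ‖y - x‖)
    simp only [zero_apply, add_zero] at hexp
    linarith
  · have hk : ‖y - x‖ ^ 2 ≤ L := by
      have : ‖y - x‖ ≤ M + ‖x‖ := (norm_sub_le _ _).trans (by gcongr; exact hM y hy)
      have := pow_le_pow_left₀ (norm_nonneg _) this 2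
      linarith
    calc min (c / 4) (b / L) * ‖y - x‖ ^ 2 ≤ b / L * L := by
          gcongr
          exact min_le_right _ _
      _ = b := by field_simp
      _ ≤ _ := by linarith

/-- The asymptotic expansion of the excess risk of an empirical minimizer. -/
theorem ae_excess_risk_expansion (h : IsSmoothLoss F C D₀ D₁ D₂) (hζ : IsIIDSeq ζ P)
    (hC : IsCompact C) (hD₀ : Integrable (fun ω => D₀ (ζ 0 ω)) P)
    (hD₁ : Integrable (fun ω => D₁ (ζ 0 ω)) P) (hD₂ : Integrable (fun ω => D₂ (ζ 0 ω)) P)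
    {x : E} (hx : x ∈ interior C)
    (hmin : ∀ y ∈ C, y ≠ x → ∫ ω, F x (ζ 0 ω) ∂P < ∫ ω, F y (ζ 0 ω) ∂P) {c : ℝ} (hc : 0 < c)
    {Q : E →L[ℝ] E →L[ℝ] ℝ} (hQ : Q = ∫ ω, fderiv ℝ (fderiv ℝ (fun s => F s (ζ 0 ω))) x ∂P)
    (hQc : ∀ v, c * ‖v‖ ^ 2 ≤ Q v v) {η : Z → E}
    (hη : ∀ z w, Q (η z) w = -fderiv ℝ (fun s => F s z) x w)
    {est : ℕ → Ω → E}
    (hest : ∀ᵐ ω ∂P, ∀ N, 1 ≤ N → est N ω ∈ C ∧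
      IsMinOn (fun t => empMean ζ (F t) N ω) C (est N ω)) {ε : ℝ} (hε : 0 < ε) :
    ∀ᵐ ω ∂P, ∀ᶠ N in atTop, |∫ ω', F (est N ω) (ζ 0 ω') ∂P - ∫ ω', F x (ζ 0 ω') ∂P -
      1 / 2 * Q (empMean ζ η N ω) (empMean ζ η N ω)| ≤ ε * ‖empMean ζ η N ω‖ ^ 2 := by
  obtain ⟨r, hr0, hr⟩ := Metric.nhds_basis_closedBall.mem_iff.1 (isOpen_interior.mem_nhds hx)
  obtain ⟨hq, hqN⟩ := h.uniform_strong_law_taylorQuot hζ hD₂ hr0.le hr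
  obtain ⟨e, he, hdet⟩ := exists_perturbed_quadratic_argmin (E := E) (norm_nonneg Q) hc hε
  have hnear := hq.eventually (Metric.closedBall_mem_nhds (0 : ℝ) (show 0 < e / 3 by positivity))
  rw [nhdsWithin_eq_nhds.2 (Metric.closedBall_mem_nhds _ hr0)] at hnear
  obtain ⟨ρ', hρ', hball'⟩ := Metric.eventually_nhds_iff_ball.1 hnear
  obtain ⟨ρ, hρ, hρr, hball⟩ : ∃ ρ > 0, ρ ≤ r ∧ ∀ v : E, ‖v‖ < ρ →
      |∫ ω, taylorQuot (fun s => F s (ζ 0 ω)) x v ∂P| ≤ e / 3 :=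
    ⟨min ρ' r, lt_min hρ' hr0, min_le_right _ _, fun v hv => by
      simpa using hball' v (by simpa using (lt_min_iff.1 hv).1)⟩
  have hI := h.integral_fderiv_eq_zero hζ hD₀ hD₁ hx hmin
  have hsymm : ∀ v w, Q v w = Q w v := by
    rw [hQ]
    exact h.integral_fderiv_fderiv_symm hζ hD₂ hx
  have hdN := hζ.strong_law (h.stronglyMeasurable_fderiv hx).measurable
    (h.integrable_fderiv (hζ.measurable 0) hD₁ hx)
  have hd2N := hζ.strong_law (h.stronglyMeasurable_fderiv_fderiv hx).measurable
    (h.integrable_fderiv_fderiv (hζ.measurable 0) hD₂ hx)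
  rw [hI] at hdN
  rw [← hQ] at hd2N
  filter_upwards [hest, h.ae_tendsto_argmin hζ hC hD₀ (interior_subset hx) hmin hest, hqN, hdN,
    hd2N] with ω hm hcons hqω hdω hd2ω
  have hGN : ∀ N w, Q (empMean ζ η N ω) w =
      -empMean ζ (fun z => fderiv ℝ (fun s => F s z) x) N ω w := by
    intro N w
    simp only [empMean, map_smul, map_sum, smul_apply, sum_apply, hη, Finset.sum_neg_distrib,
      smul_neg]
  -- Coercivity of `Q` controls the linearised step by the empirical gradient, which tends to 0 by
  -- the strong law; so the step itself tends to 0.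
  have hgle : ∀ N, ‖empMean ζ η N ω‖ ≤
      c⁻¹ * ‖empMean ζ (fun z => fderiv ℝ (fun s => F s z) x) N ω‖ := by
    intro N
    set g := empMean ζ η N ω with hg
    set D := empMean ζ (fun z => fderiv ℝ (fun s => F s z) x) N ω with hD
    rcases eq_or_ne g 0 with h0 | h0
    · rw [h0, norm_zero]
      positivity
    have hgpos : 0 < ‖g‖ := norm_pos_iff.2 h0
    have h1 : c * ‖g‖ ^ 2 ≤ ‖D‖ * ‖g‖ := by
      calc c * ‖g‖ ^ 2 ≤ Q g g := hQc g
        _ = -D g := hGN N g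
        _ ≤ ‖D g‖ := neg_le_abs _
        _ ≤ ‖D‖ * ‖g‖ := D.le_opNorm g
    rw [le_inv_mul_iff₀ hc]
    nlinarith
  have hg0 : Tendsto (fun N => ‖empMean ζ η N ω‖) atTop (𝓝 0) := by
    refine squeeze_zero (fun _ => norm_nonneg _) hgle ?_
    have := (hdω.norm).const_mul c⁻¹
    simpa [empMean] using this
  have hh0 : Tendsto (fun N => ‖est N ω - x‖) atTop (𝓝 0) := by
    rw [← tendsto_iff_norm_sub_tendsto_zero]
    exact hcons
  have hH0 : Tendsto (fun N => ‖empMean ζ (fun z => fderiv ℝ (fderiv ℝ (fun s => F s z)) x) N ω -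
      Q‖) atTop (𝓝 0) := by
    rw [← tendsto_iff_norm_sub_tendsto_zero]
    exact hd2ω
  filter_upwards [hqω (e / 3) (by positivity), hg0.eventually_lt_const hρ,
    hh0.eventually_lt_const hρ, hH0.eventually_lt_const (show 0 < e / 3 by positivity),
    eventually_ge_atTop 1] with N hqN' hgN hhN hHN hN1
  obtain ⟨hmem, hmn⟩ := hm N hN1
  -- Within radius `ρ` the error comes from the empirical Hessian, at most `e / 6` after the factor
  -- ½, and from the empirical Taylor quotient, at most `2 e / 3`; together they stay below `e`.
  have hloc : ∀ v : E, ‖v‖ < ρ → |empMean ζ (F (x + v)) N ω - empMean ζ (F x) N ω -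
      (-Q (empMean ζ η N ω) v + 1 / 2 * Q v v)| ≤ e * ‖v‖ ^ 2 := by
    intro v hv
    rw [empMean_expansion x v N ω, hGN N v]
    have h1 := hqN' v (by simpa using (hv.le.trans hρr))
    have h2 := hball v hv
    have h3 : |(empMean ζ (fun z => fderiv ℝ (fderiv ℝ (fun s => F s z)) x) N ω - Q) v v| ≤
        e / 3 * ‖v‖ ^ 2 := by
      rw [sq, ← mul_assoc]
      exact abs_bilin_le hHN.le v v
    simp only [sub_apply] at h3
    have h4 : |empMean ζ (fun z => taylorQuot (fun s => F s z) x v) N ω| ≤ 2 * e / 3 := by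
      rw [abs_le] at *
      constructor <;> linarith [h1.1, h1.2, h2.1, h2.2]
    have h5 : |empMean ζ (fun z => taylorQuot (fun s => F s z) x v) N ω * ‖v‖ ^ 2| ≤
        2 * e / 3 * ‖v‖ ^ 2 := by
      rw [abs_mul, abs_of_nonneg (sq_nonneg ‖v‖)]
      gcongr
    rw [abs_le] at *
    have := mul_nonneg he.le (sq_nonneg ‖v‖)
    constructor <;> linarith [h3.1, h3.2, h5.1, h5.2]
  have hxh : x + (est N ω - x) = est N ω := by abel
  -- The linearised minimiser must be an admissible competitor before the empirical minimiser can be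
  -- compared with it; this holds because the step is eventually small and `x` is interior.
  have hxg : x + empMean ζ η N ω ∈ C := by
    refine interior_subset (hr ?_)
    simpa using hgN.le.trans hρr
  refine hdet Q le_rfl hsymm hQc (empMean ζ η N ω) (est N ω - x) (empMean ζ (F x) N ω)
    (empMean ζ (F (x + empMean ζ η N ω)) N ω) (empMean ζ (F (est N ω)) N ω) _ _
    (hloc _ hgN) (by simpa only [hxh] using hloc _ hhN) (hmn hxg) ?_
  have hexp := h.integral_expansion (hζ.measurable 0) hD₀ hD₁ hD₂ hx (v := est N ω - x)
    (by rwa [hxh])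
  rw [hI, hxh, ← hQ] at hexp
  simp only [zero_apply, add_zero] at hexp
  rw [hexp]
  have : ∫ ω', F x (ζ 0 ω') ∂P + 1 / 2 * Q (est N ω - x) (est N ω - x) +
      (∫ ω', taylorQuot (fun s => F s (ζ 0 ω')) x (est N ω - x) ∂P) * ‖est N ω - x‖ ^ 2 -
      ∫ ω', F x (ζ 0 ω') ∂P - 1 / 2 * Q (est N ω - x) (est N ω - x) =
      (∫ ω', taylorQuot (fun s => F s (ζ 0 ω')) x (est N ω - x) ∂P) * ‖est N ω - x‖ ^ 2 := by ring
  rw [this, abs_mul, abs_of_nonneg (sq_nonneg ‖est N ω - x‖)]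
  gcongr
  exact (hball _ hhN).trans (by linarith)

end IsSmoothLoss

/-! ### From almost sure expansions to expectations. -/

/-- Events that almost surely occur only finitely often are contained in measurable events whose
probabilities tend to zero. -/
theorem exists_measurable_superset_tendsto_zero {Ω : Type*} [MeasurableSpace Ω] {P : Measure Ω}
    [IsFiniteMeasure P] {S : ℕ → Set Ω} (hS : ∀ᶠ N in atTop, NullMeasurableSet (S N) P)
    (h : ∀ᵐ ω ∂P, ∀ᶠ N in atTop, ω ∉ S N) :
    ∃ S' : ℕ → Set Ω, (∀ N, MeasurableSet (S' N)) ∧ (∀ N, S N ⊆ S' N) ∧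
      Tendsto (fun N => P (S' N)) atTop (𝓝 0) := by
  refine ⟨fun N => toMeasurable P (S N), fun N => measurableSet_toMeasurable P _,
    fun N => subset_toMeasurable P _, ?_⟩
  have hae : ∀ᵐ ω ∂P, ∀ᶠ N in atTop, (ω ∈ toMeasurable P (S N) ↔ ω ∈ (∅ : Set Ω)) := by
    obtain ⟨N₀, hN₀⟩ := eventually_atTop.1 hS
    have : ∀ᵐ ω ∂P, ∀ N, N₀ ≤ N → (ω ∈ toMeasurable P (S N) ↔ ω ∈ S N) := by
      rw [ae_all_iff]
      intro N
      by_cases hN : N₀ ≤ N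
      · filter_upwards [(hN₀ N hN).toMeasurable_ae_eq.mem_iff] with ω hω _ using hω
      · exact ae_of_all _ fun ω h => absurd h hN
    filter_upwards [this, h] with ω hω h'
    filter_upwards [h', eventually_ge_atTop N₀] with N hN hN'
    rw [hω N hN']
    simpa using hN
  have := tendsto_measure_of_ae_tendsto_indicator_of_isFiniteMeasure (μ := P) atTop
    MeasurableSet.empty (fun N => measurableSet_toMeasurable P (S N)) hae
  simpa using this

section Limit

variable {Ω : Type*} [MeasurableSpace Ω] {P : Measure Ω} {Z T W : ℕ → Ω → ℝ} {b t w : ℝ}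

/-- On the good event `Z` is within `e * W` of `T`, and `W` has bounded mean. Uniform integrability
of `W`, which dominates `T`, shows that removing the bad event changes the mean `t` of `T` very
little. Nothing is claimed about `Z` on the bad event. -/
theorem exists_exceptional_sets [IsProbabilityMeasure P]
    (hZ : ∀ N, 1 ≤ N → Integrable (Z N) P)
    (hT : ∀ N, 1 ≤ N → Integrable (T N) P) (hW : ∀ N, 1 ≤ N → Integrable (W N) P)
    (hW0 : ∀ N ω, 0 ≤ W N ω) (hTW : ∀ N ω, |T N ω| ≤ b * W N ω)
    (hTt : ∀ N, 1 ≤ N → ∫ ω, T N ω ∂P = t) (hWw : ∀ N, 1 ≤ N → ∫ ω, W N ω ∂P ≤ w)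
    (hUI : ∀ ε > 0, ∃ δ > 0, ∀ N : ℕ, 1 ≤ N → ∀ S : Set Ω, P.real S ≤ δ →
      ∫ ω in S, W N ω ∂P ≤ ε)
    (happ : ∀ ε > 0, ∀ᵐ ω ∂P, ∀ᶠ N in atTop, |Z N ω - T N ω| ≤ ε * W N ω) {ε : ℝ} (hε : 0 < ε) :
    ∃ S : ℕ → Set Ω, (∀ N, MeasurableSet (S N)) ∧ Tendsto (fun N => P (S N)) atTop (𝓝 0) ∧
      ∀ᶠ N in atTop, |∫ ω in (S N)ᶜ, Z N ω ∂P - t| ≤ ε := by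
  set e := ε / (2 * (|w| + 1)) with he
  have he0 : 0 < e := by positivity
  obtain ⟨S, hSm, hS, hSt⟩ := exists_measurable_superset_tendsto_zero (P := P)
    (S := fun N => {ω | e * W N ω < |Z N ω - T N ω|})
    (by
      filter_upwards [eventually_ge_atTop 1] with N hN
      exact nullMeasurableSet_lt ((hW N hN).aemeasurable.const_mul e)
        ((hZ N hN).sub (hT N hN)).aestronglyMeasurable.norm.aemeasurable)
    (by
      filter_upwards [happ e he0] with ω hω
      filter_upwards [hω] with N hN
      simpa using hN)
  refine ⟨S, hSm, hSt, ?_⟩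
  obtain ⟨δ, hδ, hUIδ⟩ := hUI (ε / (2 * (|b| + 1))) (by positivity)
  have hSr : ∀ᶠ N in atTop, P.real (S N) ≤ δ := by
    have : Tendsto (fun N => P.real (S N)) atTop (𝓝 0) := by
      exact (ENNReal.tendsto_toReal ENNReal.zero_ne_top).comp hSt
    exact this.eventually_le_const hδ
  filter_upwards [hSr, eventually_ge_atTop 1] with N hN hN1
  have h1 : |∫ ω in (S N)ᶜ, Z N ω ∂P - ∫ ω in (S N)ᶜ, T N ω ∂P| ≤ ε / 2 := by
    rw [← integral_sub (hZ N hN1).integrableOn (hT N hN1).integrableOn]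
    calc |∫ ω in (S N)ᶜ, (Z N ω - T N ω) ∂P| ≤ ∫ ω in (S N)ᶜ, |Z N ω - T N ω| ∂P :=
          abs_integral_le_integral_abs
      _ ≤ ∫ ω in (S N)ᶜ, e * W N ω ∂P := by
          refine setIntegral_mono_on ((hZ N hN1).sub (hT N hN1)).abs.integrableOn
            ((hW N hN1).const_mul e).integrableOn (hSm N).compl fun ω hω => ?_
          by_contra hcon
          exact hω (hS N (not_le.1 hcon))
      _ ≤ ∫ ω, e * W N ω ∂P := setIntegral_le_integral ((hW N hN1).const_mul e)
          (ae_of_all _ fun ω => mul_nonneg he0.le (hW0 N ω))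
      _ = e * ∫ ω, W N ω ∂P := integral_const_mul _ _
      _ ≤ e * (|w| + 1) := by
          gcongr
          linarith [hWw N hN1, le_abs_self w]
      _ = ε / 2 := by rw [he]; field_simp
  have h2 : |∫ ω in S N, T N ω ∂P| ≤ ε / 2 := by
    calc |∫ ω in S N, T N ω ∂P| ≤ ∫ ω in S N, |T N ω| ∂P := abs_integral_le_integral_abs
      _ ≤ ∫ ω in S N, |b| * W N ω ∂P := by
          refine setIntegral_mono_on (hT N hN1).abs.integrableOn
            ((hW N hN1).const_mul _).integrableOn (hSm N) fun ω _ => (hTW N ω).trans ?_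
          exact mul_le_mul_of_nonneg_right (le_abs_self b) (hW0 N ω)
      _ = |b| * ∫ ω in S N, W N ω ∂P := integral_const_mul _ _
      _ ≤ (|b| + 1) * (ε / (2 * (|b| + 1))) := by
          have := hUIδ N hN1 (S N) hN
          have h0 : 0 ≤ ∫ ω in S N, W N ω ∂P := integral_nonneg fun ω => hW0 N ω
          gcongr
          linarith
      _ = ε / 2 := by field_simp
  have h3 := integral_add_compl (hSm N) (hT N hN1)
  rw [hTt N hN1] at h3
  rw [abs_le] at *
  constructor <;> linarith [h1.1, h1.2, h2.1, h2.2]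

/-- Nonnegativity lets the bad event be discarded, so the lower limit needs no uniform integrability
of `Z`. This is what covers the inner sample sizes other than K⋆. -/
theorem eventually_le_integral_of_approx (hZ : ∀ N, 1 ≤ N → Integrable (Z N) P)
    (hZ0 : ∀ N, 1 ≤ N → 0 ≤ᵐ[P] Z N)
    (hS : ∀ ε > 0, ∃ S : ℕ → Set Ω, (∀ N, MeasurableSet (S N)) ∧
      Tendsto (fun N => P (S N)) atTop (𝓝 0) ∧
      ∀ᶠ N in atTop, |∫ ω in (S N)ᶜ, Z N ω ∂P - t| ≤ ε) {ε : ℝ} (hε : 0 < ε) :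
    ∀ᶠ N in atTop, t - ε ≤ ∫ ω, Z N ω ∂P := by
  obtain ⟨S, hSm, -, hN⟩ := hS ε hε
  filter_upwards [hN, eventually_ge_atTop 1] with N hN hN1
  have := setIntegral_le_integral (s := (S N)ᶜ) (hZ N hN1) (hZ0 N hN1)
  linarith [(abs_le.1 hN).1]

/-- Here uniform integrability of `Z` makes its contribution on the bad event negligible, giving
both inequalities. -/
theorem tendsto_integral_of_approx (hZ : ∀ N, 1 ≤ N → Integrable (Z N) P)
    (hS : ∀ ε > 0, ∃ S : ℕ → Set Ω, (∀ N, MeasurableSet (S N)) ∧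
      Tendsto (fun N => P (S N)) atTop (𝓝 0) ∧
      ∀ᶠ N in atTop, |∫ ω in (S N)ᶜ, Z N ω ∂P - t| ≤ ε)
    (hUI : UnifIntegrable Z 1 P) :
    Tendsto (fun N => ∫ ω, Z N ω ∂P) atTop (𝓝 t) := by
  rw [Metric.tendsto_nhds]
  intro ε hε
  obtain ⟨S, hSm, hSt, hN⟩ := hS (ε / 3) (by positivity)
  obtain ⟨δ, hδ, hUIδ⟩ := hUI (ε := ε / 3) (by positivity)
  have hSδ : ∀ᶠ N in atTop, P (S N) ≤ ENNReal.ofReal δ :=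
    hSt.eventually_le_const (ENNReal.ofReal_pos.2 hδ)
  filter_upwards [hN, hSδ, eventually_ge_atTop 1] with N hN hNδ hN1
  have h1 := hUIδ N (S N) (hSm N) hNδ
  have h2 : |∫ ω in S N, Z N ω ∂P| ≤ ε / 3 := by
    rw [eLpNorm_indicator_eq_eLpNorm_restrict (hSm N), eLpNorm_one_eq_lintegral_enorm] at h1
    have h3 := (enorm_integral_le_lintegral_enorm (μ := P.restrict (S N)) (Z N)).trans h1
    rwa [Real.enorm_eq_ofReal_abs, ENNReal.ofReal_le_ofReal_iff (by positivity)] at h3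
  have h3 := integral_add_compl (hSm N) (hZ N hN1)
  rw [Real.dist_eq, ← h3, abs_lt]
  rw [abs_le] at h2 hN
  constructor <;> linarith [h2.1, h2.2, hN.1, hN.2]

end Limit

/-! ### Coordinates of the linearised step and the limit of the expected excess risk. -/

section Coordinates

variable {q : ℕ} {Ω Z : Type*} {ζ : ℕ → Ω → Z}

theorem empMean_apply_eq_normSum (η : Z → EuclideanSpace ℝ (Fin q)) {N : ℕ} (hN : 1 ≤ N) (ω : Ω)
    (j : Fin q) : √(N : ℝ) * empMean ζ η N ω j = normSum ζ (fun z => η z j) N ω := by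
  have hN' : (0 : ℝ) < N := by exact_mod_cast hN
  have hs : √(N : ℝ) ≠ 0 := (Real.sqrt_pos.2 hN').ne'
  have hinv : (N : ℝ)⁻¹ = (√(N : ℝ))⁻¹ * (√(N : ℝ))⁻¹ := by
    rw [← mul_inv, Real.mul_self_sqrt hN'.le]
  simp only [empMean, normSum, PiLp.smul_apply, smul_eq_mul, hinv, WithLp.ofLp_sum,
    Finset.sum_apply]
  field_simp

theorem bilin_eq_sum (Q : EuclideanSpace ℝ (Fin q) →L[ℝ] EuclideanSpace ℝ (Fin q) →L[ℝ] ℝ)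
    (v w : EuclideanSpace ℝ (Fin q)) :
    Q v w = ∑ j, ∑ k, Q (EuclideanSpace.single j 1) (EuclideanSpace.single k 1) * (v j * w k) := by
  have hv : ∀ u : EuclideanSpace ℝ (Fin q), u = ∑ j, u j • EuclideanSpace.single j (1 : ℝ) := by
    intro u
    have := (EuclideanSpace.basisFun (Fin q) ℝ).sum_repr u
    simpa using this.symm
  conv_lhs => rw [hv v, hv w]
  simp only [map_sum, map_smul, sum_apply, smul_apply, smul_eq_mul]
  rw [Finset.sum_comm]
  refine Finset.sum_congr rfl fun k _ => ?_
  rw [Finset.mul_sum]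
  refine Finset.sum_congr rfl fun j _ => ?_
  ring

theorem mul_bilin_empMean (Q : EuclideanSpace ℝ (Fin q) →L[ℝ] EuclideanSpace ℝ (Fin q) →L[ℝ] ℝ)
    (η : Z → EuclideanSpace ℝ (Fin q)) {N : ℕ} (hN : 1 ≤ N) (ω : Ω) :
    N * Q (empMean ζ η N ω) (empMean ζ η N ω) = ∑ j, ∑ k,
      Q (EuclideanSpace.single j 1) (EuclideanSpace.single k 1) *
        (normSum ζ (fun z => η z j) N ω * normSum ζ (fun z => η z k) N ω) := by
  rw [bilin_eq_sum, Finset.mul_sum]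
  refine Finset.sum_congr rfl fun j _ => ?_
  rw [Finset.mul_sum]
  refine Finset.sum_congr rfl fun k _ => ?_
  rw [← empMean_apply_eq_normSum η hN, ← empMean_apply_eq_normSum η hN]
  have : (N : ℝ) = √(N : ℝ) * √(N : ℝ) := (Real.mul_self_sqrt (Nat.cast_nonneg N)).symm
  conv_lhs => rw [this]
  ring

theorem mul_norm_empMean_sq (η : Z → EuclideanSpace ℝ (Fin q)) {N : ℕ} (hN : 1 ≤ N) (ω : Ω) :
    N * ‖empMean ζ η N ω‖ ^ 2 = ∑ j, normSum ζ (fun z => η z j) N ω ^ 2 := by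
  rw [EuclideanSpace.real_norm_sq_eq, Finset.mul_sum]
  refine Finset.sum_congr rfl fun j _ => ?_
  rw [← empMean_apply_eq_normSum η hN, mul_pow, Real.sq_sqrt (Nat.cast_nonneg N)]

end Coordinates

section Risk

variable {E Z Ω : Type*} [NormedAddCommGroup E] [MeasurableSpace E]
  [BorelSpace E] [MeasurableSpace Ω] {P : Measure Ω} {C : Set E}

theorem integrable_comp_of_continuousOn [IsFiniteMeasure P] (hC : IsCompact C) {V : E → ℝ}
    (hV : ContinuousOn V C) {θ : Ω → E} (hθ : AEMeasurable θ P) (hθC : ∀ᵐ ω ∂P, θ ω ∈ C) :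
    Integrable (fun ω => V (θ ω)) P := by
  obtain ⟨M, hM⟩ := hC.exists_bound_of_continuousOn hV
  classical
  -- `V` is only known to be continuous on `C`; its extension by 0 outside this closed set is
  -- measurable and agrees almost surely along `θ`.
  have hm : Measurable (C.piecewise V 0) :=
    hV.measurable_piecewise continuousOn_const hC.isClosed.measurableSet
  refine Integrable.of_bound ((hm.comp_aemeasurable hθ).congr ?_).aestronglyMeasurable M ?_
  · filter_upwards [hθC] with ω hω
    simp [hω]
  · filter_upwards [hθC] with ω hω using hM _ hω

end Risk

namespace IsSmoothLoss

variable {q : ℕ} {Z Ω : Type*} [MeasurableSpace Z] [MeasurableSpace Ω]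
  {F : EuclideanSpace ℝ (Fin q) → Z → ℝ} {C : Set (EuclideanSpace ℝ (Fin q))} {D₀ D₁ D₂ : Z → ℝ}
  {P : Measure Ω} [IsProbabilityMeasure P] {ζ : ℕ → Ω → Z}

/-- The expected excess risk of an empirical minimizer: lower bound, and limit under uniform
integrability. -/
theorem excess_risk_limit (h : IsSmoothLoss F C D₀ D₁ D₂) (hζ : IsIIDSeq ζ P)
    (hC : IsCompact C) (hD₀ : Integrable (fun ω => D₀ (ζ 0 ω)) P)
    (hD₁ : Integrable (fun ω => D₁ (ζ 0 ω)) P) (hD₂ : Integrable (fun ω => D₂ (ζ 0 ω)) P)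
    {x : EuclideanSpace ℝ (Fin q)} (hx : x ∈ interior C)
    (hmin : ∀ y ∈ C, y ≠ x → ∫ ω, F x (ζ 0 ω) ∂P < ∫ ω, F y (ζ 0 ω) ∂P) {c : ℝ} (hc : 0 < c)
    {Q : EuclideanSpace ℝ (Fin q) →L[ℝ] EuclideanSpace ℝ (Fin q) →L[ℝ] ℝ}
    (hQ : Q = ∫ ω, fderiv ℝ (fderiv ℝ (fun s => F s (ζ 0 ω))) x ∂P)
    (hQc : ∀ v, c * ‖v‖ ^ 2 ≤ Q v v) {η : Z → EuclideanSpace ℝ (Fin q)}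
    (hη : ∀ z w, Q (η z) w = -fderiv ℝ (fun s => F s z) x w)
    (hηm : ∀ j, Measurable fun z => η z j) (hη2 : ∀ j, MemLp (fun ω => η (ζ 0 ω) j) 2 P)
    (hη0 : ∀ j, ∫ ω, η (ζ 0 ω) j ∂P = 0)
    {est : ℕ → Ω → EuclideanSpace ℝ (Fin q)} (hestm : ∀ N, 1 ≤ N → AEMeasurable (est N) P)
    (hest : ∀ᵐ ω ∂P, ∀ N, 1 ≤ N → est N ω ∈ C ∧
      IsMinOn (fun t => empMean ζ (F t) N ω) C (est N ω)) {t : ℝ}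
    (ht : t = 1 / 2 * ∑ j, ∑ k, Q (EuclideanSpace.single j 1) (EuclideanSpace.single k 1) *
      ∫ ω, η (ζ 0 ω) j * η (ζ 0 ω) k ∂P) :
    (∀ ε > 0, ∀ᶠ N : ℕ in atTop, t - ε ≤
      ∫ ω, N * (∫ ω', F (est N ω) (ζ 0 ω') ∂P - ∫ ω', F x (ζ 0 ω') ∂P) ∂P) ∧
    (UnifIntegrable (fun (N : ℕ) ω =>
        N * (∫ ω', F (est N ω) (ζ 0 ω') ∂P - ∫ ω', F x (ζ 0 ω') ∂P)) 1 P →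
      Tendsto (fun N : ℕ =>
        ∫ ω, N * (∫ ω', F (est N ω) (ζ 0 ω') ∂P - ∫ ω', F x (ζ 0 ω') ∂P) ∂P) atTop (𝓝 t)) := by
  set V : EuclideanSpace ℝ (Fin q) → ℝ := fun y => ∫ ω', F y (ζ 0 ω') ∂P with hVdef
  have hV := (h.uniform_strong_law hζ hC hD₀).1
  have hestC : ∀ N, 1 ≤ N → ∀ᵐ ω ∂P, est N ω ∈ C := fun N hN => by
    filter_upwards [hest] with ω hω using (hω N hN).1
  have hVi : ∀ N, 1 ≤ N → Integrable (fun ω => V (est N ω)) P := fun N hN =>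
    integrable_comp_of_continuousOn hC hV (hestm N hN) (hestC N hN)
  have hZi : ∀ N : ℕ, 1 ≤ N → Integrable (fun ω => N * (V (est N ω) - V x)) P := fun N hN =>
    ((hVi N hN).sub (integrable_const _)).const_mul _
  have hprodi : ∀ N j k, Integrable (fun ω => normSum ζ (fun z => η z j) N ω *
      normSum ζ (fun z => η z k) N ω) P := fun N j k =>
    (hζ.memLp_normSum (hηm j) (hη2 j) N).integrable_mul (hζ.memLp_normSum (hηm k) (hη2 k) N)
  have hsqi : ∀ N j, Integrable (fun ω => normSum ζ (fun z => η z j) N ω ^ 2) P := fun N j =>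
    (hζ.memLp_normSum (hηm j) (hη2 j) N).integrable_sq
  -- `T` is the leading term, with mean exactly `t` for each N ≥ 1, and `W` is the scale of the
  -- error; both are finite sums of products of normalised sums.
  set T : ℕ → Ω → ℝ := fun N ω => 1 / 2 * (N * Q (empMean ζ η N ω) (empMean ζ η N ω)) with hT
  set W : ℕ → Ω → ℝ := fun N ω => N * ‖empMean ζ η N ω‖ ^ 2 with hW
  have hTi : ∀ N, 1 ≤ N → Integrable (T N) P := by
    intro N hN
    simp only [hT, mul_bilin_empMean Q η hN]
    exact (integrable_finsetSum _ fun j _ => integrable_finsetSum _ fun k _ =>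
      (hprodi N j k).const_mul _).const_mul _
  have hWi : ∀ N, 1 ≤ N → Integrable (W N) P := by
    intro N hN
    simp only [hW, mul_norm_empMean_sq η hN]
    exact integrable_finsetSum _ fun j _ => hsqi N j
  have hTt : ∀ N, 1 ≤ N → ∫ ω, T N ω ∂P = t := by
    intro N hN
    simp only [hT, mul_bilin_empMean Q η hN]
    rw [integral_const_mul, integral_finsetSum _ fun j _ => integrable_finsetSum _ fun k _ =>
      (hprodi N j k).const_mul _, ht]
    congr 1
    refine Finset.sum_congr rfl fun j _ => ?_
    rw [integral_finsetSum _ fun k _ => (hprodi N j k).const_mul _]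
    refine Finset.sum_congr rfl fun k _ => ?_
    rw [integral_const_mul, hζ.integral_normSum_mul (hηm j) (hηm k) (hη2 j) (hη2 k) (hη0 j) hN]
  have hWw : ∀ N, 1 ≤ N → ∫ ω, W N ω ∂P ≤ ∑ j, ∫ ω, η (ζ 0 ω) j * η (ζ 0 ω) j ∂P := by
    intro N hN
    simp only [hW, mul_norm_empMean_sq η hN]
    rw [integral_finsetSum _ fun j _ => hsqi N j]
    refine Finset.sum_le_sum fun j _ => ?_
    simp_rw [sq]
    rw [hζ.integral_normSum_mul (hηm j) (hηm j) (hη2 j) (hη2 j) (hη0 j) hN]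
  have hUI : ∀ ε > 0, ∃ δ > 0, ∀ N : ℕ, 1 ≤ N → ∀ S : Set Ω, P.real S ≤ δ →
      ∫ ω in S, W N ω ∂P ≤ ε := by
    intro ε hε
    -- The tolerance is shared among the coordinates; `q + 1` avoids a division by zero when `q =
    -- 0`.
    have hq : (0 : ℝ) < q + 1 := by positivity
    choose δ hδ0 hδ using fun j => hζ.unifIntegrable_normSum_sq (hηm j) (hη2 j) (hη0 j)
      (div_pos hε hq)
    obtain ⟨δ', hδ'0, hδ'⟩ : ∃ δ' > 0, ∀ j, δ' ≤ δ j := by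
      rcases isEmpty_or_nonempty (Fin q) with hemp | hne
      · exact ⟨1, one_pos, fun j => (hemp.false j).elim⟩
      · obtain ⟨j₀, hj₀⟩ := Finite.exists_min δ
        exact ⟨δ j₀, hδ0 j₀, hj₀⟩
    refine ⟨δ', hδ'0, fun N hN S hS => ?_⟩
    simp only [hW, mul_norm_empMean_sq η hN]
    rw [integral_finsetSum _ fun j _ => (hsqi N j).integrableOn]
    calc ∑ j, ∫ ω in S, normSum ζ (fun z => η z j) N ω ^ 2 ∂P ≤ ∑ _j : Fin q, ε / (q + 1) :=
          Finset.sum_le_sum fun j _ => hδ j N hN S (hS.trans (hδ' j))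
      _ = q * (ε / (q + 1)) := by simp
      _ ≤ (q + 1) * (ε / (q + 1)) := by gcongr; linarith
      _ = ε := by field_simp
  have happ : ∀ ε > 0, ∀ᵐ ω ∂P, ∀ᶠ N : ℕ in atTop,
      |N * (V (est N ω) - V x) - T N ω| ≤ ε * W N ω := by
    intro ε hε
    filter_upwards [h.ae_excess_risk_expansion hζ hC hD₀ hD₁ hD₂ hx hmin hc hQ hQc hη hest hε]
      with ω hω
    filter_upwards [hω] with N hN
    have : N * (V (est N ω) - V x) - T N ω = N * (V (est N ω) - V x -
        1 / 2 * Q (empMean ζ η N ω) (empMean ζ η N ω)) := by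
      simp only [hT]
      ring
    rw [this, abs_mul, Nat.abs_cast]
    calc (N : ℝ) * _ ≤ N * (ε * ‖empMean ζ η N ω‖ ^ 2) := by gcongr
      _ = ε * W N ω := by simp only [hW]; ring
  have hTW : ∀ N ω, |T N ω| ≤ ‖Q‖ * W N ω := by
    intro N ω
    simp only [hT, hW]
    rw [abs_mul, abs_mul, Nat.abs_cast, abs_of_pos (by norm_num : (0 : ℝ) < 1 / 2)]
    have h1 := abs_bilin_le (Q := Q) le_rfl (empMean ζ η N ω) (empMean ζ η N ω)
    have h2 : 0 ≤ |Q (empMean ζ η N ω) (empMean ζ η N ω)| := abs_nonneg _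
    have h3 : (0 : ℝ) ≤ N := Nat.cast_nonneg N
    nlinarith
  have hS := fun ε (hε : 0 < ε) => exists_exceptional_sets hZi hTi hWi
    (fun N ω => mul_nonneg (Nat.cast_nonneg N) (sq_nonneg _)) hTW hTt hWw hUI happ hε
  refine ⟨fun ε hε => eventually_le_integral_of_approx hZi (fun N hN => ?_) hS hε,
    fun hUIZ => tendsto_integral_of_approx hZi hS hUIZ⟩
  filter_upwards [hestC N hN] with ω hω
  refine mul_nonneg (Nat.cast_nonneg N) (sub_nonneg.2 ?_)
  rcases eq_or_ne (est N ω) x with heq | hne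
  · rw [heq]
  · exact (hmin _ hω hne).le

end IsSmoothLoss

/-! ### A lower bound of order 1/N with explicit dependence on the model. -/

/-- If a function with first order expansion `D` at `x`, up to `M ‖·‖²`, is smaller at a point of
the ball of radius `u` than on the ball of radius `2 u`, then `‖D‖ ≤ 5 M u`. -/
theorem norm_le_of_approx_argmin {E : Type*} [NormedAddCommGroup E] [NormedSpace ℝ E]
    {v : E → ℝ} {x : E} {D : E →L[ℝ] ℝ} {M u : ℝ} (hM : 0 ≤ M) (hu : 0 < u)
    (happ : ∀ h : E, ‖h‖ ≤ 2 * u → |v (x + h) - v x - D h| ≤ M * ‖h‖ ^ 2) {k : E} (hk : ‖k‖ ≤ u)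
    (hmin : ∀ h : E, ‖h‖ ≤ 2 * u → v (x + k) ≤ v (x + h)) : ‖D‖ ≤ 5 * M * u := by
  -- The competitor is the step of length `2 u` along `w`, against a minimiser at distance at most
  -- `u`. The ratio 2 of the radii leaves `‖D‖ / 2` on the right, which the left side absorbs; the
  -- quadratic errors add up to 4Mu² + Mu².
  have key : ∀ w : E, ‖w‖ = 1 → -D w ≤ ‖D‖ / 2 + 5 * M * u / 2 := by
    intro w hw
    have hn : ‖(2 * u) • w‖ = 2 * u := by
      rw [norm_smul, hw, mul_one, Real.norm_of_nonneg (by positivity)]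
    have h1 := abs_le.1 (happ ((2 * u) • w) hn.le)
    have h2 := abs_le.1 (happ k (hk.trans (by linarith)))
    have h3 := hmin ((2 * u) • w) hn.le
    have h4 : -(‖D‖ * u) ≤ D k := by
      have := (neg_abs_le (D k)).trans' (neg_le_neg ((D.le_opNorm k).trans
        (mul_le_mul_of_nonneg_left hk (norm_nonneg D))))
      exact this
    have h5 : M * ‖k‖ ^ 2 ≤ M * u ^ 2 := by gcongr
    rw [hn, map_smul, smul_eq_mul] at h1
    have h6 : u * (-D w) ≤ u * (‖D‖ / 2 + 5 * M * u / 2) := by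
      nlinarith [h1.2, h2.1]
    exact le_of_mul_le_mul_left h6 hu
  have : ‖D‖ ≤ ‖D‖ / 2 + 5 * M * u / 2 := by
    refine ContinuousLinearMap.opNorm_le_of_unit_norm (by positivity) fun w hw => ?_
    rw [Real.norm_eq_abs, abs_le]
    have h1 := key w hw
    have h2 := key (-w) (by rwa [norm_neg])
    rw [map_neg, neg_neg] at h2
    constructor <;> linarith
  linarith

/-- A lower bound of order `1 / N` for the expected excess risk, which depends on the model only
through a few constants. -/
theorem exists_excess_risk_lower_bound {r a m s p : ℝ} (hr : 0 < r) (ha : 0 < a) (hm : 0 ≤ m)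
    (hs : 0 < s) (hp : 0 < p) :
    ∃ δ > 0, ∀ {q : ℕ} {Z Ω : Type*} [MeasurableSpace Z] [MeasurableSpace Ω]
      {F : EuclideanSpace ℝ (Fin q) → Z → ℝ} {C : Set (EuclideanSpace ℝ (Fin q))}
      {D₀ D₁ D₂ : Z → ℝ} {P : Measure Ω} [IsProbabilityMeasure P] {ζ : ℕ → Ω → Z}
      {x : EuclideanSpace ℝ (Fin q)} {est : Ω → EuclideanSpace ℝ (Fin q)} {N : ℕ} {j : Fin q}
      {V : EuclideanSpace ℝ (Fin q) → ℝ},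
      IsSmoothLoss F C D₀ D₁ D₂ → IsIIDSeq ζ P → Measurable D₂ →
      Integrable (fun ω => D₂ (ζ 0 ω)) P → ∫ ω, D₂ (ζ 0 ω) ∂P ≤ m →
      Metric.closedBall x r ⊆ interior C → 1 ≤ N →
      p ≤ P.real {ω | s <
        |normSum ζ (fun z => fderiv ℝ (fun t => F t z) x (EuclideanSpace.single j 1)) N ω|} →
      (∀ y ∈ C, a * ‖y - x‖ ^ 2 ≤ V y - V x) →
      Integrable (fun ω => V (est ω)) P →
      (∀ᵐ ω ∂P, est ω ∈ C ∧ IsMinOn (fun t => empMean ζ (F t) N ω) C (est ω)) →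
      δ / N ≤ ∫ ω, (V (est ω) - V x) ∂P := by
  -- With `u = κ / √N`, the bound `r / 2` keeps the ball of radius `2 u` in the interior. The other
  -- bound makes Markov's inequality give probability at most `p / 2` to `M ≥ s / (5 κ)`, half of
  -- what the score provides.
  set κ := min (r / 2) (p * s / (10 * (m + 1))) with hκ
  have hκ0 : 0 < κ := by positivity
  refine ⟨a * κ ^ 2 * (p / 2), by positivity, ?_⟩
  intro q Z Ω _ _ F C D₀ D₁ D₂ P _ ζ x est N j V h hζ hD₂m hD₂ hD₂le hball hN hP hgrow hVi hest
  have hN' : (0 : ℝ) < N := by exact_mod_cast hN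
  have hsN : 0 < √(N : ℝ) := Real.sqrt_pos.2 hN'
  have hsN1 : 1 ≤ √(N : ℝ) := Real.one_le_sqrt.2 (by exact_mod_cast hN)
  have hx : x ∈ interior C := hball (Metric.mem_closedBall_self hr.le)
  set u := κ / √(N : ℝ) with hu
  have hu0 : 0 < u := by positivity
  have hur : 2 * u ≤ r := by
    have h1 : u ≤ κ := div_le_self hκ0.le hsN1
    have h2 : κ ≤ r / 2 := min_le_left _ _
    linarith
  have hD₂0 : ∀ z, 0 ≤ D₂ z := fun z =>
    (norm_nonneg (fderiv ℝ (fderiv ℝ (fun s => F s z)) x)).trans (h.bound₂ z x hx)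
  set M : Ω → ℝ := fun ω => empMean ζ D₂ N ω with hMdef
  have hM0 : ∀ ω, 0 ≤ M ω := fun ω =>
    mul_nonneg (inv_nonneg.2 hN'.le) (Finset.sum_nonneg fun i _ => hD₂0 _)
  have hD₂i : ∀ i, Integrable (fun ω => D₂ (ζ i ω)) P := fun i =>
    memLp_one_iff_integrable.1 (hζ.memLp hD₂m (memLp_one_iff_integrable.2 hD₂) i)
  have hMi : Integrable M P :=
    (integrable_finsetSum (Finset.range N) fun i _ => hD₂i i).const_mul (N : ℝ)⁻¹
  have hMint : ∫ ω, M ω ∂P ≤ m := by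
    simp only [hMdef, empMean]
    rw [integral_smul, integral_finsetSum _ fun i _ => hD₂i i,
      Finset.sum_congr rfl fun i _ => hζ.integral_eq hD₂m i]
    simpa [hN'.ne'] using hD₂le
  -- the first order expansion of the empirical risk
  have happ : ∀ ω, ∀ k : EuclideanSpace ℝ (Fin q), ‖k‖ ≤ 2 * u →
      |empMean ζ (F (x + k)) N ω - empMean ζ (F x) N ω -
        empMean ζ (fun z => fderiv ℝ (fun t => F t z) x) N ω k| ≤ M ω * ‖k‖ ^ 2 := by
    intro ω k hk
    have : empMean ζ (F (x + k)) N ω - empMean ζ (F x) N ω -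
        empMean ζ (fun z => fderiv ℝ (fun t => F t z) x) N ω k = (N : ℝ)⁻¹ *
        ∑ i ∈ Finset.range N, (F (x + k) (ζ i ω) - F x (ζ i ω) -
          fderiv ℝ (fun t => F t (ζ i ω)) x k) := by
      simp only [empMean, smul_apply, sum_apply, smul_eq_mul, Finset.sum_sub_distrib]
      ring
    rw [this, abs_mul, abs_of_pos (inv_pos.2 hN')]
    simp only [hMdef, empMean, smul_eq_mul, mul_assoc]
    gcongr
    rw [Finset.sum_mul]
    refine (Finset.abs_sum_le_sum_abs _ _).trans (Finset.sum_le_sum fun i _ => ?_)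
    exact abs_sub_fderiv_le_of_norm_fderiv_fderiv_le isOpen_interior (h.contDiffOn _) hball
      (h.bound₂ _) (hk.trans hur)
  set L := s / (5 * κ) with hL
  have hL0 : 0 < L := by positivity
  set S := {ω | s <
    |normSum ζ (fun z => fderiv ℝ (fun t => F t z) x (EuclideanSpace.single j 1)) N ω|} with hS
  have hMarkov : P.real {ω | L ≤ M ω} ≤ p / 2 := by
    have h1 := mul_meas_ge_le_integral_of_nonneg (ae_of_all P hM0) hMi L
    have h2 : L * P.real {ω | L ≤ M ω} ≤ m := h1.trans hMint
    have h3 : κ ≤ p * s / (10 * (m + 1)) := min_le_right _ _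
    rw [le_div_iff₀ (by positivity)] at h3
    have h4 : m ≤ L * (p / 2) := by
      rw [hL, div_mul_eq_mul_div, le_div_iff₀ (by positivity)]
      nlinarith
    exact le_of_mul_le_mul_left (h2.trans h4) hL0
  -- A minimiser within `u` of `x` would force the empirical gradient below `5 M u`, hence the
  -- normalised score below `5 L κ = s`, against the definition of `S`. Quadratic growth turns the
  -- distance `u` into risk.
  have hfar : ∀ᵐ ω ∂P, ω ∈ S \ {ω | L ≤ M ω} →
      ω ∈ {ω | a * κ ^ 2 / N ≤ V (est ω) - V x} := by
    filter_upwards [hest] with ω hω hmem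
    obtain ⟨hωS, hωM⟩ := hmem
    have hωM' : M ω < L := not_le.1 hωM
    have hfar : u < ‖est ω - x‖ := by
      by_contra hcon
      have hle := norm_le_of_approx_argmin (v := fun t => empMean ζ (F t) N ω) (x := x)
        (hM0 ω) hu0 (happ ω) (not_lt.1 hcon) (fun k hk => by
          have hk' : x + k ∈ C := interior_subset (hball (by simpa using hk.trans hur))
          have := hω.2 hk'
          simpa using this)
      have hns : normSum ζ (fun z => fderiv ℝ (fun t => F t z) x (EuclideanSpace.single j 1)) N ω =
          √(N : ℝ) * empMean ζ (fun z => fderiv ℝ (fun t => F t z) x) N ω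
            (EuclideanSpace.single j 1) := by
        have hinv : (N : ℝ)⁻¹ = (√(N : ℝ))⁻¹ * (√(N : ℝ))⁻¹ := by
          rw [← mul_inv, Real.mul_self_sqrt hN'.le]
        simp only [normSum, empMean, smul_apply, sum_apply, smul_eq_mul, hinv]
        field_simp
      have hωS' : s < |normSum ζ (fun z => fderiv ℝ (fun t => F t z) x
        (EuclideanSpace.single j 1)) N ω| := hωS
      rw [hns, abs_mul, abs_of_pos hsN] at hωS'
      have h1 : |empMean ζ (fun z => fderiv ℝ (fun t => F t z) x) N ω
          (EuclideanSpace.single j 1)| ≤ 5 * M ω * u := by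
        refine ((empMean ζ (fun z => fderiv ℝ (fun t => F t z) x) N ω).le_opNorm
          (EuclideanSpace.single j (1 : ℝ))).trans ?_
        simpa using hle
      have h2 : √(N : ℝ) * (5 * M ω * u) ≤ s := by
        calc √(N : ℝ) * (5 * M ω * u) = 5 * M ω * κ := by
              rw [hu]
              field_simp
          _ ≤ 5 * L * κ := by gcongr
          _ = s := by rw [hL]; field_simp
      have h3 := mul_le_mul_of_nonneg_left h1 hsN.le
      linarith
    have hu2 : u ^ 2 = κ ^ 2 / N := by
      rw [hu, div_pow, Real.sq_sqrt hN'.le]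
    calc a * κ ^ 2 / N = a * u ^ 2 := by rw [hu2]; ring
      _ ≤ a * ‖est ω - x‖ ^ 2 := by gcongr
      _ ≤ V (est ω) - V x := hgrow _ hω.1
  have hprob : p / 2 ≤ P.real {ω | a * κ ^ 2 / N ≤ V (est ω) - V x} := by
    have h1 : P.real (S \ {ω | L ≤ M ω}) ≤ P.real {ω | a * κ ^ 2 / N ≤ V (est ω) - V x} :=
      ENNReal.toReal_mono (measure_ne_top _ _) (measure_mono_ae hfar)
    have h2 : P.real S ≤ P.real (S \ {ω | L ≤ M ω}) + P.real {ω | L ≤ M ω} :=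
      (measureReal_mono (by
        intro ω hω
        by_cases hL' : L ≤ M ω
        · exact Or.inr hL'
        · exact Or.inl ⟨hω, hL'⟩)).trans (measureReal_union_le _ _)
    linarith
  have hnn : 0 ≤ᵐ[P] fun ω => V (est ω) - V x := by
    filter_upwards [hest] with ω hω
    exact le_trans (by positivity) (hgrow _ hω.1)
  have hfin := mul_meas_ge_le_integral_of_nonneg hnn (hVi.sub (integrable_const _))
    (a * κ ^ 2 / N)
  calc a * κ ^ 2 * (p / 2) / N = a * κ ^ 2 / N * (p / 2) := by ring
    _ ≤ a * κ ^ 2 / N * P.real {ω | a * κ ^ 2 / N ≤ V (est ω) - V x} := by gcongr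
    _ ≤ _ := hfin

/-! ### Conditional structure of the nested sample. -/

/-- The regression function `x ↦ E[f(Y) | X = x]`. -/
def regMean {Ω : Type*} [MeasurableSpace Ω] {d p : ℕ} (P : Measure Ω) [IsFiniteMeasure P]
    (X : Ω → EuclideanSpace ℝ (Fin d)) (Y : Ω → EuclideanSpace ℝ (Fin p))
    (f : EuclideanSpace ℝ (Fin p) → ℝ) (x : EuclideanSpace ℝ (Fin d)) : ℝ :=
  ∫ y, f y ∂condDistrib Y X P x

/-- If `f` is not integrable its integral is 0 by convention and the identity still holds. Thus
conditional laws need no integrability check at individual points. -/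
theorem integral_sub_integral_eq_zero {α : Type*} [MeasurableSpace α] {ν : Measure α}
    [IsProbabilityMeasure ν] (f : α → ℝ) : ∫ y, (f y - ∫ z, f z ∂ν) ∂ν = 0 := by
  by_cases hf : Integrable f ν
  · rw [integral_sub hf (integrable_const _)]
    simp
  · simp [integral_undef hf]

section Model

variable {Ω : Type*} [MeasurableSpace Ω] {d p : ℕ} {P : Measure Ω} [IsProbabilityMeasure P]
  {X : Ω → EuclideanSpace ℝ (Fin d)} {Y : Ω → EuclideanSpace ℝ (Fin p)}
  {f : EuclideanSpace ℝ (Fin p) → ℝ}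

theorem measurable_regMean (hf : Measurable f) : Measurable (regMean P X Y f) :=
  (StronglyMeasurable.integral_condDistrib (X := X) (Y := Y) (μ := P)
    (f := fun z : EuclideanSpace ℝ (Fin d) × EuclideanSpace ℝ (Fin p) => f z.2)
    (hf.comp measurable_snd).stronglyMeasurable).measurable

theorem condMean_ae_eq (hX : Measurable X) (hY : Measurable Y) (hf : Measurable f)
    (hf2 : MemLp (fun ω => f (Y ω)) 2 P) :
    condMean P X Y f =ᵐ[P] fun ω => regMean P X Y f (X ω) :=
  condExp_ae_eq_integral_condDistrib hX hY.aemeasurable hf.stronglyMeasurable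
    (hf2.integrable (by norm_num))

theorem memLp_regMean (hX : Measurable X) (hY : Measurable Y) (hf : Measurable f)
    (hf2 : MemLp (fun ω => f (Y ω)) 2 P) : MemLp (fun ω => regMean P X Y f (X ω)) 2 P :=
  (memLp_congr_ae (condMean_ae_eq hX hY hf hf2)).1 (hf2.condExp (m := MeasurableSpace.comap X inferInstance) (by norm_num))

/-- The innovation `f(Y) - E[f(Y) | X]` is orthogonal to every function of `X`. -/
theorem integral_mul_sub_regMean (hX : Measurable X) (hY : Measurable Y) (hf : Measurable f)
    {g : EuclideanSpace ℝ (Fin d) → ℝ} (hg : Measurable g)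
    (hint : Integrable (fun ω => g (X ω) * (f (Y ω) - regMean P X Y f (X ω))) P) :
    ∫ ω, g (X ω) * (f (Y ω) - regMean P X Y f (X ω)) ∂P = 0 := by
  have hm := measurable_regMean (P := P) (X := X) (Y := Y) hf
  set Ψ : EuclideanSpace ℝ (Fin d) × EuclideanSpace ℝ (Fin p) → ℝ :=
    fun z => g z.1 * (f z.2 - regMean P X Y f z.1) with hΨ
  have hΨm : Measurable Ψ := (hg.comp measurable_fst).mul
    ((hf.comp measurable_snd).sub (hm.comp measurable_fst))
  have hXY : Measurable fun ω => (X ω, Y ω) := hX.prodMk hY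
  have h1 : ∫ ω, g (X ω) * (f (Y ω) - regMean P X Y f (X ω)) ∂P =
      ∫ z, Ψ z ∂(P.map fun ω => (X ω, Y ω)) :=
    (integral_map hXY.aemeasurable hΨm.aestronglyMeasurable).symm
  have h2 : Integrable Ψ (P.map fun ω => (X ω, Y ω)) :=
    (integrable_map_measure hΨm.aestronglyMeasurable hXY.aemeasurable).2 hint
  rw [h1]
  rw [← compProd_map_condDistrib hY.aemeasurable] at h2 ⊢
  rw [Measure.integral_compProd h2]
  simp only [hΨ, integral_const_mul, regMean, integral_sub_integral_eq_zero, mul_zero,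
    integral_zero]

namespace IsNestedSample

variable {Xs : ℕ → Ω → EuclideanSpace ℝ (Fin d)} {Ys : ℕ → ℕ → Ω → EuclideanSpace ℝ (Fin p)}

/-- Taking the whole space at all indices but `k` in `law` marginalises the other draws. -/
theorem measure_pair (h : IsNestedSample P X Y Xs Ys) (i k : ℕ)
    {S : Set (EuclideanSpace ℝ (Fin d))} {T : Set (EuclideanSpace ℝ (Fin p))}
    (hS : MeasurableSet S) (hT : MeasurableSet T) :
    P {ω | Xs i ω ∈ S ∧ Ys i k ω ∈ T} = ∫⁻ x in S, condDistrib Y X P x T ∂(P.map X) := by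
  have := h.law i (k + 1) S (fun n => if n = k then T else Set.univ) hS fun n => by
    split_ifs
    exacts [hT, MeasurableSet.univ]
  rw [show {ω | Xs i ω ∈ S ∧ Ys i k ω ∈ T} = {ω | Xs i ω ∈ S ∧ ∀ n < k + 1,
      Ys i n ω ∈ (if n = k then T else Set.univ)} by
    ext ω
    simp only [Set.mem_ofPred_eq]
    refine and_congr_right fun _ => ⟨fun hk n _ => ?_, fun H => by simpa using H k (by omega)⟩
    split_ifs with hn
    exacts [hn ▸ hk, Set.mem_univ _]]
  rw [this]
  refine lintegral_congr fun x => ?_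
  rw [Finset.prod_eq_single_of_mem k (by simp)]
  · simp
  · intro n _ hn
    simp [hn]

theorem measure_triple (h : IsNestedSample P X Y Xs Ys) (i : ℕ) {k l : ℕ} (hkl : k ≠ l)
    {S : Set (EuclideanSpace ℝ (Fin d))} {T U : Set (EuclideanSpace ℝ (Fin p))}
    (hS : MeasurableSet S) (hT : MeasurableSet T) (hU : MeasurableSet U) :
    P {ω | Xs i ω ∈ S ∧ Ys i k ω ∈ T ∧ Ys i l ω ∈ U} =
      ∫⁻ x in S, condDistrib Y X P x T * condDistrib Y X P x U ∂(P.map X) := by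
  have := h.law i (k + l + 1) S
    (fun n => if n = k then T else if n = l then U else Set.univ) hS fun n => by
    split_ifs
    exacts [hT, hU, MeasurableSet.univ]
  rw [show {ω | Xs i ω ∈ S ∧ Ys i k ω ∈ T ∧ Ys i l ω ∈ U} = {ω | Xs i ω ∈ S ∧ ∀ n < k + l + 1,
      Ys i n ω ∈ (if n = k then T else if n = l then U else Set.univ)} by
    ext ω
    simp only [Set.mem_ofPred_eq]
    refine and_congr_right fun _ => ⟨fun hk n _ => ?_, fun H => ⟨by simpa using H k (by omega),
      by simpa [hkl.symm] using H l (by omega)⟩⟩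
    split_ifs with hn hn'
    exacts [hn ▸ hk.1, hn' ▸ hk.2, Set.mem_univ _]]
  rw [this]
  refine lintegral_congr fun x => ?_
  rw [Finset.prod_eq_mul k l hkl]
  · simp [hkl.symm]
  · intro n _ hn
    simp [hn.1, hn.2]
  · intro hk
    exact absurd (Finset.mem_range.2 (by omega)) hk
  · intro hl
    exact absurd (Finset.mem_range.2 (by omega)) hl

theorem identDistrib_pair (h : IsNestedSample P X Y Xs Ys) (hX : Measurable X)
    (hY : Measurable Y) (i k : ℕ) :
    IdentDistrib (fun ω => (Xs i ω, Ys i k ω)) (fun ω => (X ω, Y ω)) P P := by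
  have hm : Measurable fun ω => (Xs i ω, Ys i k ω) :=
    (h.measurable_fst i).prodMk (h.measurable_snd i k)
  refine ⟨hm.aemeasurable, (hX.prodMk hY).aemeasurable, ?_⟩
  rw [← compProd_map_condDistrib hY.aemeasurable]
  have : IsFiniteMeasure (P.map fun ω => (Xs i ω, Ys i k ω)) := inferInstance
  refine Measure.ext_prod fun {S T} hS hT => ?_
  rw [Measure.map_apply hm (hS.prod hT), Measure.compProd_apply_prod hS hT,
    ← h.measure_pair i k hS hT]
  rfl

theorem identDistrib_fst (h : IsNestedSample P X Y Xs Ys) (hX : Measurable X)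
    (hY : Measurable Y) (i : ℕ) : IdentDistrib (Xs i) X P P :=
  (h.identDistrib_pair hX hY i 0).comp _root_.measurable_fst

/-- The factorisation on boxes is the conditional independence of two draws given X_i, expressed by
the product kernel; boxes determine a finite measure on the triple product. -/
theorem map_triple (h : IsNestedSample P X Y Xs Ys) (i : ℕ) {k l : ℕ} (hkl : k ≠ l) :
    P.map (fun ω => (Xs i ω, Ys i k ω, Ys i l ω)) =
      (P.map X) ⊗ₘ (condDistrib Y X P ×ₖ condDistrib Y X P) := by
  have hm : Measurable fun ω => (Xs i ω, Ys i k ω, Ys i l ω) :=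
    (h.measurable_fst i).prodMk ((h.measurable_snd i k).prodMk (h.measurable_snd i l))
  refine Measure.ext_prod₃ fun {S T U} hS hT hU => ?_
  rw [Measure.map_apply hm (hS.prod (hT.prod hU)),
    Measure.compProd_apply_prod hS (hT.prod hU)]
  simp_rw [Kernel.prod_apply, Measure.prod_prod]
  rw [← h.measure_triple i hkl hS hT hU]
  rfl

/-- Two innovations of the same block are conditionally uncorrelated. -/
theorem integral_innovation_mul_innovation (h : IsNestedSample P X Y Xs Ys)
    (hf : Measurable f) (i : ℕ) {k l : ℕ} (hkl : k ≠ l)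
    {s t : EuclideanSpace ℝ (Fin d) → ℝ} (hs : Measurable s) (ht : Measurable t)
    (hint : Integrable (fun ω => (s (Xs i ω) * (f (Ys i k ω) - regMean P X Y f (Xs i ω))) *
      (t (Xs i ω) * (f (Ys i l ω) - regMean P X Y f (Xs i ω)))) P) :
    ∫ ω, (s (Xs i ω) * (f (Ys i k ω) - regMean P X Y f (Xs i ω))) *
      (t (Xs i ω) * (f (Ys i l ω) - regMean P X Y f (Xs i ω))) ∂P = 0 := by
  have hm := measurable_regMean (P := P) (X := X) (Y := Y) hf
  set Ψ : EuclideanSpace ℝ (Fin d) × EuclideanSpace ℝ (Fin p) × EuclideanSpace ℝ (Fin p) → ℝ :=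
    fun z => (s z.1 * (f z.2.1 - regMean P X Y f z.1)) *
      (t z.1 * (f z.2.2 - regMean P X Y f z.1)) with hΨ
  have hΨm : Measurable Ψ := by fun_prop
  have hv : Measurable fun ω => (Xs i ω, Ys i k ω, Ys i l ω) :=
    (h.measurable_fst i).prodMk ((h.measurable_snd i k).prodMk (h.measurable_snd i l))
  have h1 : ∫ ω, (s (Xs i ω) * (f (Ys i k ω) - regMean P X Y f (Xs i ω))) *
      (t (Xs i ω) * (f (Ys i l ω) - regMean P X Y f (Xs i ω))) ∂P =
      ∫ z, Ψ z ∂(P.map fun ω => (Xs i ω, Ys i k ω, Ys i l ω)) :=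
    (integral_map hv.aemeasurable hΨm.aestronglyMeasurable).symm
  have h2 : Integrable Ψ (P.map fun ω => (Xs i ω, Ys i k ω, Ys i l ω)) :=
    (integrable_map_measure hΨm.aestronglyMeasurable hv.aemeasurable).2 hint
  rw [h1]
  rw [h.map_triple i hkl] at h2 ⊢
  rw [Measure.integral_compProd h2]
  refine integral_eq_zero_of_ae (ae_of_all _ fun x => ?_)
  simp only [hΨ, Kernel.prod_apply, Pi.zero_apply]
  rw [integral_prod_mul (fun y => s x * (f y - regMean P X Y f x))
    (fun y => t x * (f y - regMean P X Y f x))]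
  simp only [integral_const_mul, regMean, integral_sub_integral_eq_zero, mul_zero]

theorem measurable_innerMean (h : IsNestedSample P X Y Xs Ys) (hf : Measurable f) (K i : ℕ) :
    Measurable (innerMean f Ys K i) :=
  (Finset.measurable_sum _ fun k _ => hf.comp (h.measurable_snd i k)).const_mul _

theorem memLp_innerMean (h : IsNestedSample P X Y Xs Ys) (hX : Measurable X)
    (hY : Measurable Y) (hf : Measurable f) (hf2 : MemLp (fun ω => f (Y ω)) 2 P) (K i : ℕ) :
    MemLp (innerMean f Ys K i) 2 P :=
  (memLp_finsetSum _ fun k _ => ((h.identDistrib_pair hX hY i k).comp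
    (hf.comp _root_.measurable_snd)).memLp_iff.2 hf2).const_mul _

/-- By Cauchy–Schwarz the square of an average is at most the average of the squares. The bound is
free of `K`, as needed for a risk bound uniform in the inner sample size. -/
theorem integral_innerMean_sq_le (h : IsNestedSample P X Y Xs Ys) (hX : Measurable X)
    (hY : Measurable Y) (hf : Measurable f) (hf2 : MemLp (fun ω => f (Y ω)) 2 P) (K i : ℕ) :
    ∫ ω, innerMean f Ys K i ω ^ 2 ∂P ≤ ∫ ω, f (Y ω) ^ 2 ∂P := by
  rcases Nat.eq_zero_or_pos K with rfl | hK
  · simp only [innerMean, Finset.range_zero, Finset.sum_empty, mul_zero]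
    simp
    positivity
  have hK' : (0 : ℝ) < K := by exact_mod_cast hK
  have hmem : ∀ k, MemLp (fun ω => f (Ys i k ω)) 2 P := fun k =>
    ((h.identDistrib_pair hX hY i k).comp (hf.comp _root_.measurable_snd)).memLp_iff.2 hf2
  have heq : ∀ k, ∫ ω, f (Ys i k ω) ^ 2 ∂P = ∫ ω, f (Y ω) ^ 2 ∂P := fun k =>
    ((h.identDistrib_pair hX hY i k).comp ((hf.comp _root_.measurable_snd).pow_const 2)).integral_eq
  calc ∫ ω, innerMean f Ys K i ω ^ 2 ∂P
      ≤ ∫ ω, (1 / (K : ℝ)) * ∑ k ∈ Finset.range K, f (Ys i k ω) ^ 2 ∂P := by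
        refine integral_mono (h.memLp_innerMean hX hY hf hf2 K i).integrable_sq
          ((integrable_finsetSum _ fun k _ => (hmem k).integrable_sq).const_mul _) fun ω => ?_
        have := sq_sum_le_card_mul_sum_sq (s := Finset.range K) (f := fun k => f (Ys i k ω))
        rw [Finset.card_range] at this
        simp only [innerMean, mul_pow]
        calc (1 / (K : ℝ)) ^ 2 * (∑ k ∈ Finset.range K, f (Ys i k ω)) ^ 2
            ≤ (1 / (K : ℝ)) ^ 2 * (K * ∑ k ∈ Finset.range K, f (Ys i k ω) ^ 2) := by gcongr
          _ = _ := by field_simp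
    _ = ∫ ω, f (Y ω) ^ 2 ∂P := by
        rw [integral_const_mul, integral_finsetSum _ fun k _ => (hmem k).integrable_sq,
          Finset.sum_congr rfl fun k _ => heq k]
        simp only [Finset.sum_const, Finset.card_range, nsmul_eq_mul]
        field_simp

/-- This replaces the nested scheme by one iid sequence, to which M-estimation applies. Independence
is inherited from the blocks; equality of the laws is not part of `IsNestedSample` and is recovered
from the values on boxes, which form a generating π-system. -/
theorem isIIDSeq (h : IsNestedSample P X Y Xs Ys) (hf : Measurable f) (K : ℕ) :
    IsIIDSeq (fun i ω => (Xs i ω, innerMean f Ys K i ω)) P := by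
  have hm : ∀ i, Measurable fun ω => (Xs i ω, innerMean f Ys K i ω) := fun i =>
    (h.measurable_fst i).prodMk (h.measurable_innerMean hf K i)
  refine ⟨hm, ?_, fun i => ⟨(hm i).aemeasurable, (hm 0).aemeasurable, ?_⟩⟩
  · have hg : Measurable fun z : EuclideanSpace ℝ (Fin d) × (ℕ → EuclideanSpace ℝ (Fin p)) =>
        (z.1, (1 / (K : ℝ)) * ∑ k ∈ Finset.range K, f (z.2 k)) :=
      _root_.measurable_fst.prodMk ((Finset.measurable_sum _ fun k _ =>
        hf.comp ((measurable_pi_apply k).comp _root_.measurable_snd)).const_mul _)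
    exact h.indep.comp (fun _ => _) (fun _ => hg)
  · -- the law of the block is determined by its values on boxes
    set Yb : ℕ → Ω → (Fin K → EuclideanSpace ℝ (Fin p)) := fun i ω k => Ys i k ω with hYb
    have hYbm : ∀ i, Measurable (Yb i) := fun i =>
      measurable_pi_lambda _ fun k => h.measurable_snd i k
    have hbm : ∀ i, Measurable fun ω => (Xs i ω, Yb i ω) := fun i =>
      (h.measurable_fst i).prodMk (hYbm i)
    have hblock : P.map (fun ω => (Xs i ω, Yb i ω)) = P.map (fun ω => (Xs 0 ω, Yb 0 ω)) := by
      refine Measure.ext_prod fun {S T} hS hT => ?_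
      -- For fixed `S` the law of the block becomes a finite measure in the inner draws alone, so
      -- the π-system argument only concerns boxes in those draws.
      have hrest : ∀ i, P.map (fun ω => (Xs i ω, Yb i ω)) (S ×ˢ T) =
          (P.restrict (Xs i ⁻¹' S)).map (Yb i) T := by
        intro i
        rw [Measure.map_apply (hbm i) (hS.prod hT), Measure.map_apply (hYbm i) hT,
          Measure.restrict_apply (hYbm i hT), Set.mk_preimage_prod, Set.inter_comm]
      rw [hrest, hrest]
      congr 1
      have hbox : ∀ i, ∀ T : Fin K → Set (EuclideanSpace ℝ (Fin p)), (∀ k, MeasurableSet (T k)) →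
          (P.restrict (Xs i ⁻¹' S)).map (Yb i) (Set.univ.pi T) = ∫⁻ x in S,
            ∏ k ∈ Finset.range K, condDistrib Y X P x
              (if hk : k < K then T ⟨k, hk⟩ else Set.univ) ∂(P.map X) := by
        intro i T hT
        have hT' : MeasurableSet (Set.univ.pi T) := MeasurableSet.univ_pi hT
        rw [Measure.map_apply (hYbm i) hT', Measure.restrict_apply (hYbm i hT'),
          ← h.law i K S (fun k => if hk : k < K then T ⟨k, hk⟩ else Set.univ) hS fun k => by
            split_ifs
            exacts [hT _, MeasurableSet.univ]]
        congr 1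
        ext ω
        simp only [Set.mem_inter_iff, Set.mem_preimage, Set.mem_pi, Set.mem_univ, true_imp_iff,
          Set.mem_ofPred_eq, hYb]
        rw [and_comm]
        refine and_congr_right fun _ => ⟨fun H k hk => by simpa [hk] using H ⟨k, hk⟩,
          fun H k => by simpa using H k k.2⟩
      refine ext_of_generate_finite _ generateFrom_pi.symm isPiSystem_pi ?_ ?_
      · rintro _ ⟨T, hT, rfl⟩
        have hT' : ∀ k, MeasurableSet (T k) := fun k => hT k (Set.mem_univ k)
        rw [hbox i T hT', hbox 0 T hT']
      · have := (hbox i (fun _ => Set.univ) fun _ => MeasurableSet.univ).trans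
          (hbox 0 (fun _ => Set.univ) fun _ => MeasurableSet.univ).symm
        simpa only [Set.pi_univ] using this
    have hg : Measurable fun z : EuclideanSpace ℝ (Fin d) × (Fin K → EuclideanSpace ℝ (Fin p)) =>
        (z.1, (1 / (K : ℝ)) * ∑ k, f (z.2 k)) :=
      _root_.measurable_fst.prodMk ((Finset.measurable_sum _ fun k _ =>
        hf.comp ((measurable_pi_apply k).comp _root_.measurable_snd)).const_mul _)
    have heq : ∀ i, (fun ω => (Xs i ω, innerMean f Ys K i ω)) =
        (fun z : EuclideanSpace ℝ (Fin d) × (Fin K → EuclideanSpace ℝ (Fin p)) =>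
          (z.1, (1 / (K : ℝ)) * ∑ k, f (z.2 k))) ∘ fun ω => (Xs i ω, Yb i ω) := by
      intro i
      funext ω
      simp only [Function.comp_apply, innerMean, hYb]
      rw [Finset.sum_range]
    simp only [heq]
    rw [← Measure.map_map hg (hbm i), ← Measure.map_map hg (hbm 0), hblock]

end IsNestedSample

end Model

namespace IsNestedSample

variable {Ω : Type*} {d p : ℕ} {f : EuclideanSpace ℝ (Fin p) → ℝ}
  {Xs : ℕ → Ω → EuclideanSpace ℝ (Fin d)} {Ys : ℕ → ℕ → Ω → EuclideanSpace ℝ (Fin p)}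

/-- A pathwise identity: a function of X_i minus an average of weighted deviations. With `m` the
regression function these two parts are orthogonal, and all moments of the residual are computed
from this splitting. -/
theorem mul_sub_innerMean_eq (s π m : EuclideanSpace ℝ (Fin d) → ℝ) {K : ℕ} (hK : 1 ≤ K) (i : ℕ)
    (ω : Ω) : s (Xs i ω) * (π (Xs i ω) - innerMean f Ys K i ω) =
      s (Xs i ω) * (π (Xs i ω) - m (Xs i ω)) -
        (1 / (K : ℝ)) * ∑ k ∈ Finset.range K, s (Xs i ω) * (f (Ys i k ω) - m (Xs i ω)) := by
  have hK' : (K : ℝ) ≠ 0 := by positivity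
  rw [← Finset.mul_sum, Finset.sum_sub_distrib]
  simp only [innerMean, Finset.sum_const, Finset.card_range, nsmul_eq_mul]
  field_simp
  ring

variable [MeasurableSpace Ω] {P : Measure Ω} [IsProbabilityMeasure P]
  {X : Ω → EuclideanSpace ℝ (Fin d)} {Y : Ω → EuclideanSpace ℝ (Fin p)}

/-- First moment of the inner noise. -/
theorem integral_mul_sub_innerMean (h : IsNestedSample P X Y Xs Ys) (hX : Measurable X)
    (hY : Measurable Y) (hf : Measurable f) {K : ℕ} (hK : 1 ≤ K) (i : ℕ)
    {s π : EuclideanSpace ℝ (Fin d) → ℝ} (hs : Measurable s) (hπ : Measurable π)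
    (hsπ : Integrable (fun ω => s (X ω) * (π (X ω) - regMean P X Y f (X ω))) P)
    (hsf : Integrable (fun ω => s (X ω) * (f (Y ω) - regMean P X Y f (X ω))) P) :
    ∫ ω, s (Xs i ω) * (π (Xs i ω) - innerMean f Ys K i ω) ∂P =
      ∫ ω, s (X ω) * (π (X ω) - regMean P X Y f (X ω)) ∂P := by
  have hm := measurable_regMean (P := P) (X := X) (Y := Y) hf
  have hid := fun k => h.identDistrib_pair hX hY i k
  have hΨ₁ : Measurable fun x => s x * (π x - regMean P X Y f x) := by fun_prop
  have hΨ₂ : Measurable fun z : EuclideanSpace ℝ (Fin d) × EuclideanSpace ℝ (Fin p) =>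
    s z.1 * (f z.2 - regMean P X Y f z.1) := by fun_prop
  have h1 := (h.identDistrib_fst hX hY i).comp hΨ₁
  have h2 := fun k => (hid k).comp hΨ₂
  have i1 := h1.integrable_iff.2 hsπ
  have i2 := fun k => (h2 k).integrable_iff.2 hsf
  simp only [Function.comp_def] at i1 i2 h1 h2
  simp_rw [mul_sub_innerMean_eq (f := f) (Xs := Xs) (Ys := Ys) s π (regMean P X Y f) hK i]
  rw [integral_sub i1 ((integrable_finsetSum _ fun k _ => i2 k).const_mul _), integral_const_mul,
    integral_finsetSum _ fun k _ => i2 k, h1.integral_eq]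
  rw [Finset.sum_eq_zero fun k _ => by
    rw [(h2 k).integral_eq, integral_mul_sub_regMean hX hY hf hs hsf], mul_zero, sub_zero]

/-- Second moments of the inner noise. -/
theorem integral_mul_sub_innerMean_mul (h : IsNestedSample P X Y Xs Ys) (hX : Measurable X)
    (hY : Measurable Y) (hf : Measurable f) {K : ℕ} (hK : 1 ≤ K) (i : ℕ)
    {s t π : EuclideanSpace ℝ (Fin d) → ℝ} (hs : Measurable s) (ht : Measurable t)
    (hπ : Measurable π)
    (hsπ : MemLp (fun ω => s (X ω) * (π (X ω) - regMean P X Y f (X ω))) 2 P)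
    (htπ : MemLp (fun ω => t (X ω) * (π (X ω) - regMean P X Y f (X ω))) 2 P)
    (hsf : MemLp (fun ω => s (X ω) * (f (Y ω) - regMean P X Y f (X ω))) 2 P)
    (htf : MemLp (fun ω => t (X ω) * (f (Y ω) - regMean P X Y f (X ω))) 2 P) :
    ∫ ω, (s (Xs i ω) * (π (Xs i ω) - innerMean f Ys K i ω)) *
      (t (Xs i ω) * (π (Xs i ω) - innerMean f Ys K i ω)) ∂P =
      ∫ ω, (s (X ω) * (π (X ω) - regMean P X Y f (X ω))) *
        (t (X ω) * (π (X ω) - regMean P X Y f (X ω))) ∂P +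
      (1 / (K : ℝ)) * ∫ ω, (s (X ω) * (f (Y ω) - regMean P X Y f (X ω))) *
        (t (X ω) * (f (Y ω) - regMean P X Y f (X ω))) ∂P := by
  have hm := measurable_regMean (P := P) (X := X) (Y := Y) hf
  have hK' : (K : ℝ) ≠ 0 := by positivity
  have hid := fun k => h.identDistrib_pair hX hY i k
  have hx := h.identDistrib_fst hX hY i
  have mf : ∀ u : EuclideanSpace ℝ (Fin d) → ℝ, Measurable u →
      Measurable fun z : EuclideanSpace ℝ (Fin d) × EuclideanSpace ℝ (Fin p) =>
        u z.1 * (f z.2 - regMean P X Y f z.1) := fun u hu => by fun_prop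
  have mπ : ∀ u : EuclideanSpace ℝ (Fin d) → ℝ, Measurable u →
      Measurable fun x => u x * (π x - regMean P X Y f x) := fun u hu => by fun_prop
  set a : Ω → ℝ := fun ω => s (Xs i ω) * (π (Xs i ω) - regMean P X Y f (Xs i ω)) with ha
  set a' : Ω → ℝ := fun ω => t (Xs i ω) * (π (Xs i ω) - regMean P X Y f (Xs i ω)) with ha'
  set b : ℕ → Ω → ℝ := fun k ω => s (Xs i ω) * (f (Ys i k ω) - regMean P X Y f (Xs i ω)) with hb
  set b' : ℕ → Ω → ℝ := fun k ω => t (Xs i ω) * (f (Ys i k ω) - regMean P X Y f (Xs i ω)) with hb'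
  have la : MemLp a 2 P := (hx.comp (mπ s hs)).memLp_iff.2 hsπ
  have la' : MemLp a' 2 P := (hx.comp (mπ t ht)).memLp_iff.2 htπ
  have lb : ∀ k, MemLp (b k) 2 P := fun k => ((hid k).comp (mf s hs)).memLp_iff.2 hsf
  have lb' : ∀ k, MemLp (b' k) 2 P := fun k => ((hid k).comp (mf t ht)).memLp_iff.2 htf
  have eaa : ∫ ω, a ω * a' ω ∂P = ∫ ω, (s (X ω) * (π (X ω) - regMean P X Y f (X ω))) *
      (t (X ω) * (π (X ω) - regMean P X Y f (X ω))) ∂P :=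
    (hx.comp ((mπ s hs).mul (mπ t ht))).integral_eq
  have ebb : ∀ k, ∫ ω, b k ω * b' k ω ∂P =
      ∫ ω, (s (X ω) * (f (Y ω) - regMean P X Y f (X ω))) *
        (t (X ω) * (f (Y ω) - regMean P X Y f (X ω))) ∂P := fun k =>
    ((hid k).comp ((mf s hs).mul (mf t ht))).integral_eq
  have ebl : ∀ k l, k ≠ l → ∫ ω, b k ω * b' l ω ∂P = 0 := fun k l hkl =>
    h.integral_innovation_mul_innovation hf i hkl hs ht ((lb k).integrable_mul (lb' l))
  have key : ∀ u : EuclideanSpace ℝ (Fin d) → ℝ, Measurable u → ∀ k,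
      Integrable (fun ω => u (Xs i ω) * (f (Ys i k ω) - regMean P X Y f (Xs i ω))) P →
      ∫ ω, u (Xs i ω) * (f (Ys i k ω) - regMean P X Y f (Xs i ω)) ∂P = 0 := by
    intro u hu k hint
    have := (hid k).comp (mf u hu)
    rw [show ∫ ω, u (Xs i ω) * (f (Ys i k ω) - regMean P X Y f (Xs i ω)) ∂P = _ from
      this.integral_eq]
    exact integral_mul_sub_regMean hX hY hf hu (this.integrable_iff.1 hint)
  -- A cross term is a function of X_i times one innovation, so its mean vanishes.
  have eab : ∀ k, ∫ ω, a ω * b' k ω ∂P = 0 := by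
    intro k
    have hi : Integrable (fun ω => a ω * b' k ω) P := la.integrable_mul (lb' k)
    have heq : (fun ω => a ω * b' k ω) = fun ω => (fun x => s x * (π x - regMean P X Y f x) * t x)
        (Xs i ω) * (f (Ys i k ω) - regMean P X Y f (Xs i ω)) := by
      funext ω
      simp only [ha, hb']
      ring
    rw [heq] at hi ⊢
    exact key (fun x => s x * (π x - regMean P X Y f x) * t x) (by fun_prop) k hi
  have eba : ∀ k, ∫ ω, b k ω * a' ω ∂P = 0 := by
    intro k
    have hi : Integrable (fun ω => b k ω * a' ω) P := (lb k).integrable_mul la'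
    have heq : (fun ω => b k ω * a' ω) = fun ω => (fun x => t x * (π x - regMean P X Y f x) * s x)
        (Xs i ω) * (f (Ys i k ω) - regMean P X Y f (Xs i ω)) := by
      funext ω
      simp only [ha', hb]
      ring
    rw [heq] at hi ⊢
    exact key (fun x => t x * (π x - regMean P X Y f x) * s x) (by fun_prop) k hi
  have hexp : ∀ ω, (s (Xs i ω) * (π (Xs i ω) - innerMean f Ys K i ω)) *
      (t (Xs i ω) * (π (Xs i ω) - innerMean f Ys K i ω)) = a ω * a' ω -
      (1 / (K : ℝ)) * (∑ k ∈ Finset.range K, a ω * b' k ω) -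
      (1 / (K : ℝ)) * (∑ k ∈ Finset.range K, b k ω * a' ω) +
      (1 / (K : ℝ)) ^ 2 * (∑ k ∈ Finset.range K, ∑ l ∈ Finset.range K, b k ω * b' l ω) := by
    intro ω
    have h1 : s (Xs i ω) * (π (Xs i ω) - innerMean f Ys K i ω) =
        a ω - (1 / (K : ℝ)) * ∑ k ∈ Finset.range K, b k ω :=
      mul_sub_innerMean_eq s π (regMean P X Y f) hK i ω
    have h2 : t (Xs i ω) * (π (Xs i ω) - innerMean f Ys K i ω) =
        a' ω - (1 / (K : ℝ)) * ∑ k ∈ Finset.range K, b' k ω :=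
      mul_sub_innerMean_eq t π (regMean P X Y f) hK i ω
    have h3 : ∑ k ∈ Finset.range K, a ω * b' k ω = a ω * ∑ k ∈ Finset.range K, b' k ω :=
      (Finset.mul_sum ..).symm
    have h4 : ∑ k ∈ Finset.range K, b k ω * a' ω = (∑ k ∈ Finset.range K, b k ω) * a' ω :=
      (Finset.sum_mul ..).symm
    rw [h1, h2, h3, h4, ← Finset.sum_mul_sum]
    ring
  simp_rw [hexp]
  have iaa : Integrable (fun ω => a ω * a' ω) P := la.integrable_mul la'
  have jab : ∀ k, Integrable (fun ω => a ω * b' k ω) P := fun k => la.integrable_mul (lb' k)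
  have jba : ∀ k, Integrable (fun ω => b k ω * a' ω) P := fun k => (lb k).integrable_mul la'
  have jbb : ∀ k l, Integrable (fun ω => b k ω * b' l ω) P := fun k l =>
    (lb k).integrable_mul (lb' l)
  have iab : Integrable (fun ω => (1 / (K : ℝ)) * (∑ k ∈ Finset.range K, a ω * b' k ω)) P :=
    (integrable_finsetSum _ fun k _ => jab k).const_mul _
  have iba : Integrable (fun ω => (1 / (K : ℝ)) * (∑ k ∈ Finset.range K, b k ω * a' ω)) P :=
    (integrable_finsetSum _ fun k _ => jba k).const_mul _
  have ibb : Integrable (fun ω => (1 / (K : ℝ)) ^ 2 *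
      (∑ k ∈ Finset.range K, ∑ l ∈ Finset.range K, b k ω * b' l ω)) P :=
    (integrable_finsetSum _ fun k _ => integrable_finsetSum _ fun l _ =>
      jbb k l).const_mul _
  have i1 : Integrable (fun ω => a ω * a' ω -
      (1 / (K : ℝ)) * (∑ k ∈ Finset.range K, a ω * b' k ω)) P := iaa.sub iab
  have i2 : Integrable (fun ω => a ω * a' ω -
      (1 / (K : ℝ)) * (∑ k ∈ Finset.range K, a ω * b' k ω) -
      (1 / (K : ℝ)) * (∑ k ∈ Finset.range K, b k ω * a' ω)) P := i1.sub iba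
  rw [integral_add i2 ibb, integral_sub i1 iba,
    integral_sub iaa iab, integral_const_mul, integral_const_mul, integral_const_mul,
    integral_finsetSum _ fun k _ => jab k,
    integral_finsetSum _ fun k _ => jba k,
    integral_finsetSum _ fun k _ => integrable_finsetSum _ fun l _ =>
      jbb k l,
    Finset.sum_eq_zero fun k _ => eab k, Finset.sum_eq_zero fun k _ => eba k, eaa]
  -- Only the diagonal of the double sum survives: `K` equal terms against the factor `(1 / K) ^ 2`.
  -- This is the origin of the term B/K.
  have hrow : ∀ k ∈ Finset.range K, ∫ ω, ∑ l ∈ Finset.range K, b k ω * b' l ω ∂P =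
      ∫ ω, (s (X ω) * (f (Y ω) - regMean P X Y f (X ω))) *
        (t (X ω) * (f (Y ω) - regMean P X Y f (X ω))) ∂P := by
    intro k hk
    rw [integral_finsetSum _ fun l _ => jbb k l,
      Finset.sum_eq_single_of_mem k hk fun l _ hlk => ebl k l hlk.symm, ebb]
  rw [Finset.sum_congr rfl hrow]
  simp only [Finset.sum_const, Finset.card_range, nsmul_eq_mul]
  field_simp
  ring

end IsNestedSample

/-! ### The squared error as a smooth loss. -/

/-- The squared error of the predictor `φ t` at the observation `z = (x, y)`. -/
def sqLoss {E S : Type*} (φ : E → S → ℝ) (t : E) (z : S × ℝ) : ℝ := (φ t z.1 - z.2) ^ 2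

/-- A common envelope for the squared error and its first two derivatives. -/
def sqEnvelope {S : Type*} (D₀ D₁ D₂ : S → ℝ) (z : S × ℝ) : ℝ :=
  2 * D₀ z.1 ^ 2 + 2 * D₁ z.1 ^ 2 + 2 * D₂ z.1 ^ 2 + 2 * z.2 ^ 2

namespace IsSmoothLoss

variable {E S : Type*} [NormedAddCommGroup E] [NormedSpace ℝ E] [MeasurableSpace S]
  {φ : E → S → ℝ} {C : Set E} {D₀ D₁ D₂ : S → ℝ}

theorem fderiv_sqLoss (h : IsSmoothLoss φ C D₀ D₁ D₂) (z : S × ℝ) {t : E} (ht : t ∈ interior C) :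
    fderiv ℝ (fun s => sqLoss φ s z) t =
      (2 * (φ t z.1 - z.2)) • fderiv ℝ (fun s => φ s z.1) t := by
  have h1 := (((h.differentiableAt z.1 ht).hasFDerivAt.sub_const z.2).pow 2).fderiv
  simp only [sqLoss]
  refine h1.trans ?_
  ext v
  simp

theorem fderiv_fderiv_sqLoss (h : IsSmoothLoss φ C D₀ D₁ D₂) (z : S × ℝ) {t : E}
    (ht : t ∈ interior C) :
    fderiv ℝ (fderiv ℝ (fun s => sqLoss φ s z)) t =
      (2 * (φ t z.1 - z.2)) • fderiv ℝ (fderiv ℝ (fun s => φ s z.1)) t +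
        ((2 : ℝ) • fderiv ℝ (fun s => φ s z.1) t).smulRight (fderiv ℝ (fun s => φ s z.1) t) := by
  have heq : fderiv ℝ (fun s => sqLoss φ s z) =ᶠ[𝓝 t]
      fun s => (2 * (φ s z.1 - z.2)) • fderiv ℝ (fun s => φ s z.1) s := by
    filter_upwards [isOpen_interior.mem_nhds ht] with s hs using h.fderiv_sqLoss z hs
  rw [heq.fderiv_eq]
  exact ((((h.differentiableAt z.1 ht).hasFDerivAt.sub_const z.2).const_mul 2).smul
    (h.differentiableAt_fderiv z.1 ht).hasFDerivAt).fderiv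

/-- Each derivative of the loss is a sum of products of two square integrable factors, so 2ab ≤ a² +
b² bounds it by squares. One envelope with factors 2 serves all three orders; the factor 2 on `D₁ ^
2` is needed by the term 2‖∇φ‖² of the Hessian. -/
theorem sqLoss_isSmoothLoss (h : IsSmoothLoss φ C D₀ D₁ D₂) :
    IsSmoothLoss (sqLoss φ) C (sqEnvelope D₀ D₁ D₂) (sqEnvelope D₀ D₁ D₂)
      (sqEnvelope D₀ D₁ D₂) := by
  have hsq : ∀ z : S × ℝ, ∀ t ∈ C, (φ t z.1 - z.2) ^ 2 ≤ 2 * D₀ z.1 ^ 2 + 2 * z.2 ^ 2 := by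
    intro z t ht
    have h1 : φ t z.1 ^ 2 ≤ D₀ z.1 ^ 2 := sq_le_sq.2 ((h.bound₀ z.1 t ht).trans (le_abs_self _))
    nlinarith [sq_nonneg (φ t z.1 + z.2)]
  refine ⟨fun t => (((h.measurable t).comp measurable_fst).sub measurable_snd).pow_const 2,
    fun z => ((h.continuousOn z.1).sub continuousOn_const).pow 2,
    fun z => ((h.contDiffOn z.1).sub contDiffOn_const).pow 2, fun z t ht => ?_, fun z t ht => ?_,
    fun z t ht => ?_⟩
  · have := hsq z t ht
    rw [sqLoss, abs_of_nonneg (sq_nonneg _), sqEnvelope]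
    nlinarith [sq_nonneg (D₁ z.1), sq_nonneg (D₂ z.1)]
  · have h0 := hsq z t (interior_subset ht)
    have h1 := h.bound₁ z.1 t ht
    rw [h.fderiv_sqLoss z ht, norm_smul, norm_mul, Real.norm_eq_abs, Real.norm_eq_abs, abs_two]
    simp only [sqEnvelope]
    have h2 : ‖fderiv ℝ (fun s => φ s z.1) t‖ ^ 2 ≤ D₁ z.1 ^ 2 := by gcongr
    nlinarith [sq_nonneg (|φ t z.1 - z.2| - ‖fderiv ℝ (fun s => φ s z.1) t‖),
      sq_abs (φ t z.1 - z.2), sq_nonneg (D₁ z.1), sq_nonneg (D₂ z.1)]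
  · have h0 := hsq z t (interior_subset ht)
    have h1 := h.bound₁ z.1 t ht
    have h2 := h.bound₂ z.1 t ht
    rw [h.fderiv_fderiv_sqLoss z ht]
    refine (norm_add_le _ _).trans ?_
    rw [norm_smul, ContinuousLinearMap.norm_smulRight_apply, norm_smul, norm_mul,
      Real.norm_eq_abs, Real.norm_eq_abs, abs_two]
    simp only [sqEnvelope]
    have h3 : ‖fderiv ℝ (fun s => φ s z.1) t‖ ^ 2 ≤ D₁ z.1 ^ 2 := by gcongr
    have h4 : ‖fderiv ℝ (fderiv ℝ (fun s => φ s z.1)) t‖ ^ 2 ≤ D₂ z.1 ^ 2 := by gcongr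
    nlinarith [sq_nonneg (|φ t z.1 - z.2| - ‖fderiv ℝ (fderiv ℝ (fun s => φ s z.1)) t‖),
      sq_abs (φ t z.1 - z.2), sq_nonneg (D₁ z.1), sq_nonneg (D₂ z.1)]

end IsSmoothLoss

theorem gradient_apply_eq_fderiv {q : ℕ} (g : EuclideanSpace ℝ (Fin q) → ℝ)
    (t : EuclideanSpace ℝ (Fin q)) (i : Fin q) :
    gradient g t i = fderiv ℝ g t (EuclideanSpace.single i 1) := by
  have h1 : inner ℝ (gradient g t) (EuclideanSpace.single i (1 : ℝ)) =
      fderiv ℝ g t (EuclideanSpace.single i 1) := by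
    simp [gradient]
  rw [← h1, EuclideanSpace.inner_single_right]
  simp

theorem norm_gradient {q : ℕ} (g : EuclideanSpace ℝ (Fin q) → ℝ)
    (t : EuclideanSpace ℝ (Fin q)) : ‖gradient g t‖ = ‖fderiv ℝ g t‖ := by
  simp [gradient]

theorem enorm_gradient {q : ℕ} (g : EuclideanSpace ℝ (Fin q) → ℝ)
    (t : EuclideanSpace ℝ (Fin q)) : ‖gradient g t‖ₑ = ‖fderiv ℝ g t‖ₑ := by
  rw [← ofReal_norm, ← ofReal_norm, norm_gradient]

theorem exists_pos_mul_norm_sq_le {E : Type*} [NormedAddCommGroup E] [NormedSpace ℝ E]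
    [FiniteDimensional ℝ E] (Q : E →L[ℝ] E →L[ℝ] ℝ) (hQ : ∀ v, v ≠ 0 → 0 < Q v v) :
    ∃ c > 0, ∀ v, c * ‖v‖ ^ 2 ≤ Q v v := by
  have hcont : Continuous fun v => Q v v := Q.continuous.clm_apply continuous_id
  rcases (Metric.sphere (0 : E) 1).eq_empty_or_nonempty with he | hne
  -- The sphere is empty only when `E` is trivial, which covers `q = 0`.
  · refine ⟨1, one_pos, fun v => ?_⟩
    have : v = 0 := by
      by_contra hv
      have : (‖v‖⁻¹ • v) ∈ Metric.sphere (0 : E) 1 := by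
        simp [norm_smul, inv_mul_cancel₀ (norm_ne_zero_iff.2 hv)]
      simp [he] at this
    simp [this]
  · obtain ⟨u, hu, hmin⟩ := (isCompact_sphere (0 : E) 1).exists_isMinOn hne hcont.continuousOn
    have hu0 : u ≠ 0 := by
      rintro rfl
      simp at hu
    refine ⟨Q u u, hQ u hu0, fun v => ?_⟩
    rcases eq_or_ne v 0 with rfl | hv
    · simp
    have hv' := norm_ne_zero_iff.2 hv
    have hs : (‖v‖⁻¹ • v) ∈ Metric.sphere (0 : E) 1 := by
      simp [norm_smul, inv_mul_cancel₀ hv']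
    have h1 := hmin hs
    simp only [Set.mem_ofPred_eq, map_smul, smul_apply, smul_eq_mul] at h1
    calc Q u u * ‖v‖ ^ 2 ≤ (‖v‖⁻¹ * (‖v‖⁻¹ * Q v v)) * ‖v‖ ^ 2 := by gcongr
      _ = Q v v := by field_simp

/-- The `j`-th partial derivative at `x` of the predictors `φ(·, z)`. -/
def partialAt {q : ℕ} {S : Type*} (φ : EuclideanSpace ℝ (Fin q) → S → ℝ)
    (x : EuclideanSpace ℝ (Fin q)) (j : Fin q) (z : S) : ℝ :=
  fderiv ℝ (fun t => φ t z) x (EuclideanSpace.single j 1)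

theorem norm_gradient_sq_eq_sum_partialAt {q : ℕ} {S : Type*}
    (φ : EuclideanSpace ℝ (Fin q) → S → ℝ) (x : EuclideanSpace ℝ (Fin q)) (z : S) :
    ‖gradient (fun t => φ t z) x‖ ^ 2 = ∑ j, partialAt φ x j z ^ 2 := by
  simp [EuclideanSpace.norm_sq_eq, gradient_apply_eq_fderiv, partialAt]

/-! ### The nested regression model: population risk and moment conditions. -/

/-- The nested regression model with smooth predictors whose envelopes `D₀`, `D₁`, `D₂` are square
integrable. -/
structure IsSmoothModel {Ω : Type*} [MeasurableSpace Ω] {d p q : ℕ} (P : Measure Ω)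
    (X : Ω → EuclideanSpace ℝ (Fin d)) (Y : Ω → EuclideanSpace ℝ (Fin p))
    (f : EuclideanSpace ℝ (Fin p) → ℝ)
    (φ : EuclideanSpace ℝ (Fin q) → EuclideanSpace ℝ (Fin d) → ℝ)
    (C : Set (EuclideanSpace ℝ (Fin q))) (D₀ D₁ D₂ : EuclideanSpace ℝ (Fin d) → ℝ) : Prop where
  measurable_X : Measurable X
  measurable_Y : Measurable Y
  measurable_f : Measurable f
  memLp_f : MemLp (fun ω => f (Y ω)) 2 P
  smooth : IsSmoothLoss φ C D₀ D₁ D₂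
  measurable₀ : Measurable D₀
  measurable₁ : Measurable D₁
  measurable₂ : Measurable D₂
  memLp₀ : MemLp (fun ω => D₀ (X ω)) 2 P
  memLp₁ : MemLp (fun ω => D₁ (X ω)) 2 P
  memLp₂ : MemLp (fun ω => D₂ (X ω)) 2 P

namespace IsSmoothModel

variable {Ω : Type*} [MeasurableSpace Ω] {d p q : ℕ} {P : Measure Ω}
  {X : Ω → EuclideanSpace ℝ (Fin d)} {Y : Ω → EuclideanSpace ℝ (Fin p)}
  {f : EuclideanSpace ℝ (Fin p) → ℝ}
  {φ : EuclideanSpace ℝ (Fin q) → EuclideanSpace ℝ (Fin d) → ℝ}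
  {C : Set (EuclideanSpace ℝ (Fin q))} {D₀ D₁ D₂ : EuclideanSpace ℝ (Fin d) → ℝ}
  {x : EuclideanSpace ℝ (Fin q)}

theorem memLp_apply (h : IsSmoothModel P X Y f φ C D₀ D₁ D₂) {t : EuclideanSpace ℝ (Fin q)}
    (ht : t ∈ C) : MemLp (fun ω => φ t (X ω)) 2 P :=
  h.memLp₀.mono' ((h.smooth.measurable t).comp h.measurable_X).aestronglyMeasurable
    (ae_of_all _ fun _ => h.smooth.bound₀ _ t ht)

theorem measurable_partialAt (h : IsSmoothModel P X Y f φ C D₀ D₁ D₂) (hx : x ∈ interior C)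
    (j : Fin q) : Measurable (partialAt φ x j) :=
  ((ContinuousLinearMap.apply ℝ ℝ
    (EuclideanSpace.single j (1 : ℝ))).continuous.comp_stronglyMeasurable
    (h.smooth.stronglyMeasurable_fderiv hx)).measurable

variable [IsProbabilityMeasure P]

theorem measurable_m (h : IsSmoothModel P X Y f φ C D₀ D₁ D₂) : Measurable (regMean P X Y f) :=
  measurable_regMean h.measurable_f

theorem memLp_m (h : IsSmoothModel P X Y f φ C D₀ D₁ D₂) :
    MemLp (fun ω => regMean P X Y f (X ω)) 2 P :=
  memLp_regMean h.measurable_X h.measurable_Y h.measurable_f h.memLp_f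

theorem memLp_apply_sub (h : IsSmoothModel P X Y f φ C D₀ D₁ D₂)
    {t : EuclideanSpace ℝ (Fin q)} (ht : t ∈ C) :
    MemLp (fun ω => φ t (X ω) - regMean P X Y f (X ω)) 2 P :=
  (h.memLp_apply ht).sub h.memLp_m

theorem memLp_f_sub (h : IsSmoothModel P X Y f φ C D₀ D₁ D₂) :
    MemLp (fun ω => f (Y ω) - regMean P X Y f (X ω)) 2 P :=
  h.memLp_f.sub h.memLp_m

theorem condMean_eq (h : IsSmoothModel P X Y f φ C D₀ D₁ D₂) :
    condMean P X Y f =ᵐ[P] fun ω => regMean P X Y f (X ω) :=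
  condMean_ae_eq h.measurable_X h.measurable_Y h.measurable_f h.memLp_f

theorem vInf_eq (h : IsSmoothModel P X Y f φ C D₀ D₁ D₂) (t : EuclideanSpace ℝ (Fin q)) :
    vInf P X Y f φ t = ∫ ω, (φ t (X ω) - regMean P X Y f (X ω)) ^ 2 ∂P := by
  refine integral_congr_ae ?_
  filter_upwards [h.condMean_eq] with ω hω
  rw [hω]

theorem matA_apply (h : IsSmoothModel P X Y f φ C D₀ D₁ D₂) (i j : Fin q) :
    matA P X Y f φ x i j =
      ∫ ω, (partialAt φ x i (X ω) * (φ x (X ω) - regMean P X Y f (X ω))) *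
        (partialAt φ x j (X ω) * (φ x (X ω) - regMean P X Y f (X ω))) ∂P := by
  refine integral_congr_ae ?_
  filter_upwards [h.condMean_eq] with ω hω
  rw [hω, gradient_apply_eq_fderiv, gradient_apply_eq_fderiv, partialAt, partialAt]
  ring

theorem matB_apply (h : IsSmoothModel P X Y f φ C D₀ D₁ D₂) (i j : Fin q) :
    matB P X Y f φ x i j =
      ∫ ω, (partialAt φ x i (X ω) * (f (Y ω) - regMean P X Y f (X ω))) *
        (partialAt φ x j (X ω) * (f (Y ω) - regMean P X Y f (X ω))) ∂P := by
  refine integral_congr_ae ?_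
  filter_upwards [h.condMean_eq] with ω hω
  rw [hω, gradient_apply_eq_fderiv, gradient_apply_eq_fderiv, partialAt, partialAt]
  ring

variable {Xs : ℕ → Ω → EuclideanSpace ℝ (Fin d)} {Ys : ℕ → ℕ → Ω → EuclideanSpace ℝ (Fin p)}

/-- The second moment identity with weights 1. The inner noise only adds a constant in `t`, so
minimiser, excess risk and Hessian are those of v^∞ for every `K`. -/
theorem integral_sqLoss (h : IsSmoothModel P X Y f φ C D₀ D₁ D₂)
    (hs : IsNestedSample P X Y Xs Ys) {K : ℕ} (hK : 1 ≤ K) {t : EuclideanSpace ℝ (Fin q)}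
    (ht : t ∈ C) :
    ∫ ω, sqLoss φ t (Xs 0 ω, innerMean f Ys K 0 ω) ∂P = vInf P X Y f φ t +
      (1 / (K : ℝ)) * ∫ ω, (f (Y ω) - regMean P X Y f (X ω)) ^ 2 ∂P := by
  have h1 := h.memLp_apply_sub ht
  have h2 := h.memLp_f_sub
  have := hs.integral_mul_sub_innerMean_mul h.measurable_X h.measurable_Y h.measurable_f hK 0
    (s := fun _ => 1) (t := fun _ => 1) (π := φ t) measurable_const measurable_const
    (h.smooth.measurable t) (by simpa using h1) (by simpa using h1) (by simpa using h2)
    (by simpa using h2)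
  simp only [one_mul, ← pow_two] at this
  rw [h.vInf_eq]
  exact this

theorem memLp_comp_Xs (h : IsSmoothModel P X Y f φ C D₀ D₁ D₂) (hs : IsNestedSample P X Y Xs Ys)
    {D : EuclideanSpace ℝ (Fin d) → ℝ} (hD : Measurable D) (hD2 : MemLp (fun ω => D (X ω)) 2 P) :
    MemLp (fun ω => D (Xs 0 ω)) 2 P :=
  ((hs.identDistrib_fst h.measurable_X h.measurable_Y 0).comp hD).memLp_iff.2 hD2

/-- The explicit bound is recorded because it does not depend on `K`; it feeds the Markov step of
the uniform lower bound. -/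
theorem integrable_sqEnvelope (h : IsSmoothModel P X Y f φ C D₀ D₁ D₂)
    (hs : IsNestedSample P X Y Xs Ys) (K : ℕ) :
    Integrable (fun ω => sqEnvelope D₀ D₁ D₂ (Xs 0 ω, innerMean f Ys K 0 ω)) P ∧
    ∫ ω, sqEnvelope D₀ D₁ D₂ (Xs 0 ω, innerMean f Ys K 0 ω) ∂P ≤
      2 * ∫ ω, D₀ (X ω) ^ 2 ∂P + 2 * ∫ ω, D₁ (X ω) ^ 2 ∂P + 2 * ∫ ω, D₂ (X ω) ^ 2 ∂P +
        2 * ∫ ω, f (Y ω) ^ 2 ∂P := by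
  have i0 := ((h.memLp_comp_Xs hs h.measurable₀ h.memLp₀).integrable_sq).const_mul 2
  have i1 := ((h.memLp_comp_Xs hs h.measurable₁ h.memLp₁).integrable_sq).const_mul 2
  have i2 := ((h.memLp_comp_Xs hs h.measurable₂ h.memLp₂).integrable_sq).const_mul 2
  have i3 := ((hs.memLp_innerMean h.measurable_X h.measurable_Y h.measurable_f h.memLp_f K
    0).integrable_sq).const_mul 2
  have i01 := i0.add i1
  have i012 := i01.add i2
  refine ⟨i012.add i3, ?_⟩
  simp only [sqEnvelope]
  have hid := hs.identDistrib_fst h.measurable_X h.measurable_Y 0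
  have e : ∀ D : EuclideanSpace ℝ (Fin d) → ℝ, Measurable D →
      ∫ ω, D (Xs 0 ω) ^ 2 ∂P = ∫ ω, D (X ω) ^ 2 ∂P := fun D hD =>
    (hid.comp (hD.pow_const 2)).integral_eq
  have h4 := hs.integral_innerMean_sq_le h.measurable_X h.measurable_Y h.measurable_f h.memLp_f K 0
  simp only [Pi.add_def] at i01 i012
  rw [integral_add i012 i3, integral_add i01 i2, integral_add i0 i1, integral_const_mul,
    integral_const_mul, integral_const_mul, integral_const_mul, e _ h.measurable₀,
    e _ h.measurable₁, e _ h.measurable₂]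
  linarith

theorem integral_fderiv_fderiv_sqLoss (h : IsSmoothModel P X Y f φ C D₀ D₁ D₂)
    (hs : IsNestedSample P X Y Xs Ys) {K : ℕ} (hK : 1 ≤ K) (hx : x ∈ interior C) :
    ∫ ω, fderiv ℝ (fderiv ℝ (fun s => sqLoss φ s (Xs 0 ω, innerMean f Ys K 0 ω))) x ∂P =
      fderiv ℝ (fderiv ℝ (vInf P X Y f φ)) x := by
  have hi := (h.integrable_sqEnvelope hs K).1
  rw [← h.smooth.sqLoss_isSmoothLoss.fderiv_fderiv_integral
    ((hs.isIIDSeq h.measurable_f K).measurable 0) hi hi hi hx]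
  have heq : (fun s => ∫ ω, sqLoss φ s (Xs 0 ω, innerMean f Ys K 0 ω) ∂P) =ᶠ[𝓝 x] fun s =>
      vInf P X Y f φ s + (1 / (K : ℝ)) * ∫ ω, (f (Y ω) - regMean P X Y f (X ω)) ^ 2 ∂P := by
    filter_upwards [mem_interior_iff_mem_nhds.1 hx] with s hsC using h.integral_sqLoss hs hK hsC
  rw [heq.fderiv.fderiv_eq]
  congr 1
  funext s
  exact fderiv_add_const _

/-- Continuity is inherited from the sampled mean loss; `K = 1` is an arbitrary choice, since the
added term is constant in θ. -/
theorem continuousOn_vInf (h : IsSmoothModel P X Y f φ C D₀ D₁ D₂)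
    (hs : IsNestedSample P X Y Xs Ys) (hC : IsCompact C) :
    ContinuousOn (vInf P X Y f φ) C := by
  have h1 := (h.smooth.sqLoss_isSmoothLoss.uniform_strong_law (hs.isIIDSeq h.measurable_f 1) hC
    (h.integrable_sqEnvelope hs 1).1).1
  refine (h1.sub (continuousOn_const (c := (1 / ((1 : ℕ) : ℝ)) *
    ∫ ω, (f (Y ω) - regMean P X Y f (X ω)) ^ 2 ∂P))).congr fun t ht => ?_
  simp only [Pi.sub_apply]
  rw [h.integral_sqLoss hs le_rfl ht]
  ring

end IsSmoothModel

/-- Fatou's lemma along the truncation levels, which are eventually inactive at each point. -/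
theorem memLp_two_of_integral_truncAt_le {Ω S : Type*} [MeasurableSpace Ω] {P : Measure Ω}
    {s : S → ℝ} {ξ : Ω → S} {w : Ω → ℝ} {B : ℝ}
    (hm : ∀ n : ℕ, MemLp (fun ω => truncAt s n (ξ ω) * w ω) 2 P)
    (hle : ∀ n : ℕ, ∫ ω, (truncAt s n (ξ ω) * w ω) ^ 2 ∂P ≤ B) :
    MemLp (fun ω => s (ξ ω) * w ω) 2 P := by
  have hlim : ∀ ω, ∀ᶠ n : ℕ in atTop, truncAt s n (ξ ω) = s (ξ ω) := by
    intro ω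
    obtain ⟨n₀, hn₀⟩ := exists_nat_ge |s (ξ ω)|
    filter_upwards [eventually_ge_atTop n₀] with n hn
    have : ξ ω ∈ {z | |s z| ≤ (n : ℝ)} := hn₀.trans (by exact_mod_cast hn)
    simp [truncAt, this]
  have ht : ∀ᵐ ω ∂P, Tendsto (fun n : ℕ => truncAt s n (ξ ω) * w ω) atTop (𝓝 (s (ξ ω) * w ω)) :=
    ae_of_all _ fun ω => tendsto_const_nhds.congr' ((hlim ω).mono fun n hn => by simp only [hn])
  refine ⟨aestronglyMeasurable_of_tendsto_ae _ (fun n => (hm n).aestronglyMeasurable) ht, ?_⟩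
  refine (Lp.eLpNorm_lim_le_liminf_eLpNorm (fun n => (hm n).aestronglyMeasurable) _ ht).trans_lt
    ((liminf_le_of_frequently_le' (x := ENNReal.ofReal (B ^ (2 : ℝ)⁻¹))
      (Eventually.frequently (Eventually.of_forall fun n => ?_))).trans_lt ENNReal.ofReal_lt_top)
  rw [(hm n).eLpNorm_eq_integral_rpow_norm (by norm_num) (by norm_num)]
  refine ENNReal.ofReal_le_ofReal ?_
  simp only [ENNReal.toReal_ofNat, Real.rpow_two, Real.norm_eq_abs, sq_abs]
  exact Real.rpow_le_rpow (integral_nonneg fun _ => sq_nonneg _) (hle n) (by norm_num)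

/-- If a weighted residual of the inner mean is square integrable, then so are the two parts of
its orthogonal decomposition. -/
theorem IsNestedSample.memLp_of_memLp_mul_sub_innerMean {Ω : Type*} [MeasurableSpace Ω] {d p : ℕ}
    {P : Measure Ω} [IsProbabilityMeasure P]
    {X : Ω → EuclideanSpace ℝ (Fin d)} {Y : Ω → EuclideanSpace ℝ (Fin p)}
    {f : EuclideanSpace ℝ (Fin p) → ℝ} {Xs : ℕ → Ω → EuclideanSpace ℝ (Fin d)}
    {Ys : ℕ → ℕ → Ω → EuclideanSpace ℝ (Fin p)}
    (h : IsNestedSample P X Y Xs Ys) (hX : Measurable X) (hY : Measurable Y) (hf : Measurable f)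
    (hf2 : MemLp (fun ω => f (Y ω)) 2 P) {K : ℕ} (hK : 1 ≤ K)
    {s π : EuclideanSpace ℝ (Fin d) → ℝ} (hs : Measurable s) (hπ : Measurable π)
    (hπ2 : MemLp (fun ω => π (X ω)) 2 P)
    (hint : MemLp (fun ω => s (Xs 0 ω) * (π (Xs 0 ω) - innerMean f Ys K 0 ω)) 2 P) :
    MemLp (fun ω => s (X ω) * (π (X ω) - regMean P X Y f (X ω))) 2 P ∧
    MemLp (fun ω => s (X ω) * (f (Y ω) - regMean P X Y f (X ω))) 2 P := by
  have hm := memLp_regMean hX hY hf hf2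
  have hK' : (0 : ℝ) < K := by exact_mod_cast hK
  have hbdd : ∀ w : Ω → ℝ, MemLp w 2 P → ∀ n : ℕ,
      MemLp (fun ω => truncAt s n (X ω) * w ω) 2 P := fun w hw n => by
    refine (hw.const_mul (n : ℝ)).mono (((measurable_truncAt hs n).comp
      hX).aestronglyMeasurable.mul hw.aestronglyMeasurable) (ae_of_all _ fun ω => ?_)
    rw [norm_mul, norm_mul]
    gcongr
    exact (abs_truncAt_le s n.cast_nonneg _).trans (le_abs_self _)
  set B := ∫ ω, (s (Xs 0 ω) * (π (Xs 0 ω) - innerMean f Ys K 0 ω)) ^ 2 ∂P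
  -- Truncating the weight makes both parts square integrable in advance, so the orthogonal identity
  -- applies; since the truncated weight is at most `|s|`, the sum of the two parts is bounded by
  -- the given second moment, uniformly in `n`.
  have key : ∀ n : ℕ, ∫ ω, (truncAt s n (X ω) * (π (X ω) - regMean P X Y f (X ω))) ^ 2 ∂P +
      (1 / (K : ℝ)) * ∫ ω, (truncAt s n (X ω) * (f (Y ω) - regMean P X Y f (X ω))) ^ 2 ∂P ≤ B := by
    intro n
    have m1 := hbdd _ (hπ2.sub hm) n
    have m2 := hbdd _ (hf2.sub hm) n
    have e := h.integral_mul_sub_innerMean_mul hX hY hf hK 0 (measurable_truncAt hs n)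
      (measurable_truncAt hs n) hπ m1 m1 m2 m2
    simp only [← pow_two] at e
    rw [← e]
    refine integral_mono_of_nonneg (ae_of_all _ fun _ => sq_nonneg _) hint.integrable_sq
      (ae_of_all _ fun ω => ?_)
    simp only [mul_pow]
    gcongr ?_ * _
    refine sq_le_sq.2 ?_
    simp only [truncAt, Set.indicator_apply]
    split_ifs <;> simp
  have pos1 : ∀ n : ℕ, 0 ≤
      ∫ ω, (truncAt s n (X ω) * (π (X ω) - regMean P X Y f (X ω))) ^ 2 ∂P := fun n =>
    integral_nonneg fun _ => sq_nonneg _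
  have pos2 : ∀ n : ℕ, 0 ≤
      ∫ ω, (truncAt s n (X ω) * (f (Y ω) - regMean P X Y f (X ω))) ^ 2 ∂P := fun n =>
    integral_nonneg fun _ => sq_nonneg _
  refine ⟨memLp_two_of_integral_truncAt_le (B := B) (fun n => hbdd _ (hπ2.sub hm) n) fun n => ?_,
    memLp_two_of_integral_truncAt_le (B := K * B)
      (fun n => hbdd _ (hf2.sub hm) n) fun n => ?_⟩
  · have := mul_nonneg (one_div_nonneg.2 hK'.le) (pos2 n)
    linarith [key n]
  · have h1 := key n
    have h2 : (1 / (K : ℝ)) *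
        ∫ ω, (truncAt s n (X ω) * (f (Y ω) - regMean P X Y f (X ω))) ^ 2 ∂P ≤ B := by
      linarith [pos1 n]
    rw [one_div, inv_mul_le_iff₀ hK'] at h2
    exact h2

/-! ### Score covariance and the limit of the expected risk. -/

/-- The `j`-th partial derivative at `x` of the squared error. -/
def score {q : ℕ} {S : Type*} (φ : EuclideanSpace ℝ (Fin q) → S → ℝ)
    (x : EuclideanSpace ℝ (Fin q)) (j : Fin q) (z : S × ℝ) : ℝ :=
  2 * (partialAt φ x j z.1 * (φ x z.1 - z.2))

theorem fderiv_sqLoss_single {q : ℕ} {S : Type*} [MeasurableSpace S]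
    {φ : EuclideanSpace ℝ (Fin q) → S → ℝ} {C : Set (EuclideanSpace ℝ (Fin q))} {D₀ D₁ D₂ : S → ℝ}
    (h : IsSmoothLoss φ C D₀ D₁ D₂) {x : EuclideanSpace ℝ (Fin q)} (hx : x ∈ interior C)
    (j : Fin q) (z : S × ℝ) :
    fderiv ℝ (fun t => sqLoss φ t z) x (EuclideanSpace.single j 1) = score φ x j z := by
  rw [h.fderiv_sqLoss z hx]
  simp [score, partialAt]
  ring

theorem clm_apply_eq_sum {q : ℕ} (L : EuclideanSpace ℝ (Fin q) →L[ℝ] ℝ)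
    (w : EuclideanSpace ℝ (Fin q)) : L w = ∑ k, w k * L (EuclideanSpace.single k 1) := by
  have hw : w = ∑ j, w j • EuclideanSpace.single j (1 : ℝ) := by
    have := (EuclideanSpace.basisFun (Fin q) ℝ).sum_repr w
    simpa using this.symm
  conv_lhs => rw [hw]
  simp

theorem exists_pos_mul_norm_sq_le_of_posDef_hessianMatrix {q : ℕ}
    {g : EuclideanSpace ℝ (Fin q) → ℝ} {x : EuclideanSpace ℝ (Fin q)}
    (hH : (hessianMatrix g x).PosDef) :
    ∃ c > 0, ∀ v, c * ‖v‖ ^ 2 ≤ fderiv ℝ (fderiv ℝ g) x v v := by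
  refine exists_pos_mul_norm_sq_le _ fun v hv => ?_
  have := hH.dotProduct_mulVec_pos (x := v.ofLp) (by simpa using hv)
  rw [bilin_eq_sum]
  refine this.trans_eq ?_
  simp only [dotProduct, Matrix.mulVec, Finset.mul_sum, hessianMatrix, Matrix.of_apply]
  refine Finset.sum_congr rfl fun j _ => Finset.sum_congr rfl fun k _ => ?_
  simp
  ring

/-- The covariance of the linearised step is H⁻¹ (4G) H⁻ᵀ; tested against ½ H, one factor H⁻¹
cancels. -/
theorem half_sum_sandwich {q : ℕ} {H G : Matrix (Fin q) (Fin q) ℝ} (hH : IsUnit H.det) :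
    1 / 2 * ∑ j, ∑ k, H j k * (∑ a, ∑ b, H⁻¹ j a * H⁻¹ k b * (4 * G a b)) =
      2 * (G * H⁻¹).trace := by
  have h1 : ∀ j k, ∑ a, ∑ b, H⁻¹ j a * H⁻¹ k b * (4 * G a b) =
      4 * (H⁻¹ * G * H⁻¹.transpose) j k := by
    intro j k
    simp only [Matrix.mul_apply, Matrix.transpose_apply, Finset.sum_mul, Finset.mul_sum]
    rw [Finset.sum_comm]
    refine Finset.sum_congr rfl fun b _ => Finset.sum_congr rfl fun a _ => by ring
  have h2 : ∑ j, ∑ k, H j k * (H⁻¹ * G * H⁻¹.transpose) j k =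
      (H * (H⁻¹ * G * H⁻¹.transpose).transpose).trace := by
    simp only [Matrix.trace, Matrix.diag_apply, Matrix.mul_apply, Matrix.transpose_apply]
  have h3 : H * (H⁻¹ * G * H⁻¹.transpose).transpose = (H⁻¹ * G).transpose := by
    rw [Matrix.transpose_mul, Matrix.transpose_transpose, ← Matrix.mul_assoc,
      Matrix.mul_nonsing_inv _ hH, Matrix.one_mul]
  simp only [h1]
  have h4 : ∑ j, ∑ k, H j k * (4 * (H⁻¹ * G * H⁻¹.transpose) j k) =
      4 * ∑ j, ∑ k, H j k * (H⁻¹ * G * H⁻¹.transpose) j k := by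
    simp only [Finset.mul_sum]
    refine Finset.sum_congr rfl fun j _ => Finset.sum_congr rfl fun k _ => by ring
  rw [h4, h2, h3, Matrix.trace_transpose, Matrix.trace_mul_comm]
  ring

theorem integral_sum_mul_sum_eq {Ω ι : Type*} [Fintype ι] [MeasurableSpace Ω] {P : Measure Ω}
    {g : ι → Ω → ℝ} (hg : ∀ i, MemLp (g i) 2 P) (u v : ι → ℝ) :
    ∫ ω, (-∑ a, u a * g a ω) * (-∑ b, v b * g b ω) ∂P =
      ∑ a, ∑ b, u a * v b * ∫ ω, g a ω * g b ω ∂P := by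
  have h1 : ∀ ω, (-∑ a, u a * g a ω) * (-∑ b, v b * g b ω) =
      ∑ a, ∑ b, u a * v b * (g a ω * g b ω) := by
    intro ω
    rw [neg_mul_neg, Finset.sum_mul_sum]
    refine Finset.sum_congr rfl fun a _ => Finset.sum_congr rfl fun b _ => by ring
  simp_rw [h1]
  have hi : ∀ a b, Integrable (fun ω => u a * v b * (g a ω * g b ω)) P := fun a b =>
    ((hg a).integrable_mul (hg b)).const_mul _
  rw [integral_finsetSum _ fun a _ => integrable_finsetSum _ fun b _ => hi a b]
  refine Finset.sum_congr rfl fun a _ => ?_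
  rw [integral_finsetSum _ fun b _ => hi a b]
  simp only [integral_const_mul]

theorem IsNestedSample.memLp_mul_sub_innerMean {Ω : Type*} [MeasurableSpace Ω] {d p : ℕ}
    {P : Measure Ω} [IsProbabilityMeasure P]
    {X : Ω → EuclideanSpace ℝ (Fin d)} {Y : Ω → EuclideanSpace ℝ (Fin p)}
    {f : EuclideanSpace ℝ (Fin p) → ℝ} {Xs : ℕ → Ω → EuclideanSpace ℝ (Fin d)}
    {Ys : ℕ → ℕ → Ω → EuclideanSpace ℝ (Fin p)}
    (h : IsNestedSample P X Y Xs Ys) (hX : Measurable X) (hY : Measurable Y) (hf : Measurable f)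
    {K : ℕ} (hK : 1 ≤ K) (i : ℕ)
    {s π : EuclideanSpace ℝ (Fin d) → ℝ} (hs : Measurable s) (hπ : Measurable π)
    (hsπ : MemLp (fun ω => s (X ω) * (π (X ω) - regMean P X Y f (X ω))) 2 P)
    (hsf : MemLp (fun ω => s (X ω) * (f (Y ω) - regMean P X Y f (X ω))) 2 P) :
    MemLp (fun ω => s (Xs i ω) * (π (Xs i ω) - innerMean f Ys K i ω)) 2 P := by
  have hm := measurable_regMean (P := P) (X := X) (Y := Y) hf
  have hΨ₁ : Measurable fun x => s x * (π x - regMean P X Y f x) := by fun_prop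
  have hΨ₂ : Measurable fun z : EuclideanSpace ℝ (Fin d) × EuclideanSpace ℝ (Fin p) =>
    s z.1 * (f z.2 - regMean P X Y f z.1) := by fun_prop
  simp_rw [mul_sub_innerMean_eq (f := f) (Xs := Xs) (Ys := Ys) s π (regMean P X Y f) hK i]
  exact (((h.identDistrib_fst hX hY i).comp hΨ₁).memLp_iff.2 hsπ).sub
    ((memLp_finsetSum _ fun k _ =>
      ((h.identDistrib_pair hX hY i k).comp hΨ₂).memLp_iff.2 hsf).const_mul _)

namespace IsSmoothModel

variable {Ω : Type*} [MeasurableSpace Ω] {d p q : ℕ} {P : Measure Ω}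
  {X : Ω → EuclideanSpace ℝ (Fin d)} {Y : Ω → EuclideanSpace ℝ (Fin p)}
  {f : EuclideanSpace ℝ (Fin p) → ℝ}
  {φ : EuclideanSpace ℝ (Fin q) → EuclideanSpace ℝ (Fin d) → ℝ}
  {C : Set (EuclideanSpace ℝ (Fin q))} {D₀ D₁ D₂ : EuclideanSpace ℝ (Fin d) → ℝ}
  {x : EuclideanSpace ℝ (Fin q)}
  {Xs : ℕ → Ω → EuclideanSpace ℝ (Fin d)} {Ys : ℕ → ℕ → Ω → EuclideanSpace ℝ (Fin p)}

theorem measurable_score (h : IsSmoothModel P X Y f φ C D₀ D₁ D₂) (hx : x ∈ interior C)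
    (j : Fin q) : Measurable (score φ x j) := by
  have h1 := h.measurable_partialAt hx j
  have h2 := h.smooth.measurable x
  exact ((h1.comp measurable_fst).mul ((h2.comp measurable_fst).sub measurable_snd)).const_mul 2

variable [IsProbabilityMeasure P]

theorem integral_score_mul_score (h : IsSmoothModel P X Y f φ C D₀ D₁ D₂)
    (hs : IsNestedSample P X Y Xs Ys) {K : ℕ} (hK : 1 ≤ K) (hx : x ∈ interior C)
    (hA : ∀ j, MemLp (fun ω => partialAt φ x j (X ω) * (φ x (X ω) - regMean P X Y f (X ω))) 2 P)
    (hB : ∀ j, MemLp (fun ω => partialAt φ x j (X ω) * (f (Y ω) - regMean P X Y f (X ω))) 2 P)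
    (i j : Fin q) :
    ∫ ω, score φ x i (Xs 0 ω, innerMean f Ys K 0 ω) * score φ x j (Xs 0 ω, innerMean f Ys K 0 ω)
      ∂P = 4 * matGamma P X Y f φ x K i j := by
  have h1 := hs.integral_mul_sub_innerMean_mul h.measurable_X h.measurable_Y h.measurable_f hK 0
    (h.measurable_partialAt hx i) (h.measurable_partialAt hx j) (h.smooth.measurable x)
    (hA i) (hA j) (hB i) (hB j)
  rw [← h.matA_apply, ← h.matB_apply] at h1
  simp only [matGamma, Matrix.add_apply, Matrix.smul_apply, smul_eq_mul]
  rw [← h1, ← integral_const_mul]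
  refine integral_congr_ae (ae_of_all _ fun ω => ?_)
  simp only [score]
  ring

theorem integral_sqLoss_lt (h : IsSmoothModel P X Y f φ C D₀ D₁ D₂)
    (hs : IsNestedSample P X Y Xs Ys) (hx : x ∈ interior C)
    (hmin : ∀ y ∈ C, y ≠ x → vInf P X Y f φ x < vInf P X Y f φ y) {K : ℕ} (hK : 1 ≤ K) :
    ∀ y ∈ C, y ≠ x → ∫ ω, sqLoss φ x (Xs 0 ω, innerMean f Ys K 0 ω) ∂P <
      ∫ ω, sqLoss φ y (Xs 0 ω, innerMean f Ys K 0 ω) ∂P := by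
  intro y hy hne
  rw [h.integral_sqLoss hs hK hy, h.integral_sqLoss hs hK (interior_subset hx)]
  linarith [hmin y hy hne]

theorem memLp_score (h : IsSmoothModel P X Y f φ C D₀ D₁ D₂)
    (hs : IsNestedSample P X Y Xs Ys) (hx : x ∈ interior C)
    (hA : ∀ j, MemLp (fun ω => partialAt φ x j (X ω) * (φ x (X ω) - regMean P X Y f (X ω))) 2 P)
    (hB : ∀ j, MemLp (fun ω => partialAt φ x j (X ω) * (f (Y ω) - regMean P X Y f (X ω))) 2 P)
    {K : ℕ} (hK : 1 ≤ K) (j : Fin q) :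
    MemLp (fun ω => score φ x j (Xs 0 ω, innerMean f Ys K 0 ω)) 2 P :=
  (hs.memLp_mul_sub_innerMean h.measurable_X h.measurable_Y h.measurable_f hK 0
    (h.measurable_partialAt hx j) (h.smooth.measurable x) (hA j) (hB j)).const_mul 2

theorem integral_score_eq_zero (h : IsSmoothModel P X Y f φ C D₀ D₁ D₂)
    (hs : IsNestedSample P X Y Xs Ys) (hx : x ∈ interior C)
    (hmin : ∀ y ∈ C, y ≠ x → vInf P X Y f φ x < vInf P X Y f φ y) {K : ℕ} (hK : 1 ≤ K)
    (j : Fin q) : ∫ ω, score φ x j (Xs 0 ω, innerMean f Ys K 0 ω) ∂P = 0 := by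
  have hζ := hs.isIIDSeq h.measurable_f K
  have hF := h.smooth.sqLoss_isSmoothLoss
  have hD := (h.integrable_sqEnvelope hs K).1
  have h1 := hF.integral_fderiv_eq_zero hζ hD hD hx (h.integral_sqLoss_lt hs hx hmin hK)
  have h2 := congrArg (fun L => L (EuclideanSpace.single j (1 : ℝ))) h1
  simp only [ContinuousLinearMap.integral_apply (hF.integrable_fderiv (hζ.measurable 0) hD hx),
    fderiv_sqLoss_single h.smooth hx] at h2
  simpa using h2

theorem integrable_vInf_comp (h : IsSmoothModel P X Y f φ C D₀ D₁ D₂)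
    (hs : IsNestedSample P X Y Xs Ys) (hC : IsCompact C)
    {θ : Ω → EuclideanSpace ℝ (Fin q)} (hθ : AEMeasurable θ P) (hθC : ∀ᵐ ω ∂P, θ ω ∈ C) :
    Integrable (fun ω => vInf P X Y f φ (θ ω)) P :=
  integrable_comp_of_continuousOn hC (h.continuousOn_vInf hs hC) hθ hθC

/-- M-estimation applied to the pairs (X_i, inner mean), where the constant between mean loss and
v^∞ cancels from every difference. The lower limit is kept separate because it is needed for all
`K`, whereas uniform integrability is only available at K⋆. -/
theorem risk_limit (h : IsSmoothModel P X Y f φ C D₀ D₁ D₂)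
    (hs : IsNestedSample P X Y Xs Ys) (hC : IsCompact C) (hx : x ∈ interior C)
    (hmin : ∀ y ∈ C, y ≠ x → vInf P X Y f φ x < vInf P X Y f φ y)
    (hH : (hessianMatrix (vInf P X Y f φ) x).PosDef)
    (hA : ∀ j, MemLp (fun ω => partialAt φ x j (X ω) * (φ x (X ω) - regMean P X Y f (X ω))) 2 P)
    (hB : ∀ j, MemLp (fun ω => partialAt φ x j (X ω) * (f (Y ω) - regMean P X Y f (X ω))) 2 P)
    {K : ℕ} (hK : 1 ≤ K)
    {est : ℕ → Ω → EuclideanSpace ℝ (Fin q)} (hestm : ∀ N, 1 ≤ N → AEMeasurable (est N) P)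
    (hest : ∀ N, 1 ≤ N → ∀ᵐ ω ∂P,
      est N ω ∈ C ∧ IsMinOn (vEmp f φ Xs Ys K N ω) C (est N ω)) :
    (∀ ε > 0, ∀ᶠ N : ℕ in atTop,
      2 * (matGamma P X Y f φ x K * (hessianMatrix (vInf P X Y f φ) x)⁻¹).trace - ε ≤
        N * (∫ ω, vInf P X Y f φ (est N ω) ∂P - vInf P X Y f φ x)) ∧
    (UnifIntegrable (fun (N : ℕ) ω =>
        (N : ℝ) * (vInf P X Y f φ (est N ω) - vInf P X Y f φ x)) 1 P →
      Tendsto (fun N : ℕ => N * (∫ ω, vInf P X Y f φ (est N ω) ∂P - vInf P X Y f φ x)) atTop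
        (𝓝 (2 * (matGamma P X Y f φ x K * (hessianMatrix (vInf P X Y f φ) x)⁻¹).trace))) := by
  set H := hessianMatrix (vInf P X Y f φ) x with hHdef
  set ζ : ℕ → Ω → EuclideanSpace ℝ (Fin d) × ℝ :=
    fun i ω => (Xs i ω, innerMean f Ys K i ω) with hζdef
  have hζ : IsIIDSeq ζ P := hs.isIIDSeq h.measurable_f K
  have hF := h.smooth.sqLoss_isSmoothLoss
  have hD : Integrable (fun ω => sqEnvelope D₀ D₁ D₂ (ζ 0 ω)) P := (h.integrable_sqEnvelope hs K).1
  have hV : ∀ y ∈ C, ∫ ω, sqLoss φ y (ζ 0 ω) ∂P = vInf P X Y f φ y +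
      (1 / (K : ℝ)) * ∫ ω, (f (Y ω) - regMean P X Y f (X ω)) ^ 2 ∂P := fun y hy =>
    h.integral_sqLoss hs hK hy
  have hxC := interior_subset hx
  have hmin' := h.integral_sqLoss_lt hs hx hmin hK
  obtain ⟨c, hc, hQc⟩ := exists_pos_mul_norm_sq_le_of_posDef_hessianMatrix hH
  set Q := fderiv ℝ (fderiv ℝ (vInf P X Y f φ)) x with hQdef
  have hQ : Q = ∫ ω, fderiv ℝ (fderiv ℝ (fun s => sqLoss φ s (ζ 0 ω))) x ∂P :=
    (h.integral_fderiv_fderiv_sqLoss hs hK hx).symm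
  have hQH : ∀ j k, Q (EuclideanSpace.single j 1) (EuclideanSpace.single k 1) = H j k :=
    fun j k => rfl
  have hdet : IsUnit H.det := (Matrix.isUnit_iff_isUnit_det _).1 hH.isUnit
  have hsymm : H.transpose = H := by
    have := hH.isHermitian
    rwa [Matrix.IsHermitian, Matrix.conjTranspose_eq_transpose_of_trivial] at this
  -- One Newton step from the minimiser: it solves `Q (η z) = -∇loss`, and its empirical mean
  -- minimises the quadratic model of the empirical risk.
  set η : EuclideanSpace ℝ (Fin d) × ℝ → EuclideanSpace ℝ (Fin q) :=
    fun z => WithLp.toLp 2 fun j => -∑ k, H⁻¹ j k * score φ x k z with hηdef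
  have hη : ∀ z w, Q (η z) w = -fderiv ℝ (fun s => sqLoss φ s z) x w := by
    intro z w
    have e1 : H.mulVec (η z).ofLp = fun k => -score φ x k z := by
      have : (η z).ofLp = -(H⁻¹.mulVec fun k => score φ x k z) := by
        funext j
        simp [hηdef, Matrix.mulVec, dotProduct]
      rw [this, Matrix.mulVec_neg, Matrix.mulVec_mulVec, Matrix.mul_nonsing_inv _ hdet,
        Matrix.one_mulVec]
      rfl
    rw [bilin_eq_sum, clm_apply_eq_sum _ w, Finset.sum_comm, ← Finset.sum_neg_distrib]
    refine Finset.sum_congr rfl fun k _ => ?_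
    rw [fderiv_sqLoss_single h.smooth hx]
    have e2 := congrFun e1 k
    simp only [Matrix.mulVec, dotProduct] at e2
    rw [← mul_neg, ← e2, Finset.mul_sum]
    refine Finset.sum_congr rfl fun j _ => ?_
    rw [hQH, ← hsymm, Matrix.transpose_apply, hsymm]
    ring
  have hsm := h.measurable_score hx
  have hG2 : ∀ j, MemLp (fun ω => score φ x j (ζ 0 ω)) 2 P := h.memLp_score hs hx hA hB hK
  have hG0 : ∀ j, ∫ ω, score φ x j (ζ 0 ω) ∂P = 0 := h.integral_score_eq_zero hs hx hmin hK
  have hηm : ∀ j, Measurable fun z => η z j := fun j =>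
    (Finset.measurable_sum _ fun k _ => (hsm k).const_mul (H⁻¹ j k)).neg
  have hη2 : ∀ j, MemLp (fun ω => η (ζ 0 ω) j) 2 P := fun j =>
    (memLp_finsetSum _ fun k _ => (hG2 k).const_mul (H⁻¹ j k)).neg
  have hη0 : ∀ j, ∫ ω, η (ζ 0 ω) j ∂P = 0 := by
    intro j
    simp only [hηdef]
    rw [integral_neg, integral_finsetSum _ fun k _ =>
      ((hG2 k).integrable (by norm_num)).const_mul (H⁻¹ j k)]
    simp [integral_const_mul, hG0]
  have hest' : ∀ᵐ ω ∂P, ∀ N, 1 ≤ N → est N ω ∈ C ∧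
      IsMinOn (fun t => empMean ζ (sqLoss φ t) N ω) C (est N ω) := by
    rw [ae_all_iff]
    intro N
    by_cases hN : 1 ≤ N
    · filter_upwards [hest N hN] with ω hω _
      have : (fun t => empMean ζ (sqLoss φ t) N ω) = vEmp f φ Xs Ys K N ω := by
        funext t
        simp [empMean, vEmp, sqLoss, hζdef]
      rw [this]
      exact hω
    · exact ae_of_all _ fun ω hN' => absurd hN' hN
  have ht : 2 * (matGamma P X Y f φ x K * H⁻¹).trace = 1 / 2 * ∑ j, ∑ k,
      Q (EuclideanSpace.single j 1) (EuclideanSpace.single k 1) *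
        ∫ ω, η (ζ 0 ω) j * η (ζ 0 ω) k ∂P := by
    rw [← half_sum_sandwich hdet]
    congr 1
    refine Finset.sum_congr rfl fun j _ => Finset.sum_congr rfl fun k _ => ?_
    rw [hQH]
    congr 1
    simp only [hηdef]
    rw [integral_sum_mul_sum_eq hG2]
    refine Finset.sum_congr rfl fun a _ => Finset.sum_congr rfl fun b _ => ?_
    rw [h.integral_score_mul_score hs hK hx hA hB]
  obtain ⟨hlow, hlim⟩ := hF.excess_risk_limit hζ hC hD hD hD hx hmin' hc hQ hQc hη hηm hη2 hη0
    hestm hest' ht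
  have hcongr : ∀ N : ℕ, 1 ≤ N → (fun ω => (N : ℝ) *
      (∫ ω', sqLoss φ (est N ω) (ζ 0 ω') ∂P - ∫ ω', sqLoss φ x (ζ 0 ω') ∂P)) =ᵐ[P]
      fun ω => (N : ℝ) * (vInf P X Y f φ (est N ω) - vInf P X Y f φ x) := by
    intro N hN
    filter_upwards [hest N hN] with ω hω
    rw [hV _ hω.1, hV x hxC]
    ring
  have hint : ∀ N : ℕ, 1 ≤ N → ∫ ω, (N : ℝ) *
      (∫ ω', sqLoss φ (est N ω) (ζ 0 ω') ∂P - ∫ ω', sqLoss φ x (ζ 0 ω') ∂P) ∂P =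
      N * (∫ ω, vInf P X Y f φ (est N ω) ∂P - vInf P X Y f φ x) := by
    intro N hN
    rw [integral_congr_ae (hcongr N hN), integral_const_mul, integral_sub
      (h.integrable_vInf_comp hs hC (hestm N hN) ((hest N hN).mono fun _ h => h.1))
      (integrable_const _)]
    simp
  refine ⟨fun ε hε => ?_, fun hUI => ?_⟩
  · filter_upwards [hlow ε hε, eventually_ge_atTop 1] with N hN hN1
    rwa [hint N hN1] at hN
  · refine (hlim (hUI.ae_eq fun N => ?_)).congr' ?_
    -- At index 0 nothing is known about the estimator, but the factor `N` makes both functions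
    -- vanish.
    · rcases Nat.eq_zero_or_pos N with rfl | hN
      · simp
      · exact (hcongr N hN).symm
    · filter_upwards [eventually_ge_atTop 1] with N hN using hint N hN

end IsSmoothModel

/-! ### The lower bound uniform in the inner sample size, and positivity of traces. -/

/-- A centred square integrable function that is not zero correlates with a bounded centred
function. -/
theorem exists_bounded_test {Ω S : Type*} [MeasurableSpace Ω] [MeasurableSpace S] {P : Measure Ω}
    [IsProbabilityMeasure P] {ξ : Ω → S} (hξ : Measurable ξ) {α : S → ℝ} (hα : Measurable α)
    (hα2 : MemLp (fun ω => α (ξ ω)) 2 P) (hα0 : ∫ ω, α (ξ ω) ∂P = 0)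
    (hpos : 0 < ∫ ω, α (ξ ω) ^ 2 ∂P) :
    ∃ β : S → ℝ, Measurable β ∧ (∃ M : ℝ, ∀ z, |β z| ≤ M) ∧ ∫ ω, β (ξ ω) ∂P = 0 ∧
      (∫ ω, α (ξ ω) ^ 2 ∂P) / 2 ≤ ∫ ω, α (ξ ω) * β (ξ ω) ∂P := by
  obtain ⟨n, hn⟩ := ((tendsto_order.1 (tendsto_integral_sub_truncAt_sq hξ hα hα2)).2 _
    (half_pos hpos)).exists
  set b := ∫ ω, truncAt α n (ξ ω) ∂P with hb
  have hbd : ∀ z, |truncAt α n z| ≤ n := abs_truncAt_le α n.cast_nonneg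
  have hm := measurable_truncAt hα n
  have hti : MemLp (fun ω => truncAt α n (ξ ω)) 2 P :=
    MemLp.of_bound (hm.comp hξ).aestronglyMeasurable n (ae_of_all _ fun ω => hbd _)
  refine ⟨fun z => truncAt α n z - b, hm.sub_const b, ⟨n + |b|, fun z => ?_⟩, ?_, ?_⟩
  · exact (abs_sub _ _).trans (by linarith [hbd z])
  · rw [integral_sub (hti.integrable (by norm_num)) (integrable_const _)]
    simp [hb]
  -- The test function is the recentred truncation. Recentring costs nothing because `α` has mean 0,
  -- and the truncation level leaves a tail below half the second moment.
  · have h1 : ∀ ω, α (ξ ω) * (truncAt α n (ξ ω) - b) =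
        α (ξ ω) ^ 2 - (α (ξ ω) - truncAt α n (ξ ω)) ^ 2 - b * α (ξ ω) := by
      intro ω
      rw [mul_sub, mul_truncAt]
      ring
    simp_rw [h1]
    have i1 : Integrable (fun ω => α (ξ ω) ^ 2) P := hα2.integrable_sq
    have i2 : Integrable (fun ω => (α (ξ ω) - truncAt α n (ξ ω)) ^ 2) P :=
      (hα2.sub hti).integrable_sq
    have i3 : Integrable (fun ω => b * α (ξ ω)) P := (hα2.integrable (by norm_num)).const_mul b
    have i12 : Integrable (fun ω => α (ξ ω) ^ 2 - (α (ξ ω) - truncAt α n (ξ ω)) ^ 2) P :=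
      i1.sub i2
    rw [integral_sub i12 i3, integral_sub i1 i2, integral_const_mul, hα0]
    linarith

/-- The trace is the mean of the quadratic form of `G` at the random vector `w`, so its sign can be
read pointwise. -/
theorem trace_gram_mul {Ω ι : Type*} [Fintype ι] [MeasurableSpace Ω] {P : Measure Ω}
    {w : ι → Ω → ℝ} (hw : ∀ i, MemLp (w i) 2 P) {M : Matrix ι ι ℝ}
    (hM : ∀ i j, M i j = ∫ ω, w i ω * w j ω ∂P) (G : Matrix ι ι ℝ) :
    Integrable (fun ω => (fun i => w i ω) ⬝ᵥ G.mulVec fun i => w i ω) P ∧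
    (M * G).trace = ∫ ω, (fun i => w i ω) ⬝ᵥ G.mulVec (fun i => w i ω) ∂P := by
  have hi : ∀ i j, Integrable (fun ω => w j ω * (G j i * w i ω)) P := fun i j =>
    (hw j).integrable_mul ((hw i).const_mul _)
  have heq : ∀ ω, (fun i => w i ω) ⬝ᵥ G.mulVec (fun i => w i ω) =
      ∑ i, ∑ j, w j ω * (G j i * w i ω) := by
    intro ω
    simp only [dotProduct, Matrix.mulVec, Finset.mul_sum]
    exact Finset.sum_comm
  simp_rw [heq]
  refine ⟨integrable_finsetSum _ fun i _ => integrable_finsetSum _ fun j _ => hi i j, ?_⟩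
  rw [integral_finsetSum _ fun i _ => integrable_finsetSum _ fun j _ => hi i j]
  simp only [Matrix.trace, Matrix.diag_apply, Matrix.mul_apply]
  refine Finset.sum_congr rfl fun i _ => ?_
  rw [integral_finsetSum _ fun j _ => hi i j]
  refine Finset.sum_congr rfl fun j _ => ?_
  rw [hM, ← integral_mul_const]
  refine integral_congr_ae (ae_of_all _ fun ω => ?_)
  simp only
  ring

theorem trace_gram_mul_nonneg {Ω ι : Type*} [Fintype ι] [MeasurableSpace Ω] {P : Measure Ω}
    {w : ι → Ω → ℝ} (hw : ∀ i, MemLp (w i) 2 P) {M : Matrix ι ι ℝ}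
    (hM : ∀ i j, M i j = ∫ ω, w i ω * w j ω ∂P) {G : Matrix ι ι ℝ} (hG : G.PosDef) :
    0 ≤ (M * G).trace := by
  rw [(trace_gram_mul hw hM G).2]
  exact integral_nonneg fun ω => hG.posSemidef.dotProduct_mulVec_nonneg fun i => w i ω

/-- If the mean of a nonnegative quadratic form vanishes, definiteness of `G` forces `w = 0` almost
surely, and then the Gram matrix `M` is zero. -/
theorem trace_gram_mul_pos {Ω ι : Type*} [Fintype ι] [MeasurableSpace Ω] {P : Measure Ω}
    {w : ι → Ω → ℝ} (hw : ∀ i, MemLp (w i) 2 P) {M : Matrix ι ι ℝ}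
    (hM : ∀ i j, M i j = ∫ ω, w i ω * w j ω ∂P) {G : Matrix ι ι ℝ} (hG : G.PosDef) (hM0 : M ≠ 0) :
    0 < (M * G).trace := by
  refine lt_of_le_of_ne (trace_gram_mul_nonneg hw hM hG) fun h0 => hM0 (Matrix.ext fun i j => ?_)
  obtain ⟨hint, heq⟩ := trace_gram_mul hw hM G
  have hnn : 0 ≤ fun ω => (fun i => w i ω) ⬝ᵥ G.mulVec (fun i => w i ω) :=
    fun ω => hG.posSemidef.dotProduct_mulVec_nonneg fun i => w i ω
  rw [heq, eq_comm, integral_eq_zero_iff_of_nonneg hnn hint] at h0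
  rw [hM, Matrix.zero_apply]
  refine integral_eq_zero_of_ae ?_
  filter_upwards [h0] with ω hω
  have : (fun i => w i ω) = 0 := by
    by_contra hne
    exact (hG.dotProduct_mulVec_pos hne).ne' hω
  simp [congrFun this i]

namespace IsSmoothModel

variable {Ω : Type*} [MeasurableSpace Ω] {d p q : ℕ} {P : Measure Ω} [IsProbabilityMeasure P]
  {X : Ω → EuclideanSpace ℝ (Fin d)} {Y : Ω → EuclideanSpace ℝ (Fin p)}
  {f : EuclideanSpace ℝ (Fin p) → ℝ}
  {φ : EuclideanSpace ℝ (Fin q) → EuclideanSpace ℝ (Fin d) → ℝ}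
  {C : Set (EuclideanSpace ℝ (Fin q))} {D₀ D₁ D₂ : EuclideanSpace ℝ (Fin d) → ℝ}
  {x : EuclideanSpace ℝ (Fin q)}
  {Xs : ℕ → Ω → EuclideanSpace ℝ (Fin d)} {Ys : ℕ → ℕ → Ω → EuclideanSpace ℝ (Fin p)}

theorem matA_diag_nonneg (h : IsSmoothModel P X Y f φ C D₀ D₁ D₂) (j : Fin q) :
    0 ≤ matA P X Y f φ x j j := by
  rw [h.matA_apply]
  exact integral_nonneg fun ω => mul_self_nonneg _

theorem matB_diag_nonneg (h : IsSmoothModel P X Y f φ C D₀ D₁ D₂) (j : Fin q) :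
    0 ≤ matB P X Y f φ x j j := by
  rw [h.matB_apply]
  exact integral_nonneg fun ω => mul_self_nonneg _

/-- A Gram matrix with zero diagonal comes from almost surely zero entries. The index found here
selects the score coordinate that drives the lower bound. -/
theorem exists_matA_diag_pos (h : IsSmoothModel P X Y f φ C D₀ D₁ D₂)
    (hA : ∀ j, MemLp (fun ω => partialAt φ x j (X ω) * (φ x (X ω) - regMean P X Y f (X ω))) 2 P)
    (hne : matA P X Y f φ x ≠ 0) : ∃ j, 0 < matA P X Y f φ x j j := by
  by_contra! hcon
  refine hne (Matrix.ext fun i j => ?_)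
  have h0 : ∫ ω, (partialAt φ x i (X ω) * (φ x (X ω) - regMean P X Y f (X ω))) *
      (partialAt φ x i (X ω) * (φ x (X ω) - regMean P X Y f (X ω))) ∂P = 0 := by
    rw [← h.matA_apply]
    exact le_antisymm (hcon i) (h.matA_diag_nonneg i)
  rw [integral_eq_zero_iff_of_nonneg (fun ω => mul_self_nonneg _)
    ((hA i).integrable_mul (hA i))] at h0
  rw [h.matA_apply, Matrix.zero_apply]
  refine integral_eq_zero_of_ae ?_
  filter_upwards [h0] with ω hω
  have : partialAt φ x i (X ω) * (φ x (X ω) - regMean P X Y f (X ω)) = 0 := by simpa using hω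
  simp [this]

theorem trace_matA_mul_inv_pos (h : IsSmoothModel P X Y f φ C D₀ D₁ D₂)
    (hA : ∀ j, MemLp (fun ω => partialAt φ x j (X ω) * (φ x (X ω) - regMean P X Y f (X ω))) 2 P)
    (hne : matA P X Y f φ x ≠ 0) {H : Matrix (Fin q) (Fin q) ℝ} (hH : H.PosDef) :
    0 < (matA P X Y f φ x * H⁻¹).trace :=
  trace_gram_mul_pos hA h.matA_apply hH.inv hne

theorem trace_matB_mul_inv_nonneg (h : IsSmoothModel P X Y f φ C D₀ D₁ D₂)
    (hB : ∀ j, MemLp (fun ω => partialAt φ x j (X ω) * (f (Y ω) - regMean P X Y f (X ω))) 2 P)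
    {H : Matrix (Fin q) (Fin q) ℝ} (hH : H.PosDef) :
    0 ≤ (matB P X Y f φ x * H⁻¹).trace :=
  trace_gram_mul_nonneg hB h.matB_apply hH.inv

/-- The expected excess risk is at least of order `1 / N`, uniformly in the inner sample size. -/
theorem exists_le_excess_risk (h : IsSmoothModel P X Y f φ C D₀ D₁ D₂)
    (hs : IsNestedSample P X Y Xs Ys) (hC : IsCompact C) (hx : x ∈ interior C)
    (hmin : ∀ y ∈ C, y ≠ x → vInf P X Y f φ x < vInf P X Y f φ y)
    (hH : (hessianMatrix (vInf P X Y f φ) x).PosDef)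
    (hA : ∀ j, MemLp (fun ω => partialAt φ x j (X ω) * (φ x (X ω) - regMean P X Y f (X ω))) 2 P)
    (hB : ∀ j, MemLp (fun ω => partialAt φ x j (X ω) * (f (Y ω) - regMean P X Y f (X ω))) 2 P)
    (hne : matA P X Y f φ x ≠ 0) :
    ∃ δ > 0, ∀ (K N : ℕ) (est : Ω → EuclideanSpace ℝ (Fin q)), 1 ≤ K → 1 ≤ N →
      AEMeasurable est P →
      (∀ᵐ ω ∂P, est ω ∈ C ∧ IsMinOn (vEmp f φ Xs Ys K N ω) C (est ω)) →
      δ / N ≤ ∫ ω, vInf P X Y f φ (est ω) ∂P - vInf P X Y f φ x := by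
  have hF := h.smooth.sqLoss_isSmoothLoss
  obtain ⟨j, hj⟩ := h.exists_matA_diag_pos hA hne
  -- quadratic growth of the risk
  obtain ⟨c, hc, hQc⟩ := exists_pos_mul_norm_sq_le_of_posDef_hessianMatrix hH
  obtain ⟨a, ha, hgrow⟩ := hF.exists_quadratic_growth (hs.isIIDSeq h.measurable_f 1) hC
    (h.integrable_sqEnvelope hs 1).1 (h.integrable_sqEnvelope hs 1).1
    (h.integrable_sqEnvelope hs 1).1 hx (h.integral_sqLoss_lt hs hx hmin le_rfl) hc (by
      rw [h.integral_fderiv_fderiv_sqLoss hs le_rfl hx]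
      exact hQc)
  have hgrow' : ∀ y ∈ C, a * ‖y - x‖ ^ 2 ≤ vInf P X Y f φ y - vInf P X Y f φ x := by
    intro y hy
    have := hgrow y hy
    rw [h.integral_sqLoss hs le_rfl hy, h.integral_sqLoss hs le_rfl (interior_subset hx)] at this
    linarith
  obtain ⟨r, hr, hball⟩ := Metric.nhds_basis_closedBall.mem_iff.1 (isOpen_interior.mem_nhds hx)
  -- the test function
  set g := partialAt φ x j with hg
  have hgm : Measurable g := h.measurable_partialAt hx j
  -- `α` is the part of the score that depends on `X` alone. It does not involve `K`, and its second
  -- moment is 4 times the positive diagonal entry of A.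
  set α : EuclideanSpace ℝ (Fin d) → ℝ := fun z => 2 * g z * (φ x z - regMean P X Y f z) with hα
  have hm := h.measurable_m
  have hφm := h.smooth.measurable x
  have hαm : Measurable α := (hgm.const_mul 2).mul (hφm.sub hm)
  have hα2 : MemLp (fun ω => α (X ω)) 2 P := by
    refine ((hA j).const_mul 2).ae_eq (ae_of_all _ fun ω => ?_)
    simp only [hα]
    ring
  have hf2 : MemLp (fun ω => 2 * g (X ω) * (f (Y ω) - regMean P X Y f (X ω))) 2 P := by
    refine ((hB j).const_mul 2).ae_eq (ae_of_all _ fun ω => ?_)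
    simp only
    ring
  have hα0 : ∫ ω, α (X ω) ∂P = 0 := by
    rw [← h.integral_score_eq_zero hs hx hmin le_rfl j]
    refine (hs.integral_mul_sub_innerMean h.measurable_X h.measurable_Y h.measurable_f le_rfl 0
      (hgm.const_mul 2) hφm (hα2.integrable (by norm_num))
      (hf2.integrable (by norm_num))).symm.trans ?_
    refine integral_congr_ae (ae_of_all _ fun ω => ?_)
    simp only [score, hg]
    ring
  have hαA : ∫ ω, α (X ω) ^ 2 ∂P = 4 * matA P X Y f φ x j j := by
    rw [h.matA_apply, ← integral_const_mul]
    refine integral_congr_ae (ae_of_all _ fun ω => ?_)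
    simp only [hα, hg]
    ring
  obtain ⟨β, hβm, ⟨M, hM⟩, hβ0, hβ⟩ := exists_bounded_test h.measurable_X hαm hα2 hα0
    (by rw [hαA]; positivity)
  rw [hαA] at hβ
  have hBd := h.matB_diag_nonneg (x := x) j
  obtain ⟨s, hs0, π, hπ0, hsmall⟩ := exists_le_measureReal_lt_abs (a := 2 * matA P X Y f φ x j j)
    (b := 4 * (matA P X Y f φ x j j + matB P X Y f φ x j j)) (m := 3 * M ^ 4) (by positivity)
    (by positivity) (by positivity)
  set m := 2 * ∫ ω, D₀ (X ω) ^ 2 ∂P + 2 * ∫ ω, D₁ (X ω) ^ 2 ∂P + 2 * ∫ ω, D₂ (X ω) ^ 2 ∂P +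
        2 * ∫ ω, f (Y ω) ^ 2 ∂P with hmdef
  have hm0 : 0 ≤ m := by
    have : ∀ g : Ω → ℝ, 0 ≤ ∫ ω, g ω ^ 2 ∂P := fun g => integral_nonneg fun _ => sq_nonneg _
    have h1 := this fun ω => D₀ (X ω)
    have h2 := this fun ω => D₁ (X ω)
    have h3 := this fun ω => D₂ (X ω)
    have h4 := this fun ω => f (Y ω)
    linarith
  obtain ⟨δ, hδ, hlow⟩ := exists_excess_risk_lower_bound hr ha hm0 hs0 hπ0
  refine ⟨δ, hδ, fun K N est hK hN hestm hest => ?_⟩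
  set ζ : ℕ → Ω → EuclideanSpace ℝ (Fin d) × ℝ :=
    fun i ω => (Xs i ω, innerMean f Ys K i ω) with hζdef
  have hζ : IsIIDSeq ζ P := hs.isIIDSeq h.measurable_f K
  have hVi := h.integrable_vInf_comp hs hC hestm (hest.mono fun _ h => h.1)
  have hfd : (fun z => fderiv ℝ (fun t => sqLoss φ t z) x (EuclideanSpace.single j 1)) =
      score φ x j := funext fun z => fderiv_sqLoss_single h.smooth hx j z
  have hsm := h.measurable_score hx j
  have hU2 : MemLp (fun ω => score φ x j (ζ 0 ω)) 2 P := h.memLp_score hs hx hA hB hK j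
  have hU0 : ∫ ω, score φ x j (ζ 0 ω) ∂P = 0 := h.integral_score_eq_zero hs hx hmin hK j
  -- The test variable ignores the inner mean. Innovations are orthogonal to functions of X, so its
  -- correlation with the score is that of `α` and `β` for every `K`.
  set γ : EuclideanSpace ℝ (Fin d) × ℝ → ℝ := fun z => β z.1 with hγ
  have hγm : Measurable γ := hβm.comp measurable_fst
  have hγM : ∀ z, |γ z| ≤ M := fun z => hM z.1
  have hγ2 : MemLp (fun ω => γ (ζ 0 ω)) 2 P :=
    MemLp.of_bound (hγm.comp (hζ.measurable 0)).aestronglyMeasurable M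
      (ae_of_all _ fun ω => hγM _)
  have hγ0 : ∫ ω, γ (ζ 0 ω) ∂P = 0 := by
    rw [← hβ0]
    exact ((hs.identDistrib_fst h.measurable_X h.measurable_Y 0).comp hβm).integral_eq
  have hprob : π ≤ P.real {ω | s < |normSum ζ (score φ x j) N ω|} := by
    refine hsmall P _ (normSum ζ γ N) (hζ.memLp_normSum hsm hU2 N) (hζ.memLp_normSum hγm hγ2 N)
      (hζ.integrable_normSum_pow_four hγm hγM N) ?_ ?_
      (hζ.integral_normSum_pow_four_le hγm hγM hγ0 N)
    · rw [hζ.integral_normSum_mul hsm hγm hU2 hγ2 hU0 hN]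
      have hβint : ∀ w : Ω → ℝ, MemLp w 2 P → Integrable (fun ω => w ω * β (X ω)) P := fun w hw =>
        hw.integrable_mul (MemLp.of_bound (p := 2) (hβm.comp h.measurable_X).aestronglyMeasurable M
          (ae_of_all _ fun ω => hM _))
      have e := hs.integral_mul_sub_innerMean h.measurable_X h.measurable_Y h.measurable_f hK 0
        (s := fun z => 2 * g z * β z) (π := φ x) ((hgm.const_mul 2).mul hβm) hφm
        ((hβint _ hα2).congr (ae_of_all _ fun ω => by simp only [hα]; ring))
        ((hβint _ hf2).congr (ae_of_all _ fun ω => by simp only; ring))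
      calc 2 * matA P X Y f φ x j j ≤ ∫ ω, α (X ω) * β (X ω) ∂P := by linarith
        _ = ∫ ω, 2 * g (X ω) * β (X ω) * (φ x (X ω) - regMean P X Y f (X ω)) ∂P :=
          integral_congr_ae (ae_of_all _ fun ω => by simp only [hα]; ring)
        _ = ∫ ω, 2 * g (Xs 0 ω) * β (Xs 0 ω) * (φ x (Xs 0 ω) - innerMean f Ys K 0 ω) ∂P := e.symm
        _ = _ := integral_congr_ae (ae_of_all _ fun ω => by simp only [score, hγ, hζdef, hg]; ring)
    · simp only [pow_two]
      rw [hζ.integral_normSum_mul hsm hsm hU2 hU2 hU0 hN]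
      -- The variance of the score is 4(A_jj + B_jj / K), bounded uniformly through `1 / K ≤ 1`.
      rw [h.integral_score_mul_score hs hK hx hA hB]
      simp only [matGamma, Matrix.add_apply, Matrix.smul_apply, smul_eq_mul]
      have : 1 / (K : ℝ) ≤ 1 := by
        rw [div_le_one (by positivity)]
        exact_mod_cast hK
      nlinarith
  have hest' : ∀ᵐ ω ∂P, est ω ∈ C ∧ IsMinOn (fun t => empMean ζ (sqLoss φ t) N ω) C (est ω) := by
    filter_upwards [hest] with ω hω
    have : (fun t => empMean ζ (sqLoss φ t) N ω) = vEmp f φ Xs Ys K N ω := by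
      funext t
      simp [empMean, vEmp, sqLoss, hζdef]
    rw [this]
    exact hω
  have hDm : Measurable (sqEnvelope D₀ D₁ D₂) := by
    have := h.measurable₀
    have := h.measurable₁
    have := h.measurable₂
    unfold sqEnvelope
    fun_prop
  have := hlow hF hζ hDm (h.integrable_sqEnvelope hs K).1 (h.integrable_sqEnvelope hs K).2 hball
    hN (by rw [hfd]; exact hprob) hgrow' hVi hest'
  rwa [integral_sub hVi (integrable_const _), integral_const, probReal_univ, one_smul] at this

end IsSmoothModel

/-! ### The optimal inner sample size and the budget problem. -/

theorem nu_add_div_le {y : ℝ} {K : ℕ} (hK : 1 ≤ K) : (nu y : ℝ) + y / nu y ≤ K + y / K := by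
  obtain ⟨h1, h2⟩ := nu_mem y
  have hn : (0 : ℝ) < nu y := by exact_mod_cast h1
  have hK' : (0 : ℝ) < K := by exact_mod_cast hK
  -- Both factors of the numerator have the same sign: for `K` above `n = nu y` one has K n ≥ n(n+1)
  -- ≥ y, and for `K` below it minimality of `n` gives y > (n-1) n ≥ K n.
  have key : (K : ℝ) + y / K - (nu y + y / nu y) = (K - nu y) * (K * nu y - y) / (K * nu y) := by
    field_simp
    ring
  have : 0 ≤ ((K : ℝ) - nu y) * (K * nu y - y) := by
    rcases lt_trichotomy K (nu y) with hlt | heq | hgt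
    · have hlt' : (K : ℝ) + 1 ≤ nu y := by exact_mod_cast hlt
      obtain ⟨n, hn1⟩ := Nat.exists_eq_add_of_lt hlt
      have hnot : ¬(1 ≤ nu y - 1 ∧ y ≤ ((nu y - 1 : ℕ) : ℝ) * (((nu y - 1 : ℕ) : ℝ) + 1)) :=
        Nat.notMem_of_lt_sInf (s := {n : ℕ | 1 ≤ n ∧ y ≤ (n : ℝ) * ((n : ℝ) + 1)})
          (show nu y - 1 < nu y by omega)
      have hy : ((nu y : ℝ) - 1) * nu y < y := by
        by_contra! hcon
        refine hnot ⟨by omega, ?_⟩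
        rw [Nat.cast_sub h1]
        push_cast
        linarith
      refine mul_nonneg_of_nonpos_of_nonpos (by linarith) ?_
      nlinarith
    · simp [heq]
    · have hgt' : (nu y : ℝ) + 1 ≤ K := by exact_mod_cast hgt
      refine mul_nonneg (by linarith) ?_
      nlinarith
  have h3 : 0 ≤ ((K : ℝ) - nu y) * (K * nu y - y) / (K * nu y) := by positivity
  linarith

/-- `ν` minimises the limiting normalised risk at unit budget. -/
theorem one_add_nu_mul_le {CYX α β : ℝ} (hC : 0 < CYX) (hα : 0 < α) {K : ℕ} (hK : 1 ≤ K) :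
    (1 + (nu (β / (CYX * α)) : ℝ) * CYX) * (α + β / nu (β / (CYX * α))) ≤
      (1 + K * CYX) * (α + β / K) := by
  set y := β / (CYX * α) with hy
  have hβ : β = y * (CYX * α) := by rw [hy]; field_simp
  have hn : (0 : ℝ) < nu y := by exact_mod_cast (nu_mem y).1
  have hK' : (0 : ℝ) < K := by exact_mod_cast hK
  -- Expanding the product, only the combination `k + y / k` depends on `k`.
  have e : ∀ k : ℝ, 0 < k → (1 + k * CYX) * (α + β / k) =
      α + CYX * α * (k + y / k) + y * CYX * (CYX * α) := by
    intro k hk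
    rw [hβ]
    field_simp
    ring
  rw [e _ hn, e _ hK']
  have := nu_add_div_le (y := y) hK
  gcongr

/-- Asymptotic optimality of the allocation given by `ν`, for any array of risks of order `1 / N`
whose normalised lower limits are those of `α + β / K`. -/
theorem allocation_asymptotics {R : ℕ → ℕ → ℝ} {CYX α β δ : ℝ} (hC : 0 < CYX) (hα : 0 < α)
    (hβ : 0 ≤ β) (hδ : 0 < δ) (hlow : ∀ N K, 1 ≤ N → 1 ≤ K → δ / N ≤ R N K)
    (hliminf : ∀ K : ℕ, 1 ≤ K → ∀ ε > 0, ∀ᶠ N : ℕ in atTop, α + β / K - ε ≤ N * R N K)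
    {Kstar : ℕ} (hK : Kstar = nu (β / (CYX * α)))
    (hlim : Tendsto (fun N : ℕ => N * R N Kstar) atTop (𝓝 (α + β / Kstar)))
    {Nstar : ℝ → ℕ} (hN : ∀ c, Nstar c = ⌊c / (1 + (Kstar : ℝ) * CYX)⌋₊) :
    (∀ᶠ c : ℝ in atTop, 1 ≤ Nstar c ∧ 1 ≤ Kstar ∧
      (Nstar c : ℝ) + (Nstar c : ℝ) * (Kstar : ℝ) * CYX ≤ c) ∧
    (fun c : ℝ => R (Nstar c) Kstar) ~[atTop] fun c => budgetInf R CYX c := by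
  have hK1 : 1 ≤ Kstar := hK ▸ (nu_mem _).1
  have hK0 : (0 : ℝ) < Kstar := by exact_mod_cast hK1
  set L := 1 + (Kstar : ℝ) * CYX with hL
  have hL0 : 0 < L := by positivity
  set opt := L * (α + β / Kstar) with hopt
  have hopt0 : 0 < opt := by positivity
  have hdiv : Tendsto (fun c : ℝ => c / L) atTop atTop := tendsto_id.atTop_div_const hL0
  have hNt : Tendsto Nstar atTop atTop := by
    have : Nstar = fun c => ⌊c / L⌋₊ := funext hN
    rw [this]
    exact tendsto_nat_floor_atTop.comp hdiv
  have hfeas : ∀ᶠ c : ℝ in atTop, 1 ≤ Nstar c ∧ 1 ≤ Kstar ∧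
      (Nstar c : ℝ) + (Nstar c : ℝ) * (Kstar : ℝ) * CYX ≤ c := by
    filter_upwards [hNt.eventually_ge_atTop 1, eventually_ge_atTop 0] with c hc hc0
    refine ⟨hc, hK1, ?_⟩
    have h1 : (Nstar c : ℝ) ≤ c / L := by
      rw [hN]
      exact Nat.floor_le (by positivity)
    rw [le_div_iff₀ hL0] at h1
    rw [hL] at h1
    linarith
  refine ⟨hfeas, ?_⟩
  -- c R = L · (c/L)/N · (N R), and the rounding in N = ⌊c/L⌋ is negligible.
  have hup : Tendsto (fun c : ℝ => c * R (Nstar c) Kstar) atTop (𝓝 opt) := by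
    have h1 : Tendsto (fun c : ℝ => (⌊c / L⌋₊ : ℝ) / (c / L)) atTop (𝓝 1) :=
      tendsto_nat_floor_div_atTop.comp hdiv
    have h2 := (tendsto_const_nhds (x := L)).mul
      ((h1.inv₀ one_ne_zero).mul (hlim.comp hNt))
    rw [inv_one, one_mul] at h2
    refine h2.congr' ?_
    filter_upwards [hNt.eventually_ge_atTop 1, eventually_gt_atTop 0] with c hc hc0
    have hc' : (Nstar c : ℝ) ≠ 0 := by positivity
    simp only [Function.comp_apply, ← hN]
    field_simp
  have hpos : ∀ N K, 1 ≤ N → 1 ≤ K → 0 ≤ R N K := fun N K hN hK =>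
    (by positivity : 0 ≤ δ / (N : ℝ)).trans (hlow N K hN hK)
  have hlower : ∀ ε > 0, ∀ᶠ c : ℝ in atTop, ∀ N K : ℕ, 1 ≤ N → 1 ≤ K →
      (N : ℝ) + (N : ℝ) * (K : ℝ) * CYX ≤ c → opt - ε ≤ c * R N K := by
    intro ε hε
    -- Three regimes. For `K ≥ K₀` the cost per outer sample times `δ` already exceeds `opt`; for
    -- the finitely many `K < K₀` with `N ≥ N₀` the lower limits apply, with `ε'` reduced by the
    -- largest cost factor; for `N < N₀` the bound `δ / N` wins once `c` is large.
    obtain ⟨K₀, hK₀⟩ := exists_nat_ge (opt / (δ * CYX))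
    rw [div_le_iff₀ (by positivity)] at hK₀
    set ε' := ε / (1 + K₀ * CYX) with hε'
    have hε'0 : 0 < ε' := by positivity
    have hev : ∀ᶠ N : ℕ in atTop, ∀ K ∈ Finset.range K₀, 1 ≤ K → α + β / K - ε' ≤ N * R N K := by
      rw [Filter.eventually_all_finset]
      intro K _
      by_cases hK : 1 ≤ K
      · filter_upwards [hliminf K hK ε' hε'0] with N hN _ using hN
      · exact Eventually.of_forall fun N h => absurd h hK
    obtain ⟨N₀, hN₀⟩ := eventually_atTop.1 hev
    filter_upwards [eventually_ge_atTop (opt * N₀ / δ), eventually_ge_atTop 0]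
      with c hc hc0 N K hN1 hK1' hcost
    have hN' : (0 : ℝ) < N := by exact_mod_cast hN1
    have hR := hlow N K hN1 hK1'
    have hR0 := hpos N K hN1 hK1'
    have hcR : (1 + K * CYX) * (N * R N K) ≤ c * R N K := by
      calc (1 + K * CYX) * (N * R N K) = (N + N * K * CYX) * R N K := by ring
        _ ≤ c * R N K := by gcongr
    rw [div_le_iff₀ hN'] at hR
    rcases le_or_gt K₀ K with hKK | hKK
    · have hKK' : (K₀ : ℝ) ≤ K := by exact_mod_cast hKK
      have h1 : (1 + K * CYX) * δ ≤ (1 + K * CYX) * (N * R N K) := by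
        gcongr
        linarith
      have h2 : K₀ * (δ * CYX) ≤ K * (δ * CYX) := by gcongr
      nlinarith
    · rcases le_or_gt N₀ N with hNN | hNN
      · have h1 := hN₀ N hNN K (Finset.mem_range.2 hKK) hK1'
        have h2 : (1 + K * CYX) * (α + β / K - ε') ≤ (1 + K * CYX) * (N * R N K) := by gcongr
        have h3 := one_add_nu_mul_le (β := β) hC hα hK1'
        rw [← hK] at h3
        have hKK' : (K : ℝ) ≤ K₀ := by exact_mod_cast hKK.le
        have h4 : (1 + K * CYX) * ε' ≤ (1 + K₀ * CYX) * ε' := by gcongr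
        have h5 : (1 + K₀ * CYX) * ε' = ε := by
          rw [hε']
          field_simp
        linarith
      · have hNN' : (N : ℝ) ≤ N₀ := by exact_mod_cast hNN.le
        rw [div_le_iff₀ hδ] at hc
        have h1 : opt * N ≤ (c * R N K) * N := by
          calc opt * N ≤ opt * N₀ := by gcongr
            _ ≤ c * δ := hc
            _ ≤ c * (R N K * N) := by gcongr
            _ = _ := by ring
        have := le_of_mul_le_mul_right h1 hN'
        linarith
  -- The infimum is taken in `ℝ`, so the feasible risks must be nonempty, by the proposed
  -- allocation, and bounded below, by 0.
  have hset : ∀ᶠ c : ℝ in atTop, budgetInf R CYX c ≤ R (Nstar c) Kstar ∧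
      ∀ ε > 0, (∀ N K : ℕ, 1 ≤ N → 1 ≤ K → (N : ℝ) + (N : ℝ) * (K : ℝ) * CYX ≤ c →
        opt - ε ≤ c * R N K) → opt - ε ≤ c * budgetInf R CYX c := by
    filter_upwards [hfeas, eventually_gt_atTop 0] with c hc hc0
    refine ⟨csInf_le ⟨0, ?_⟩ ⟨Nstar c, Kstar, hc.1, hc.2.1, hc.2.2, rfl⟩, fun ε _ h => ?_⟩
    · rintro r ⟨N, K, hN1, hK1', -, rfl⟩
      exact hpos N K hN1 hK1'
    · rw [mul_comm, ← div_le_iff₀ hc0]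
      refine le_csInf ⟨_, Nstar c, Kstar, hc.1, hc.2.1, hc.2.2, rfl⟩ ?_
      rintro r ⟨N, K, hN1, hK1', hcost, rfl⟩
      rw [div_le_iff₀ hc0, mul_comm]
      exact h N K hN1 hK1' hcost
  have hinf : Tendsto (fun c : ℝ => c * budgetInf R CYX c) atTop (𝓝 opt) := by
    rw [tendsto_order]
    refine ⟨fun a ha => ?_, fun a ha => ?_⟩
    · filter_upwards [hlower ((opt - a) / 2) (by linarith), hset] with c h1 h2
      have := h2.2 _ (by linarith) h1
      linarith
    · filter_upwards [hset, (tendsto_order.1 hup).2 a ha, eventually_ge_atTop 0] with c h1 h2 h3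
      exact (mul_le_mul_of_nonneg_left h1.1 h3).trans_lt h2
  have hratio := hup.div hinf hopt0.ne'
  rw [div_self hopt0.ne'] at hratio
  have hne : ∀ᶠ c : ℝ in atTop, budgetInf R CYX c ≠ 0 := by
    filter_upwards [(tendsto_order.1 hinf).1 0 hopt0] with c hc h0
    simp [h0] at hc
  refine (isEquivalent_iff_tendsto_one hne).2 (hratio.congr' ?_)
  filter_upwards [eventually_gt_atTop 0] with c hc
  simp only [Pi.div_apply]
  exact mul_div_mul_left _ _ hc.ne'

/-! ### Reduction from almost surely smooth to everywhere smooth predictors. -/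

theorem measurable_biSup_of_continuousOn {E S : Type*} [TopologicalSpace E]
    [TopologicalSpace.PseudoMetrizableSpace E] [SecondCountableTopology E] [MeasurableSpace S]
    {U : Set E} {g : E → S → ENNReal} (hg : ∀ z, ContinuousOn (fun t => g t z) U)
    (hm : ∀ t ∈ U, Measurable (g t)) : Measurable fun z => ⨆ t ∈ U, g t z := by
  obtain ⟨D, hDU, hD, hUD⟩ :=
    (TopologicalSpace.IsSeparable.of_separableSpace U).exists_countable_dense_subset
  -- By continuity on `U` the uncountable supremum is already attained along a countable dense
  -- subset of `U`.
  have heq : (fun z => ⨆ t ∈ U, g t z) = fun z => ⨆ t ∈ D, g t z := by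
    funext z
    refine le_antisymm (iSup₂_le fun t ht => ?_) (biSup_mono hDU)
    have : (𝓝[D] t).NeBot := mem_closure_iff_nhdsWithin_neBot.1 (hUD ht)
    refine le_of_tendsto ((hg z t ht).mono_left (nhdsWithin_mono _ hDU)) ?_
    filter_upwards [self_mem_nhdsWithin] with s hs using le_iSup₂ (f := fun s _ => g s z) s hs
  rw [heq]
  exact Measurable.biSup D hD fun t ht => hm t (hDU ht)

theorem norm_le_sqrt_toReal_of_enorm_sq_le {F : Type*} [NormedAddCommGroup F] {a : F} {b : ENNReal}
    (hb : b < ⊤) (h : ‖a‖ₑ ^ 2 ≤ b) : ‖a‖ ≤ √b.toReal := by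
  refine Real.le_sqrt_of_sq_le ?_
  have := ENNReal.toReal_mono hb.ne h
  simpa using this

theorem memLp_sqrt_toReal {Ω : Type*} [MeasurableSpace Ω] {P : Measure Ω} {e : Ω → ENNReal}
    (he : Measurable e) (hfin : ∫⁻ ω, e ω ∂P < ⊤) : MemLp (fun ω => √(e ω).toReal) 2 P := by
  have hm : Measurable fun ω => √(e ω).toReal := he.ennreal_toReal.sqrt
  rw [memLp_two_iff_integrable_sq hm.aestronglyMeasurable]
  simp only [Real.sq_sqrt ENNReal.toReal_nonneg]
  exact integrable_toReal_of_lintegral_ne_top he.aemeasurable hfin.ne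

/-- A model whose predictors are almost surely smooth, with square integrable suprema, agrees
almost surely with one whose predictors are smooth everywhere. -/
theorem exists_isSmoothModel {Ω : Type*} [MeasurableSpace Ω] {d p q : ℕ} {P : Measure Ω}
    [IsProbabilityMeasure P]
    {X : Ω → EuclideanSpace ℝ (Fin d)} {Y : Ω → EuclideanSpace ℝ (Fin p)}
    (hX : Measurable X) (hY : Measurable Y)
    {f : EuclideanSpace ℝ (Fin p) → ℝ} (hf : Measurable f)
    (hf2 : MemLp (fun ω => f (Y ω)) 2 P)
    {φ : EuclideanSpace ℝ (Fin q) → EuclideanSpace ℝ (Fin d) → ℝ} (hφ : ∀ θ, Measurable (φ θ))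
    {C : Set (EuclideanSpace ℝ (Fin q))}
    (hsup : ∫⁻ ω, ⨆ θ ∈ C, ‖φ θ (X ω)‖ₑ ^ 2 ∂P < ⊤)
    (hcont : ∀ᵐ x ∂(P.map X), ContinuousOn (fun θ => φ θ x) C)
    (hC2 : ∀ᵐ x ∂(P.map X), ContDiffOn ℝ 2 (fun θ => φ θ x) (interior C))
    (hgrad : ∫⁻ ω, ⨆ θ ∈ interior C, ‖fderiv ℝ (fun t => φ t (X ω)) θ‖ₑ ^ 2 ∂P < ⊤)
    (hhess : ∫⁻ ω, ⨆ θ ∈ interior C, ‖fderiv ℝ (fderiv ℝ (fun t => φ t (X ω))) θ‖ₑ ^ 2 ∂P < ⊤) :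
    ∃ (φ' : EuclideanSpace ℝ (Fin q) → EuclideanSpace ℝ (Fin d) → ℝ)
      (D₀ D₁ D₂ : EuclideanSpace ℝ (Fin d) → ℝ), IsSmoothModel P X Y f φ' C D₀ D₁ D₂ ∧
      ∀ᵐ x ∂(P.map X), ∀ θ, φ' θ x = φ θ x := by
  classical
  -- restriction to a measurable set of smooth predictors
  obtain ⟨G, hGsub, hGm, hG⟩ : ∃ G : Set (EuclideanSpace ℝ (Fin d)), (∀ x ∈ G,
      ContinuousOn (fun θ => φ θ x) C ∧ ContDiffOn ℝ 2 (fun θ => φ θ x) (interior C)) ∧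
      MeasurableSet G ∧ ∀ᵐ x ∂(P.map X), x ∈ G := by
    obtain ⟨t, ht, htm, ht0⟩ := exists_measurable_superset_of_null (ae_iff.1 (hcont.and hC2))
    refine ⟨tᶜ, fun x hx => ?_, htm.compl, by rw [ae_iff]; simpa using ht0⟩
    by_contra hcon
    exact hx (ht hcon)
  -- The modification takes two rounds: the suprema are measurable only once every predictor is
  -- smooth, and only then can the set where they are finite be used.
  set ψ : EuclideanSpace ℝ (Fin q) → EuclideanSpace ℝ (Fin d) → ℝ :=
    fun θ x => if x ∈ G then φ θ x else 0 with hψ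
  have hψG : ∀ x ∈ G, (fun θ => ψ θ x) = fun θ => φ θ x := fun x hx => by
    funext θ
    simp [hψ, hx]
  have hψG' : ∀ x ∉ G, (fun θ => ψ θ x) = fun _ => 0 := fun x hx => by
    funext θ
    simp [hψ, hx]
  have hψm : ∀ θ, Measurable (ψ θ) := fun θ => (hφ θ).ite hGm measurable_const
  have hψc : ∀ x, ContinuousOn (fun θ => ψ θ x) C := fun x => by
    by_cases hx : x ∈ G
    · rw [hψG x hx]
      exact (hGsub x hx).1
    · rw [hψG' x hx]
      exact continuousOn_const
  have hψ2 : ∀ x, ContDiffOn ℝ 2 (fun θ => ψ θ x) (interior C) := fun x => by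
    by_cases hx : x ∈ G
    · rw [hψG x hx]
      exact (hGsub x hx).2
    · rw [hψG' x hx]
      exact contDiffOn_const
  have hd1 : ∀ x, ∀ θ ∈ interior C, DifferentiableAt ℝ (fun θ => ψ θ x) θ := fun x θ hθ =>
    ((hψ2 x).contDiffAt (isOpen_interior.mem_nhds hθ)).differentiableAt (by norm_num)
  have hc1 : ∀ x, ContDiffOn ℝ 1 (fderiv ℝ fun θ => ψ θ x) (interior C) := fun x =>
    (hψ2 x).fderiv_of_isOpen isOpen_interior (by norm_num)
  have hd2 : ∀ x, ∀ θ ∈ interior C, DifferentiableAt ℝ (fderiv ℝ fun θ => ψ θ x) θ :=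
    fun x θ hθ => ((hc1 x).contDiffAt (isOpen_interior.mem_nhds hθ)).differentiableAt (by norm_num)
  have hc2 : ∀ x, ContinuousOn (fderiv ℝ (fderiv ℝ fun θ => ψ θ x)) (interior C) := fun x =>
    (hc1 x).continuousOn_fderiv_of_isOpen isOpen_interior (by norm_num)
  have hm1 : ∀ θ ∈ interior C, StronglyMeasurable fun x => fderiv ℝ (fun θ => ψ θ x) θ :=
    fun θ hθ => stronglyMeasurable_fderiv_param isOpen_interior
      (fun s _ => (hψm s).stronglyMeasurable) (fun x _ hs => hd1 x _ hs) hθ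
  have hm2 : ∀ θ ∈ interior C,
      StronglyMeasurable fun x => fderiv ℝ (fderiv ℝ fun θ => ψ θ x) θ := fun θ hθ =>
    stronglyMeasurable_fderiv_param (F := fun s z => fderiv ℝ (fun θ => ψ θ z) s) isOpen_interior
      (fun _ hs => hm1 _ hs) (fun x _ hs => hd2 x _ hs) hθ
  -- the suprema are measurable
  set e₀ : EuclideanSpace ℝ (Fin d) → ENNReal := fun x => ⨆ θ ∈ C, ‖ψ θ x‖ₑ ^ 2 with he₀
  set e₁ : EuclideanSpace ℝ (Fin d) → ENNReal :=
    fun x => ⨆ θ ∈ interior C, ‖fderiv ℝ (fun t => ψ t x) θ‖ₑ ^ 2 with he₁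
  set e₂ : EuclideanSpace ℝ (Fin d) → ENNReal :=
    fun x => ⨆ θ ∈ interior C, ‖fderiv ℝ (fderiv ℝ fun t => ψ t x) θ‖ₑ ^ 2 with he₂
  have me₀ : Measurable e₀ := measurable_biSup_of_continuousOn
    (fun x => ((ENNReal.continuous_pow 2).comp continuous_enorm).comp_continuousOn (hψc x))
    fun θ _ => (hψm θ).enorm.pow_const 2
  have me₁ : Measurable e₁ := measurable_biSup_of_continuousOn
    (fun x => ((ENNReal.continuous_pow 2).comp continuous_enorm).comp_continuousOn
      (hc1 x).continuousOn)
    fun θ hθ => (hm1 θ hθ).enorm.pow_const 2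
  have me₂ : Measurable e₂ := measurable_biSup_of_continuousOn
    (fun x => ((ENNReal.continuous_pow 2).comp continuous_enorm).comp_continuousOn (hc2 x))
    fun θ hθ => (hm2 θ hθ).enorm.pow_const 2
  have hGX : ∀ᵐ ω ∂P, X ω ∈ G := ae_of_ae_map hX.aemeasurable hG
  have f₀ : ∫⁻ ω, e₀ (X ω) ∂P < ⊤ := by
    refine (lintegral_congr_ae ?_).trans_lt hsup
    filter_upwards [hGX] with ω hω
    simp [he₀, hψ, hω]
  have f₁ : ∫⁻ ω, e₁ (X ω) ∂P < ⊤ := by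
    refine (lintegral_congr_ae ?_).trans_lt hgrad
    filter_upwards [hGX] with ω hω
    simp only [he₁, hψG _ hω]
  have f₂ : ∫⁻ ω, e₂ (X ω) ∂P < ⊤ := by
    refine (lintegral_congr_ae ?_).trans_lt hhess
    filter_upwards [hGX] with ω hω
    simp only [he₂, hψG _ hω]
  -- restriction to finite suprema
  have hfin : ∀ e : EuclideanSpace ℝ (Fin d) → ENNReal, Measurable e → ∫⁻ ω, e (X ω) ∂P < ⊤ →
      ∀ᵐ x ∂(P.map X), e x < ⊤ := fun e he h =>
    ae_lt_top he (by rw [lintegral_map he hX]; exact h.ne)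
  set G' : Set (EuclideanSpace ℝ (Fin d)) := {x | e₀ x < ⊤ ∧ e₁ x < ⊤ ∧ e₂ x < ⊤} with hG'
  have hG'm : MeasurableSet G' := (measurableSet_lt me₀ measurable_const).inter
    ((measurableSet_lt me₁ measurable_const).inter (measurableSet_lt me₂ measurable_const))
  set φ' : EuclideanSpace ℝ (Fin q) → EuclideanSpace ℝ (Fin d) → ℝ :=
    fun θ x => if x ∈ G' then ψ θ x else 0 with hφ'
  have hφG : ∀ x ∈ G', (fun θ => φ' θ x) = fun θ => ψ θ x := fun x hx => by
    funext θ
    simp [hφ', hx]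
  have hφG' : ∀ x ∉ G', (fun θ => φ' θ x) = fun _ => 0 := fun x hx => by
    funext θ
    simp [hφ', hx]
  refine ⟨φ', fun x => √(e₀ x).toReal, fun x => √(e₁ x).toReal, fun x => √(e₂ x).toReal,
    ⟨hX, hY, hf, hf2, ⟨fun θ => (hψm θ).ite hG'm measurable_const, fun x => ?_, fun x => ?_,
      fun x θ hθ => ?_, fun x θ hθ => ?_, fun x θ hθ => ?_⟩, me₀.ennreal_toReal.sqrt,
      me₁.ennreal_toReal.sqrt, me₂.ennreal_toReal.sqrt, memLp_sqrt_toReal (me₀.comp hX) f₀,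
      memLp_sqrt_toReal (me₁.comp hX) f₁, memLp_sqrt_toReal (me₂.comp hX) f₂⟩, ?_⟩
  · by_cases hx : x ∈ G'
    · rw [hφG x hx]
      exact hψc x
    · rw [hφG' x hx]
      exact continuousOn_const
  · by_cases hx : x ∈ G'
    · rw [hφG x hx]
      exact hψ2 x
    · rw [hφG' x hx]
      exact contDiffOn_const
  · by_cases hx : x ∈ G'
    · rw [show φ' θ x = ψ θ x from congrFun (hφG x hx) θ, ← Real.norm_eq_abs]
      exact norm_le_sqrt_toReal_of_enorm_sq_le hx.1 (le_iSup₂ (f := fun θ _ => ‖ψ θ x‖ₑ ^ 2) θ hθ)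
    · rw [show φ' θ x = 0 from congrFun (hφG' x hx) θ, abs_zero]
      positivity
  · by_cases hx : x ∈ G'
    · rw [hφG x hx]
      exact norm_le_sqrt_toReal_of_enorm_sq_le hx.2.1
        (le_iSup₂ (f := fun θ _ => ‖fderiv ℝ (fun t => ψ t x) θ‖ₑ ^ 2) θ hθ)
    · rw [hφG' x hx]
      simp
  · by_cases hx : x ∈ G'
    · rw [hφG x hx]
      exact norm_le_sqrt_toReal_of_enorm_sq_le hx.2.2
        (le_iSup₂ (f := fun θ _ => ‖fderiv ℝ (fderiv ℝ fun t => ψ t x) θ‖ₑ ^ 2) θ hθ)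
    · rw [hφG' x hx]
      simp
  · filter_upwards [hG, hfin e₀ me₀ f₀, hfin e₁ me₁ f₁, hfin e₂ me₂ f₂] with x h0 h1 h2 h3 θ
    have hx : x ∈ G' := ⟨h1, h2, h3⟩
    rw [show φ' θ x = ψ θ x from congrFun (hφG x hx) θ]
    exact congrFun (hψG x h0) θ

/-! ### The two conclusions for smooth models. -/

namespace IsSmoothModel

variable {Ω : Type*} [MeasurableSpace Ω] {d p q : ℕ} {P : Measure Ω} [IsProbabilityMeasure P]
  {X : Ω → EuclideanSpace ℝ (Fin d)} {Y : Ω → EuclideanSpace ℝ (Fin p)}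
  {f : EuclideanSpace ℝ (Fin p) → ℝ}
  {φ : EuclideanSpace ℝ (Fin q) → EuclideanSpace ℝ (Fin d) → ℝ}
  {C : Set (EuclideanSpace ℝ (Fin q))} {D₀ D₁ D₂ : EuclideanSpace ℝ (Fin d) → ℝ}
  {x : EuclideanSpace ℝ (Fin q)}
  {Xs : ℕ → Ω → EuclideanSpace ℝ (Fin d)} {Ys : ℕ → ℕ → Ω → EuclideanSpace ℝ (Fin p)}

/-- The moment condition is assumed for one `K`, but its conclusion does not mention `K`: it
provides the score moments for all inner sample sizes at once. -/
theorem memLp_of_integrable (h : IsSmoothModel P X Y f φ C D₀ D₁ D₂)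
    (hs : IsNestedSample P X Y Xs Ys) (hx : x ∈ interior C) {K : ℕ} (hK : 1 ≤ K)
    (hint : Integrable (fun ω => (φ x (Xs 0 ω) - innerMean f Ys K 0 ω) ^ 2 *
        ‖gradient (fun t => φ t (Xs 0 ω)) x‖ ^ 2) P) (j : Fin q) :
    MemLp (fun ω => partialAt φ x j (X ω) * (φ x (X ω) - regMean P X Y f (X ω))) 2 P ∧
    MemLp (fun ω => partialAt φ x j (X ω) * (f (Y ω) - regMean P X Y f (X ω))) 2 P := by
  have hφm := h.smooth.measurable x
  have hgm := h.measurable_partialAt hx j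
  refine hs.memLp_of_memLp_mul_sub_innerMean h.measurable_X h.measurable_Y h.measurable_f h.memLp_f
    hK hgm hφm (h.memLp_apply (interior_subset hx)) ?_
  have hm : Measurable fun ω => partialAt φ x j (Xs 0 ω) *
      (φ x (Xs 0 ω) - innerMean f Ys K 0 ω) :=
    (hgm.comp (hs.measurable_fst 0)).mul ((hφm.comp (hs.measurable_fst 0)).sub
      (hs.measurable_innerMean h.measurable_f K 0))
  rw [memLp_two_iff_integrable_sq hm.aestronglyMeasurable]
  refine hint.mono' (hm.pow_const 2).aestronglyMeasurable (ae_of_all _ fun ω => ?_)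
  rw [Real.norm_of_nonneg (sq_nonneg _), mul_pow, mul_comm, norm_gradient_sq_eq_sum_partialAt]
  gcongr
  exact Finset.single_le_sum (f := fun j => partialAt φ x j (Xs 0 ω) ^ 2)
    (fun _ _ => sq_nonneg _) (Finset.mem_univ j)

theorem risk_expansion (h : IsSmoothModel P X Y f φ C D₀ D₁ D₂)
    (hs : IsNestedSample P X Y Xs Ys) (hC : IsCompact C) (hx : x ∈ interior C)
    (hmin : ∀ y ∈ C, y ≠ x → vInf P X Y f φ x < vInf P X Y f φ y)
    (hH : (hessianMatrix (vInf P X Y f φ) x).PosDef) {K : ℕ} (hK : 1 ≤ K)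
    (hint : Integrable (fun ω => (φ x (Xs 0 ω) - innerMean f Ys K 0 ω) ^ 2 *
        ‖gradient (fun t => φ t (Xs 0 ω)) x‖ ^ 2) P)
    {est : ℕ → Ω → EuclideanSpace ℝ (Fin q)} (hestm : ∀ N, 1 ≤ N → AEMeasurable (est N) P)
    (hest : ∀ N, 1 ≤ N → ∀ᵐ ω ∂P,
      est N ω ∈ C ∧ IsMinOn (vEmp f φ Xs Ys K N ω) C (est N ω))
    (hUI : UniformIntegrable (fun (N : ℕ) (ω : Ω) =>
        (N : ℝ) * (vInf P X Y f φ (est N ω) - vInf P X Y f φ x)) 1 P) :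
    (fun N : ℕ => (∫ ω, vInf P X Y f φ (est N ω) ∂P) - (vInf P X Y f φ x +
        2 * (matGamma P X Y f φ x K * (hessianMatrix (vInf P X Y f φ) x)⁻¹).trace / (N : ℝ)))
      =o[atTop] (fun N : ℕ => 1 / (N : ℝ)) := by
  have hmem := h.memLp_of_integrable hs hx hK hint
  have hlim := (h.risk_limit hs hC hx hmin hH (fun j => (hmem j).1) (fun j => (hmem j).2) hK hestm
    hest).2 hUI.unifIntegrable
  rw [isLittleO_iff_tendsto' ((eventually_ge_atTop 1).mono fun N hN h0 => by
    have : (0 : ℝ) < 1 / N := by positivity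
    exact absurd h0 this.ne')]
  have h0 := hlim.sub_const
    (2 * (matGamma P X Y f φ x K * (hessianMatrix (vInf P X Y f φ) x)⁻¹).trace)
  rw [sub_self] at h0
  refine h0.congr' ?_
  filter_upwards [eventually_ge_atTop 1] with N hN
  have hN' : (N : ℝ) ≠ 0 := by positivity
  field_simp
  ring

/-- Uniform integrability is used only at K⋆, for the upper bound on the infimum; the competing
pairs are handled by the lower limits and by the bound of order 1/N. -/
theorem optimal_allocation (h : IsSmoothModel P X Y f φ C D₀ D₁ D₂)
    (hs : IsNestedSample P X Y Xs Ys) (hC : IsCompact C) (hx : x ∈ interior C)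
    (hmin : ∀ y ∈ C, y ≠ x → vInf P X Y f φ x < vInf P X Y f φ y)
    {H : Matrix (Fin q) (Fin q) ℝ} (hHeq : H = hessianMatrix (vInf P X Y f φ) x) (hH : H.PosDef)
    {est : ℕ → ℕ → Ω → EuclideanSpace ℝ (Fin q)}
    (hestm : ∀ K N, 1 ≤ K → 1 ≤ N → AEMeasurable (est K N) P)
    (hest : ∀ K N, 1 ≤ K → 1 ≤ N → ∀ᵐ ω ∂P,
      est K N ω ∈ C ∧ IsMinOn (vEmp f φ Xs Ys K N ω) C (est K N ω))
    (hA0 : matA P X Y f φ x ≠ 0) {CYX : ℝ} (hCYX : 0 < CYX) {Kstar : ℕ} {Nstar : ℝ → ℕ}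
    (hK : Kstar = nu ((matB P X Y f φ x * H⁻¹).trace / (CYX * (matA P X Y f φ x * H⁻¹).trace)))
    (hN : ∀ c : ℝ, Nstar c = ⌊c / (1 + (Kstar : ℝ) * CYX)⌋₊)
    (hint : Integrable (fun ω => (φ x (Xs 0 ω) - innerMean f Ys Kstar 0 ω) ^ 2 *
        ‖gradient (fun t => φ t (Xs 0 ω)) x‖ ^ 2) P)
    (hUI : UniformIntegrable (fun (N : ℕ) (ω : Ω) =>
        (N : ℝ) * (vInf P X Y f φ (est Kstar N ω) - vInf P X Y f φ x)) 1 P) :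
    (∀ᶠ c : ℝ in atTop, 1 ≤ Nstar c ∧ 1 ≤ Kstar ∧
        (Nstar c : ℝ) + (Nstar c : ℝ) * (Kstar : ℝ) * CYX ≤ c) ∧
      (fun c : ℝ => (∫ ω, vInf P X Y f φ (est Kstar (Nstar c) ω) ∂P) - vInf P X Y f φ x)
        ~[atTop]
      (fun c : ℝ => budgetInf (fun N K =>
        (∫ ω, vInf P X Y f φ (est K N ω) ∂P) - vInf P X Y f φ x) CYX c) := by
  have hK1 : 1 ≤ Kstar := hK ▸ (nu_mem _).1
  have hmem := h.memLp_of_integrable hs hx hK1 hint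
  have hA := fun j => (hmem j).1
  have hB := fun j => (hmem j).2
  have hα := h.trace_matA_mul_inv_pos hA hA0 hH
  have hβ := h.trace_matB_mul_inv_nonneg hB hH
  obtain ⟨δ, hδ, hlow⟩ := h.exists_le_excess_risk hs hC hx hmin (hHeq ▸ hH) hA hB hA0
  have htr : ∀ K : ℕ, 2 * (matGamma P X Y f φ x K * H⁻¹).trace =
      2 * (matA P X Y f φ x * H⁻¹).trace + 2 * (matB P X Y f φ x * H⁻¹).trace / K := by
    intro K
    rw [matGamma, Matrix.add_mul, Matrix.trace_add, Matrix.smul_mul, Matrix.trace_smul,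
      smul_eq_mul]
    ring
  have hrisk := fun K hK => h.risk_limit hs hC hx hmin (hHeq ▸ hH) hA hB hK
    (fun N => hestm K N hK) fun N => hest K N hK
  simp only [← hHeq, htr] at hrisk
  exact allocation_asymptotics
    (R := fun N K => (∫ ω, vInf P X Y f φ (est K N ω) ∂P) - vInf P X Y f φ x)
    hCYX (by positivity : 0 < 2 * (matA P X Y f φ x * H⁻¹).trace)
    (by positivity : 0 ≤ 2 * (matB P X Y f φ x * H⁻¹).trace) hδ
    (fun N K hN hK => hlow K N _ hK hN (hestm K N hK hN) (hest K N hK hN))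
    (fun K hK => (hrisk K hK).1)
    -- The common factor 2 of α and β cancels in the argument of `nu`.
    (by rw [hK, mul_left_comm, mul_div_mul_left _ _ two_ne_zero])
    ((hrisk Kstar hK1).2 hUI.unifIntegrable) hN

end IsSmoothModel

end

/-- Hypotheses `hC2`, `hgrad`, `hhess` are only required on the interior of `C`, where the
derivatives of `φ(·, x)` are unambiguous; this is implied by any reading of "twice continuously
differentiable on `C`". The estimator `θ_N^K` is `est K N`. "Almost surely in `X`" means almost
everywhere for the law of `X`. The coefficient of `1/N` is `E[2 Gᵀ H G] = 2 tr(Γ^K H⁻¹)` with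
`G ∼ 𝓝(0, H⁻¹ Γ^K H⁻¹)`. -/
theorem mainTheorem1 {Ω : Type*} [MeasurableSpace Ω] (P : Measure Ω) [IsProbabilityMeasure P]
    (d p q : ℕ)
    (X : Ω → EuclideanSpace ℝ (Fin d)) (Y : Ω → EuclideanSpace ℝ (Fin p))
    (hX : Measurable X) (hY : Measurable Y)
    (f : EuclideanSpace ℝ (Fin p) → ℝ) (hf : Measurable f)
    (hf2 : MemLp (fun ω => f (Y ω)) 2 P)
    (φ : EuclideanSpace ℝ (Fin q) → EuclideanSpace ℝ (Fin d) → ℝ)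
    (hφ : ∀ θ, Measurable (φ θ)) (hφ2 : ∀ θ, MemLp (fun ω => φ θ (X ω)) 2 P)
    (Xs : ℕ → Ω → EuclideanSpace ℝ (Fin d)) (Ys : ℕ → ℕ → Ω → EuclideanSpace ℝ (Fin p))
    (hsample : IsNestedSample P X Y Xs Ys)
    (C : Set (EuclideanSpace ℝ (Fin q))) (hC : IsCompact C)
    (hsup : ∫⁻ ω, ⨆ θ ∈ C, ‖φ θ (X ω)‖ₑ ^ 2 ∂P < ⊤)
    (hcont : ∀ᵐ x ∂(P.map X), ContinuousOn (fun θ => φ θ x) C)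
    (θstar : EuclideanSpace ℝ (Fin q)) (hθstar : θstar ∈ interior C)
    (hmin : ∀ θ ∈ C, θ ≠ θstar → vInf P X Y f φ θstar < vInf P X Y f φ θ)
    (hC2 : ∀ᵐ x ∂(P.map X), ContDiffOn ℝ 2 (fun θ => φ θ x) (interior C))
    (hgrad : ∫⁻ ω, ⨆ θ ∈ interior C, ‖gradient (fun t => φ t (X ω)) θ‖ₑ ^ 2 ∂P < ⊤)
    (hhess : ∫⁻ ω, ⨆ θ ∈ interior C, ‖fderiv ℝ (fderiv ℝ (fun t => φ t (X ω))) θ‖ₑ ^ 2 ∂P < ⊤)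
    (H : Matrix (Fin q) (Fin q) ℝ) (hH : H = hessianMatrix (vInf P X Y f φ) θstar)
    (hHpos : H.PosDef)
    (est : ℕ → ℕ → Ω → EuclideanSpace ℝ (Fin q))
    (hest_meas : ∀ K N, 1 ≤ K → 1 ≤ N → AEMeasurable (est K N) P)
    (hest : ∀ K N, 1 ≤ K → 1 ≤ N → ∀ᵐ ω ∂P,
      est K N ω ∈ C ∧ IsMinOn (vEmp f φ Xs Ys K N ω) C (est K N ω)) :
    -- the expansion of the expected risk, for each fixed `K`
    (∀ K : ℕ, 1 ≤ K →
      Integrable (fun ω => (φ θstar (Xs 0 ω) - innerMean f Ys K 0 ω) ^ 2 *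
        ‖gradient (fun t => φ t (Xs 0 ω)) θstar‖ ^ 2) P →
      UniformIntegrable (fun (N : ℕ) (ω : Ω) =>
        (N : ℝ) * (vInf P X Y f φ (est K N ω) - vInf P X Y f φ θstar)) 1 P →
      (fun N : ℕ => (∫ ω, vInf P X Y f φ (est K N ω) ∂P) -
          (vInf P X Y f φ θstar + 2 * (matGamma P X Y f φ θstar K * H⁻¹).trace / (N : ℝ)))
        =o[atTop] (fun N : ℕ => 1 / (N : ℝ))) ∧
    -- the asymptotically optimal allocation for a budget `c → ∞`
    (matA P X Y f φ θstar ≠ 0 →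
      ∀ (CYX : ℝ), 0 < CYX → ∀ (Kstar : ℕ) (Nstar : ℝ → ℕ),
      Kstar = nu ((matB P X Y f φ θstar * H⁻¹).trace /
        (CYX * (matA P X Y f φ θstar * H⁻¹).trace)) →
      (∀ c : ℝ, Nstar c = ⌊c / (1 + (Kstar : ℝ) * CYX)⌋₊) →
      Integrable (fun ω => (φ θstar (Xs 0 ω) - innerMean f Ys Kstar 0 ω) ^ 2 *
        ‖gradient (fun t => φ t (Xs 0 ω)) θstar‖ ^ 2) P →
      UniformIntegrable (fun (N : ℕ) (ω : Ω) =>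
        (N : ℝ) * (vInf P X Y f φ (est Kstar N ω) - vInf P X Y f φ θstar)) 1 P →
      (∀ᶠ c : ℝ in atTop, 1 ≤ Nstar c ∧ 1 ≤ Kstar ∧
        (Nstar c : ℝ) + (Nstar c : ℝ) * (Kstar : ℝ) * CYX ≤ c) ∧
      (fun c : ℝ => (∫ ω, vInf P X Y f φ (est Kstar (Nstar c) ω) ∂P) - vInf P X Y f φ θstar)
        ~[atTop]
      (fun c : ℝ => budgetInf (fun N K =>
        (∫ ω, vInf P X Y f φ (est K N ω) ∂P) - vInf P X Y f φ θstar) CYX c)) := by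
  simp only [enorm_gradient] at hgrad
  obtain ⟨φ', D₀, D₁, D₂, hM, hφ'⟩ :=
    exists_isSmoothModel hX hY hf hf2 hφ hsup hcont hC2 hgrad hhess
  have hXφ : ∀ᵐ ω ∂P, ∀ θ, φ' θ (X ω) = φ θ (X ω) := ae_of_ae_map hX.aemeasurable hφ'
  -- Every X_i has the law of X, so the modified predictors agree almost surely along the sample.
  -- The empirical risks are then unchanged and the given estimators remain minimisers.
  have hXsφ : ∀ i, ∀ᵐ ω ∂P, ∀ θ, φ' θ (Xs i ω) = φ θ (Xs i ω) := fun i =>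
    ae_of_ae_map (hsample.measurable_fst i).aemeasurable
      ((hsample.identDistrib_fst hX hY i).map_eq ▸ hφ')
  have hv : vInf P X Y f φ = vInf P X Y f φ' := by
    funext θ
    refine integral_congr_ae ?_
    filter_upwards [hXφ] with ω hω
    rw [hω]
  have hA : matA P X Y f φ θstar = matA P X Y f φ' θstar := by
    ext i j
    refine integral_congr_ae ?_
    filter_upwards [hXφ] with ω hω
    rw [funext hω, hω]
  have hB : matB P X Y f φ θstar = matB P X Y f φ' θstar := by
    ext i j
    refine integral_congr_ae ?_
    filter_upwards [hXφ] with ω hω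
    rw [funext hω]
  have hest' : ∀ K N, 1 ≤ K → 1 ≤ N → ∀ᵐ ω ∂P,
      est K N ω ∈ C ∧ IsMinOn (vEmp f φ' Xs Ys K N ω) C (est K N ω) := by
    intro K N hK hN
    filter_upwards [hest K N hK hN, ae_all_iff.2 hXsφ] with ω h1 h2
    have : vEmp f φ' Xs Ys K N ω = vEmp f φ Xs Ys K N ω := by
      funext θ
      simp only [vEmp, h2]
    rw [this]
    exact h1
  have hI : ∀ K : ℕ, Integrable (fun ω => (φ θstar (Xs 0 ω) - innerMean f Ys K 0 ω) ^ 2 *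
        ‖gradient (fun t => φ t (Xs 0 ω)) θstar‖ ^ 2) P →
      Integrable (fun ω => (φ' θstar (Xs 0 ω) - innerMean f Ys K 0 ω) ^ 2 *
        ‖gradient (fun t => φ' t (Xs 0 ω)) θstar‖ ^ 2) P := by
    intro K hK
    refine hK.congr ?_
    filter_upwards [hXsφ 0] with ω hω
    rw [funext hω, hω]
  have hΓ : ∀ K, matGamma P X Y f φ θstar K = matGamma P X Y f φ' θstar K := fun K => by
    rw [matGamma, matGamma, hA, hB]
  simp only [hΓ, hA, hB]
  rw [hv] at hmin hH ⊢
  refine ⟨fun K hK hint hUI => ?_, fun hA0 CYX hCYX Kstar Nstar hK hN hint hUI => ?_⟩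
  · subst hH
    exact hM.risk_expansion hsample hC hθstar hmin hHpos hK (hI K hint)
      (fun N => hest_meas K N hK) (fun N => hest' K N hK) hUI
  · exact hM.optimal_allocation hsample hC hθstar hmin hH hHpos hest_meas hest' hA0 hCYX hK hN
      (hI Kstar hint) hUI
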